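/- Let $d\ge 1$ and let $a:\mathbb Z^d\to[0,\infty)$ satisfy $a(z)=a(-z)$, $\sum_z a(z)=1$, $a(0)=0$ and $a(z)>0$ if $|z|=1$; put $\mathcal L f(x)=\sum_{z}a(z)\,(f(x+z)-f(x))$. Let $b\in \ell^1(\mathbb Z^d)$ be real-valued and $B(x)=\sum_{z}b(x-z)b(-z)$, so that $B(x-y)=\sum_z b(x-z)b(y-z)$. Let $W(t,x)$, $t\ge0$, $x\in\mathbb Z^d$, be a Wiener process (relative to a filtration) with covariance $\langle W(s,x)W(t,y)\rangle=\min(s,t)\,B(x-y)$. For $\varkappa>0$ let $u$ be a solution of the lattice Anderson problem in the Itô sense, $$u(t,x)=1+\int_0^t\varkappa\,\mathcal L u(s,x)\,ds+\int_0^t u(s,x)\,dW(s,x),\qquad t\ge 0,\ x\in\mathbb Z^d,$$ in a weighted Hilbert space $L^2(\mathbb Z^d,\rho)$, that is, $u$ is adapted and jointly measurable and $\sup_{t\le T}\sum_x\rho(x)\langle u(t,x)^2\rangle<\infty$ for every $T$, where the weight $\rho>0$ is summable and $\sum_z a(z)\rho(x-z)\le C\rho(x)$ for all $x$ with some constant $C$.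 Put $M_p(t)=\langle u(t,0)^p\rangle$. Then for every integer $p\ge1$ the moment $M_p(t)$ is finite and positive for all $t\ge 0$, and the Lyapunov exponent $$\gamma_p(\varkappa)=\lim_{t\to\infty}\frac{\ln M_p(t)}{t}$$ exists, is finite, and depends only on $a$, $b$, $p$ and $\varkappa$. Moreover, for every integer $p\ge 3$ and every $\varkappa>0$, $$\frac{\gamma_p(\varkappa)}{p}\;\le\;\Big\lfloor \frac p2\Big\rfloor\,\gamma_2\!\Big(\frac{\varkappa}{p}\Big).$$ -/

import Mathlib

open MeasureTheory ProbabilityTheory Filter Topology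
open scoped NNReal ENNReal

noncomputable section

namespace Anderson

/-- The lattice `ℤ^d`. -/
abbrev Site (d : ℕ) : Type := Fin d → ℤ

/-- A jump law on `ℤ^d`: symmetric, non-negative, of total mass one, without mass at the origin,
and charging every point of Euclidean norm one (the points `± e_i`). -/
structure IsJumpLaw {d : ℕ} (a : Site d → ℝ) : Prop where
  nonneg : ∀ z, 0 ≤ a z
  symm : ∀ z, a (-z) = a z
  hasSum_one : HasSum a 1
  zero : a 0 = 0
  pos_unit : ∀ i : Fin d, 0 < a (Pi.single i 1)

/-- The non-local Laplacian `(L f)(x) = ∑_z a(z) (f(x+z) - f(x))`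
(the term with `z = 0` vanishes). -/
def laplacian {d : ℕ} (a : Site d → ℝ) (f : Site d → ℝ) (x : Site d) : ℝ :=
  ∑' z, a z * (f (x + z) - f x)

/-- The space correlator `B(x) = ∑_z b(x-z) b(-z)` of the kernel `b`, so that
`B(x-y) = ∑_z b(x-z) b(y-z)`. -/
def correlator {d : ℕ} (b : Site d → ℝ) (x : Site d) : ℝ :=
  ∑' z, b (x - z) * b (-z)

/-- A weight for which the averaging operator of `a`, hence the non-local Laplacian, is bounded on
the weighted Hilbert space of functions `f` with `∑_x ρ(x) f(x)^2 < ∞`. -/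
structure IsAdmissibleWeight {d : ℕ} (a ρ : Site d → ℝ) : Prop where
  pos : ∀ x, 0 < ρ x
  summable : Summable ρ
  averaging : ∃ C : ℝ, ∀ x, ∑' z, a z * ρ (x - z) ≤ C * ρ x

variable {Ω : Type*} {mΩ : MeasurableSpace Ω}

/-- A Wiener process `W(t,x)` relative to the filtration `𝓕` with covariance
`⟨W(s,x) W(t,y)⟩ = min(s,t) B(x-y)`: the time integral of a Gaussian field that is white in time
and has space correlator `B`. -/
structure IsWienerField {d : ℕ} (𝓕 : Filtration ℝ≥0 mΩ) (μ : Measure Ω) (B : Site d → ℝ)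
    (W : ℝ≥0 → Site d → Ω → ℝ) : Prop where
  gaussian : IsGaussianProcess (fun q : ℝ≥0 × Site d => W q.1 q.2) μ
  mean_zero : ∀ t x, ∫ ω, W t x ω ∂μ = 0
  covariance : ∀ s t x y, cov[W s x, W t y; μ] = (min s t : ℝ≥0) * B (x - y)
  continuous_paths : ∀ x, ∀ᵐ ω ∂μ, Continuous fun t => W t x ω
  adapted : ∀ t x, Measurable[𝓕 t] (W t x)
  indep_increments : ∀ s t, s ≤ t →
    Indep (MeasurableSpace.comap (fun ω x => W t x ω - W s x ω) MeasurableSpace.pi) (𝓕 s) μ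

/-- A simple process: `coef k` on the time interval `(time k, time (k+1)]`, `k < n`, where `coef k`
is bounded and measurable with respect to the past of `time k`. -/
structure SimpleProcess (𝓕 : Filtration ℝ≥0 mΩ) where
  n : ℕ
  time : ℕ → ℝ≥0
  mono : Monotone time
  coef : ℕ → Ω → ℝ
  measurable : ∀ k, Measurable[𝓕 (time k)] (coef k)
  bounded : ∀ k, ∃ C : ℝ, ∀ ω, |coef k ω| ≤ C

namespace SimpleProcess

variable {𝓕 : Filtration ℝ≥0 mΩ}

/-- The value of a simple process at time `s`. -/
def eval (φ : SimpleProcess 𝓕) (s : ℝ≥0) (ω : Ω) : ℝ :=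
  ∑ k ∈ Finset.range φ.n,
    (Set.Ioc (φ.time k) (φ.time (k + 1))).indicator (fun _ => φ.coef k ω) s

/-- The elementary stochastic integral `∫_0^t φ dM` of a simple process. -/
def integral (φ : SimpleProcess 𝓕) (M : ℝ≥0 → Ω → ℝ) (t : ℝ≥0) (ω : Ω) : ℝ :=
  ∑ k ∈ Finset.range φ.n,
    φ.coef k ω * (M (min (φ.time (k + 1)) t) ω - M (min (φ.time k) t) ω)

end SimpleProcess

/-- `I` is (a version of) the Itô integral `∫_0^t X dM`: for some sequence of simple processes
converging to `X` in `L²([0,t] × Ω)`, the elementary integrals converge to `I` in `L²(Ω)`. -/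
def IsItoIntegral (𝓕 : Filtration ℝ≥0 mΩ) (μ : Measure Ω) (M X : ℝ≥0 → Ω → ℝ) (t : ℝ≥0)
    (I : Ω → ℝ) : Prop :=
  ∃ φ : ℕ → SimpleProcess 𝓕,
    Tendsto (fun n => ∫⁻ ω, ∫⁻ s in Set.Ioc (0 : ℝ) t,
      ‖X s.toNNReal ω - (φ n).eval s.toNNReal ω‖ₑ ^ 2 ∂volume ∂μ) atTop (𝓝 0) ∧
    Tendsto (fun n => ∫⁻ ω, ‖I ω - (φ n).integral M t ω‖ₑ ^ 2 ∂μ) atTop (𝓝 0)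

/-- `u` solves the lattice Anderson problem `∂u/∂t = κ L u + u dW/dt`, `u(0,·) = 1`, in the Itô sense
`u(t,x) = 1 + ∫_0^t κ (L u)(s,x) ds + ∫_0^t u(s,x) dW(s,x)`, in a weighted Hilbert space on which `L`
is bounded. -/
structure IsSolution {d : ℕ} (𝓕 : Filtration ℝ≥0 mΩ) (μ : Measure Ω) (a : Site d → ℝ) (κ : ℝ)
    (W u : ℝ≥0 → Site d → Ω → ℝ) : Prop where
  measurable : ∀ x, Measurable fun q : ℝ≥0 × Ω => u q.1 x q.2
  adapted : ∀ t x, Measurable[𝓕 t] (u t x)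
  square_bound : ∃ ρ : Site d → ℝ, IsAdmissibleWeight a ρ ∧ ∀ T : ℝ≥0, ∃ C : ℝ≥0, ∀ t ≤ T,
    ∑' x, ENNReal.ofReal (ρ x) * ∫⁻ ω, ‖u t x ω‖ₑ ^ 2 ∂μ ≤ C
  equation : ∀ t x, IsItoIntegral 𝓕 μ (fun s => W s x) (fun s => u s x) t
    (fun ω => u t x ω - 1 - ∫ s in (0 : ℝ)..t, κ * laplacian a (fun y => u s.toNNReal y ω) x)

/-- The mixed moment `m_p(t, x_1, …, x_p) = ⟨u(t,x_1) ⋯ u(t,x_p)⟩`. -/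
def mixedMoment {d : ℕ} (μ : Measure Ω) (u : ℝ≥0 → Site d → Ω → ℝ) {p : ℕ} (t : ℝ≥0)
    (x : Fin p → Site d) : ℝ :=
  ∫ ω, ∏ i, u t (x i) ω ∂μ

/-- The `p`-th moment `M_p(t) = m_p(t, 0, …, 0) = ⟨u(t,0)^p⟩`. -/
def fieldMoment {d : ℕ} (μ : Measure Ω) (u : ℝ≥0 → Site d → Ω → ℝ) (p : ℕ) (t : ℝ≥0) : ℝ :=
  mixedMoment μ u t (fun _ : Fin p => (0 : Site d))

/-- The Lyapunov exponent of the `p`-th moment exists and equals `γ`: the `p`-th moment is finite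
and positive at all times, and `ln M_p(t) / t → γ` as `t → ∞`. -/
structure HasLyapunovExponent {d : ℕ} (μ : Measure Ω) (u : ℝ≥0 → Site d → Ω → ℝ) (p : ℕ)
    (γ : ℝ) : Prop where
  integrable : ∀ t, Integrable (fun ω => u t 0 ω ^ p) μ
  moment_pos : ∀ t, 0 < fieldMoment μ u p t
  tendsto : Tendsto (fun t : ℝ≥0 => Real.log (fieldMoment μ u p t) / (t : ℝ)) atTop (𝓝 γ)

end Anderson

end

open MeasureTheory ProbabilityTheory Filter Topology
open scoped NNReal ENNReal

noncomputable section

namespace Anderson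

section

section LTwo

variable {α : Type*}

/-- The `ℓ²` norm of a function with values in `[0, ∞]`. -/
def l2 (f : α → ℝ≥0∞) : ℝ≥0∞ := (∑' x, f x ^ 2) ^ (1 / 2 : ℝ)

lemma l2_sq (f : α → ℝ≥0∞) : l2 f ^ 2 = ∑' x, f x ^ 2 := by
  rw [l2, ← ENNReal.rpow_natCast, ← ENNReal.rpow_mul]; norm_num

lemma le_of_sq_le_sq {a b : ℝ≥0∞} (h : a ^ 2 ≤ b ^ 2) : a ≤ b :=
  (ENNReal.pow_le_pow_left_iff two_ne_zero).1 h

lemma l2_le_iff {f : α → ℝ≥0∞} {c : ℝ≥0∞} : l2 f ≤ c ↔ ∑' x, f x ^ 2 ≤ c ^ 2 := by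
  rw [← l2_sq]; exact (ENNReal.pow_le_pow_left_iff two_ne_zero).symm

lemma l2_mono {f g : α → ℝ≥0∞} (h : ∀ x, f x ≤ g x) : l2 f ≤ l2 g := by
  rw [l2_le_iff, l2_sq]
  exact ENNReal.tsum_le_tsum fun x => by gcongr; exact h x

lemma l2_const_mul (c : ℝ≥0∞) (f : α → ℝ≥0∞) : l2 (fun x => c * f x) = c * l2 f := by
  have : l2 (fun x => c * f x) ^ 2 = (c * l2 f) ^ 2 := by
    rw [l2_sq, mul_pow, l2_sq, ← ENNReal.tsum_mul_left]
    simp_rw [mul_pow]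
  exact le_antisymm (le_of_sq_le_sq this.le) (le_of_sq_le_sq this.ge)

lemma l2_zero : l2 (fun _ : α => (0 : ℝ≥0∞)) = 0 := by
  simp [l2]

lemma le_l2 (f : α → ℝ≥0∞) (x : α) : f x ≤ l2 f := by
  apply le_of_sq_le_sq
  rw [l2_sq]
  exact ENNReal.le_tsum x

lemma tsum_mul_le_l2_mul_l2 (f g : α → ℝ≥0∞) : ∑' x, f x * g x ≤ l2 f * l2 g := by
  let _ : MeasurableSpace α := ⊤
  have h := ENNReal.lintegral_mul_le_Lp_mul_Lq (Measure.count (α := α))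
    (p := 2) (q := 2) Real.HolderConjugate.two_two
    (f := f) (g := g) measurable_from_top.aemeasurable measurable_from_top.aemeasurable
  simpa [lintegral_count' measurable_from_top, l2] using h

lemma l2_add_le (f g : α → ℝ≥0∞) : l2 (fun x => f x + g x) ≤ l2 f + l2 g := by
  let _ : MeasurableSpace α := ⊤
  have h := ENNReal.lintegral_Lp_add_le (μ := Measure.count (α := α)) (p := 2)
    (f := f) (g := g) measurable_from_top.aemeasurable measurable_from_top.aemeasurable
    (by norm_num)
  simpa [lintegral_count' measurable_from_top, l2] using h

lemma l2_sum_le {ι : Type*} (s : Finset ι) (f : ι → α → ℝ≥0∞) :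
    l2 (fun x => ∑ i ∈ s, f i x) ≤ ∑ i ∈ s, l2 (f i) := by
  classical
  induction s using Finset.induction_on with
  | empty => simp [l2_zero]
  | insert i s hi ih =>
    simp_rw [Finset.sum_insert hi]
    exact (l2_add_le _ _).trans (by gcongr)

lemma sq_tsum_mul_le (w f : α → ℝ≥0∞) :
    (∑' s, w s * f s) ^ 2 ≤ (∑' s, w s) * ∑' s, w s * f s ^ 2 := by
  have hw : ∀ s, (w s ^ (1 / 2 : ℝ)) ^ 2 = w s := fun s => by
    rw [← ENNReal.rpow_natCast, ← ENNReal.rpow_mul]; norm_num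
  have h := tsum_mul_le_l2_mul_l2 (fun s => w s ^ (1 / 2 : ℝ)) (fun s => w s ^ (1 / 2 : ℝ) * f s)
  have h2 : ∀ s, w s ^ (1 / 2 : ℝ) * (w s ^ (1 / 2 : ℝ) * f s) = w s * f s := fun s => by
    rw [← mul_assoc, ← sq, hw]
  simp_rw [h2] at h
  calc (∑' s, w s * f s) ^ 2 ≤ (l2 (fun s => w s ^ (1 / 2 : ℝ)) *
        l2 (fun s => w s ^ (1 / 2 : ℝ) * f s)) ^ 2 := by gcongr
    _ = _ := by rw [mul_pow, l2_sq, l2_sq]; simp_rw [mul_pow, hw]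

end LTwo

/-- A symmetric hopping operator on a group: jumps by `shift s` with weight `weight s`, and a
bounded multiplication operator. -/
structure Hopping (Γ σ : Type*) [AddCommGroup Γ] where
  weight : σ → ℝ≥0∞
  shift : σ → Γ
  diag : Γ → ℝ≥0∞
  diagBound : ℝ≥0∞
  refl : σ ≃ σ
  weight_refl : ∀ s, weight (refl s) = weight s
  shift_refl : ∀ s, shift (refl s) = -shift s
  weight_ne_top : ∑' s, weight s ≠ ⊤
  diagBound_ne_top : diagBound ≠ ⊤
  diag_le : ∀ x, diag x ≤ diagBound

namespace Hopping

variable {Γ σ : Type*} [AddCommGroup Γ] (G : Hopping Γ σ)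

/-- The action of a hopping operator on functions with values in `[0, ∞]`. -/
def op (f : Γ → ℝ≥0∞) (x : Γ) : ℝ≥0∞ :=
  ∑' s, G.weight s * f (x + G.shift s) + G.diag x * f x

/-- The `ℓ²` operator norm of a hopping operator. -/
def norm : ℝ≥0∞ := ⨆ f : Γ → ℝ≥0∞, l2 (G.op f) / l2 f

variable {G}

lemma op_mono {f g : Γ → ℝ≥0∞} (h : ∀ x, f x ≤ g x) (x : Γ) : G.op f x ≤ G.op g x := by
  unfold op
  gcongr
  · exact h _
  · exact h _

lemma iterate_op_mono {f g : Γ → ℝ≥0∞} (h : ∀ x, f x ≤ g x) (n : ℕ) (x : Γ) :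
    (G.op^[n] f) x ≤ (G.op^[n] g) x := by
  induction n generalizing x with
  | zero => exact h x
  | succ n ih =>
    rw [Function.iterate_succ_apply', Function.iterate_succ_apply']
    exact op_mono ih x

lemma op_const_mul (c : ℝ≥0∞) (f : Γ → ℝ≥0∞) :
    G.op (fun x => c * f x) = fun x => c * G.op f x := by
  ext x
  simp only [op, mul_add, ← ENNReal.tsum_mul_left]
  congr 1
  · exact tsum_congr fun s => by ring
  · ring

lemma iterate_op_const_mul (c : ℝ≥0∞) (f : Γ → ℝ≥0∞) (n : ℕ) :
    G.op^[n] (fun x => c * f x) = fun x => c * (G.op^[n] f) x := by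
  induction n with
  | zero => rfl
  | succ n ih => rw [Function.iterate_succ_apply', ih, op_const_mul, Function.iterate_succ_apply']

lemma tsum_weight_refl (f : Γ → ℝ≥0∞) (y : Γ) :
    ∑' s, G.weight s * f (y - G.shift s) = ∑' s, G.weight s * f (y + G.shift s) := by
  rw [← G.refl.tsum_eq]
  exact tsum_congr fun s => by rw [G.weight_refl, G.shift_refl, sub_neg_eq_add]

lemma tsum_mul_op (f g : Γ → ℝ≥0∞) : ∑' x, f x * G.op g x = ∑' x, G.op f x * g x := by
  simp only [op, mul_add, add_mul]
  rw [ENNReal.tsum_add, ENNReal.tsum_add]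
  congr 1
  · simp_rw [← tsum_weight_refl f, ← ENNReal.tsum_mul_left, ← ENNReal.tsum_mul_right]
    rw [ENNReal.tsum_comm, ENNReal.tsum_comm (f := fun x s => _ * f (x - _) * g x)]
    refine tsum_congr fun s => ?_
    rw [← (Equiv.addRight (G.shift s)).tsum_eq (fun x => G.weight s * f (x - G.shift s) * g x)]
    refine tsum_congr fun x => ?_
    simp only [Equiv.coe_addRight, add_sub_cancel_right]
    ring
  · exact tsum_congr fun x => by ring

lemma tsum_mul_iterate_op (f g : Γ → ℝ≥0∞) (n : ℕ) :
    ∑' x, f x * (G.op^[n] g) x = ∑' x, (G.op^[n] f) x * g x := by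
  induction n generalizing f with
  | zero => rfl
  | succ n ih =>
    rw [Function.iterate_succ_apply', tsum_mul_op, ih, Function.iterate_succ_apply]

lemma l2_op_le_bound (f : Γ → ℝ≥0∞) :
    l2 (G.op f) ≤ (∑' s, G.weight s + G.diagBound) * l2 f := by
  have h1 : l2 (fun x => ∑' s, G.weight s * f (x + G.shift s)) ≤ (∑' s, G.weight s) * l2 f := by
    rw [l2_le_iff, mul_pow, l2_sq]
    calc ∑' x, (∑' s, G.weight s * f (x + G.shift s)) ^ 2
        ≤ ∑' x, (∑' s, G.weight s) * ∑' s, G.weight s * f (x + G.shift s) ^ 2 :=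
          ENNReal.tsum_le_tsum fun x => sq_tsum_mul_le _ _
      _ = (∑' s, G.weight s) * ∑' s, G.weight s * ∑' x, f x ^ 2 := by
          rw [ENNReal.tsum_mul_left, ENNReal.tsum_comm]
          congr 1
          refine tsum_congr fun s => ?_
          rw [ENNReal.tsum_mul_left]
          congr 1
          exact (Equiv.addRight (G.shift s)).tsum_eq (fun x => f x ^ 2)
      _ = _ := by rw [ENNReal.tsum_mul_right]; ring
  have h2 : l2 (fun x => G.diag x * f x) ≤ G.diagBound * l2 f := by
    rw [← l2_const_mul]
    exact l2_mono fun x => by gcongr; exact G.diag_le x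
  calc l2 (G.op f) ≤ _ := l2_add_le _ _
    _ ≤ _ := by rw [add_mul]; gcongr

lemma norm_le {C : ℝ≥0∞} (h : ∀ f, l2 f ≠ ⊤ → l2 (G.op f) ≤ C * l2 f) :
    G.norm ≤ C := by
  refine iSup_le fun f => ?_
  rcases eq_or_ne (l2 f) ⊤ with hf | hf
  · rw [hf, ENNReal.div_top]; exact zero_le
  · exact ENNReal.div_le_of_le_mul (h f hf)

lemma norm_ne_top : G.norm ≠ ⊤ :=
  ne_top_of_le_ne_top (ENNReal.add_ne_top.2 ⟨G.weight_ne_top, G.diagBound_ne_top⟩)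
    (norm_le fun f _ => l2_op_le_bound f)

lemma l2_op_le {f : Γ → ℝ≥0∞} (hf : l2 f ≠ ⊤) : l2 (G.op f) ≤ G.norm * l2 f := by
  rcases eq_or_ne (l2 f) 0 with h0 | h0
  · have := l2_op_le_bound (G := G) f
    rw [h0, mul_zero] at this ⊢
    exact this
  · rw [← ENNReal.div_le_iff h0 hf]
    exact le_iSup (fun f => l2 (G.op f) / l2 f) f

lemma op_eq_tsum_single [DecidableEq Γ] (f : Γ → ℝ≥0∞) (x : Γ) :
    G.op f x = ∑' y, f y * G.op (Pi.single y 1) x := by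
  have key : ∀ z, f z = ∑' y, f y * (Pi.single y (1 : ℝ≥0∞) : Γ → ℝ≥0∞) z := fun z => by
    rw [tsum_eq_single z]
    · simp
    · intro y hy; simp [hy.symm]
  simp only [op, mul_add]
  rw [ENNReal.tsum_add]
  congr 1
  · simp_rw [← ENNReal.tsum_mul_left]
    rw [ENNReal.tsum_comm]
    refine tsum_congr fun s => ?_
    conv_lhs => rw [key (x + G.shift s)]
    rw [← ENNReal.tsum_mul_left]
    exact tsum_congr fun y => by ring
  · conv_lhs => rw [key x]
    rw [← ENNReal.tsum_mul_left]
    exact tsum_congr fun y => by ring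

lemma exists_finite_lt {c : ℝ≥0∞} (hc : c < G.norm) :
    ∃ (t : Finset Γ) (f : Γ → ℝ≥0∞), (∀ x ∉ t, f x = 0) ∧ l2 f ≠ 0 ∧ l2 f ≠ ⊤ ∧
      c * l2 f ≤ l2 (G.op f) := by
  classical
  obtain ⟨f, hf⟩ := lt_iSup_iff.1 hc
  have h0 : l2 f ≠ 0 := by
    intro h
    have := l2_op_le_bound (G := G) f
    rw [h, mul_zero, nonpos_iff_eq_zero] at this
    rw [this, ENNReal.zero_div] at hf
    exact not_lt_zero hf
  have ht : l2 f ≠ ⊤ := by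
    intro h
    rw [h, ENNReal.div_top] at hf
    exact not_lt_zero hf
  rw [ENNReal.lt_div_iff_mul_lt (Or.inl h0) (Or.inl ht)] at hf
  have hsq : (c * l2 f) ^ 2 < ∑' x, G.op f x ^ 2 := by
    rw [← l2_sq]; exact ENNReal.pow_lt_pow_left two_ne_zero hf
  rw [ENNReal.tsum_eq_iSup_sum] at hsq
  obtain ⟨r, hr⟩ := lt_iSup_iff.1 hsq
  have hop : ∀ (t : Finset Γ) x, G.op (fun y => if y ∈ t then f y else 0) x
      = ∑ y ∈ t, f y * G.op (Pi.single y 1) x := by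
    intro t x
    rw [op_eq_tsum_single, tsum_eq_sum (s := t)]
    · exact Finset.sum_congr rfl fun y hy => by simp [hy]
    · intro y hy; simp [hy]
  have htend : Tendsto (fun t : Finset Γ => ∑ x ∈ r, G.op (fun y => if y ∈ t then f y else 0) x ^ 2)
      atTop (𝓝 (∑ x ∈ r, G.op f x ^ 2)) := by
    refine tendsto_finsetSum _ fun x _ => ?_
    refine ((ENNReal.continuous_pow 2).tendsto _).comp ?_
    simp_rw [hop]
    rw [op_eq_tsum_single]
    exact ENNReal.summable.hasSum
  have hne : ∀ᶠ t : Finset Γ in atTop, l2 (fun y => if y ∈ t then f y else 0) ≠ 0 := by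
    have : ∃ x, f x ≠ 0 := by
      by_contra! h
      exact h0 (by rw [show f = fun _ => 0 from funext h, l2_zero])
    obtain ⟨x, hx⟩ := this
    filter_upwards [eventually_ge_atTop {x}] with t ht' h
    have := le_l2 (fun y => if y ∈ t then f y else 0) x
    rw [h] at this
    have hxt : x ∈ t := ht' (Finset.mem_singleton_self x)
    simp [hxt] at this
    exact hx this
  obtain ⟨t, h1, h2⟩ := (((htend.eventually_const_lt hr)).and
    hne).exists
  have hle : l2 (fun y => if y ∈ t then f y else 0) ≤ l2 f :=
      l2_mono fun x => by split_ifs <;> simp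
  refine ⟨t, _, fun x hx => by simp [hx], h2, ne_top_of_le_ne_top ht hle, ?_⟩
  apply le_of_sq_le_sq
  calc (c * l2 (fun y => if y ∈ t then f y else 0)) ^ 2 ≤ (c * l2 f) ^ 2 := by gcongr
      _ ≤ _ := h1.le
      _ ≤ _ := by rw [l2_sq]; exact ENNReal.sum_le_tsum r

lemma l2_iterate_ne_top {f : Γ → ℝ≥0∞} (hf : l2 f ≠ ⊤) (n : ℕ) : l2 (G.op^[n] f) ≠ ⊤ := by
  induction n with
  | zero => exact hf
  | succ n ih =>
    rw [Function.iterate_succ_apply']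
    exact ne_top_of_le_ne_top (ENNReal.mul_ne_top norm_ne_top ih) (l2_op_le ih)

lemma pow_mul_l2_le {f : Γ → ℝ≥0∞} {c : ℝ≥0∞} (hf : l2 f ≠ ⊤)
    (h : c * l2 f ≤ l2 (G.op f)) (n : ℕ) : c ^ n * l2 f ≤ l2 (G.op^[n] f) := by
  have step : ∀ n, c * l2 (G.op^[n] f) ≤ l2 (G.op^[n + 1] f) := by
    intro n
    induction n with
    | zero => exact h
    | succ n ih =>
      rcases eq_or_ne (l2 (G.op^[n + 1] f)) 0 with h0 | h0
      · rw [h0, mul_zero]; exact zero_le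
      have hcs : l2 (G.op^[n + 1] f) ^ 2 ≤ l2 (G.op^[n] f) * l2 (G.op^[n + 2] f) := by
        calc l2 (G.op^[n + 1] f) ^ 2 = ∑' x, (G.op^[n + 1] f) x * (G.op^[n + 1] f) x := by
              rw [l2_sq]; simp_rw [sq]
          _ = ∑' x, (G.op^[n] f) x * (G.op^[n + 2] f) x := by
              rw [show n + 2 = (n + 1) + 1 from rfl, Function.iterate_succ_apply' G.op (n + 1),
                tsum_mul_op, Function.iterate_succ_apply' G.op n]
          _ ≤ _ := tsum_mul_le_l2_mul_l2 _ _
      have ht := l2_iterate_ne_top (G := G) hf (n + 1)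
      have : l2 (G.op^[n + 1] f) * (c * l2 (G.op^[n + 1] f)) ≤
          l2 (G.op^[n + 1] f) * l2 (G.op^[n + 2] f) := by
        calc _ = c * l2 (G.op^[n + 1] f) ^ 2 := by ring
          _ ≤ c * (l2 (G.op^[n] f) * l2 (G.op^[n + 2] f)) := by gcongr
          _ = (c * l2 (G.op^[n] f)) * l2 (G.op^[n + 2] f) := by ring
          _ ≤ _ := by gcongr
      exact (ENNReal.mul_le_mul_iff_right h0 ht).1 this
  induction n with
  | zero => simp
  | succ n ih =>
    calc c ^ (n + 1) * l2 f = c * (c ^ n * l2 f) := by ring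
      _ ≤ c * l2 (G.op^[n] f) := by gcongr
      _ ≤ _ := step n

end Hopping

end

section

namespace Hopping

variable {Γ σ : Type*} [AddCommGroup Γ] {G : Hopping Γ σ}

/-- `y` can be reached from `x` by finitely many jumps. -/
def Reach (G : Hopping Γ σ) (x y : Γ) : Prop :=
  ∃ m : ℕ, ∃ c : ℝ≥0∞, c ≠ 0 ∧ ∀ g : Γ → ℝ≥0∞, c * g y ≤ (G.op^[m] g) x

lemma pow_mul_le_iterate {δ : ℝ≥0∞} (hδ : ∀ x, δ ≤ G.diag x) (g : Γ → ℝ≥0∞) (n : ℕ) (x : Γ) :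
    δ ^ n * g x ≤ (G.op^[n] g) x := by
  induction n generalizing x with
  | zero => simp
  | succ n ih =>
    rw [Function.iterate_succ_apply']
    calc δ ^ (n + 1) * g x = δ * (δ ^ n * g x) := by ring
      _ ≤ G.diag x * (G.op^[n] g) x := by gcongr; exacts [hδ x, ih x]
      _ ≤ _ := le_add_self

lemma exists_uniform_reach {δ : ℝ≥0∞} (hδ0 : δ ≠ 0) (hδ : ∀ x, δ ≤ G.diag x)
    (hr : ∀ x, G.Reach 0 x) (t : Finset Γ) :
    ∃ M : ℕ, ∃ c : ℝ≥0∞, c ≠ 0 ∧ ∀ g : Γ → ℝ≥0∞, ∀ x ∈ t, c * g x ≤ (G.op^[M] g) 0 := by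
  classical
  induction t using Finset.induction_on with
  | empty => exact ⟨0, 1, one_ne_zero, by simp⟩
  | insert y t hy ih =>
    obtain ⟨M, c, hc, h⟩ := ih
    obtain ⟨m, c', hc', h'⟩ := hr y
    refine ⟨M + m, min (δ ^ m * c) (δ ^ M * c'), ?_, fun g x hx => ?_⟩
    · exact (lt_min (pos_iff_ne_zero.2 (mul_ne_zero (pow_ne_zero _ hδ0) hc))
        (pos_iff_ne_zero.2 (mul_ne_zero (pow_ne_zero _ hδ0) hc'))).ne'
    rcases Finset.mem_insert.1 hx with rfl | hx
    · calc _ ≤ δ ^ M * c' * g x := by gcongr; exact min_le_right _ _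
        _ = δ ^ M * (c' * g x) := by ring
        _ ≤ δ ^ M * (G.op^[m] g) 0 := by gcongr; exact h' g
        _ ≤ (G.op^[M] (G.op^[m] g)) 0 := pow_mul_le_iterate hδ _ _ _
        _ = _ := by rw [Function.iterate_add_apply]
    · calc _ ≤ δ ^ m * c * g x := by gcongr; exact min_le_left _ _
        _ = δ ^ m * (c * g x) := by ring
        _ ≤ δ ^ m * (G.op^[M] g) 0 := by gcongr; exact h g x hx
        _ ≤ (G.op^[m] (G.op^[M] g)) 0 := pow_mul_le_iterate hδ _ _ _
        _ = _ := by rw [add_comm, Function.iterate_add_apply]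

lemma iterate_one_le (n : ℕ) (x : Γ) :
    (G.op^[n] fun _ => 1) x ≤ (∑' s, G.weight s + G.diagBound) ^ n := by
  induction n generalizing x with
  | zero => simp
  | succ n ih =>
    rw [Function.iterate_succ_apply', op, pow_succ', add_mul, ← ENNReal.tsum_mul_right]
    gcongr
    · exact ih _
    · exact G.diag_le x
    · exact ih _

lemma iterate_one_ne_top (n : ℕ) (x : Γ) : (G.op^[n] fun _ => 1) x ≠ ⊤ :=
  ne_top_of_le_ne_top (ENNReal.pow_ne_top
    (ENNReal.add_ne_top.2 ⟨G.weight_ne_top, G.diagBound_ne_top⟩)) (iterate_one_le n x)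

lemma exists_lower {δ : ℝ≥0∞} (hδ0 : δ ≠ 0) (hδ : ∀ x, δ ≤ G.diag x)
    (hr : ∀ x, G.Reach 0 x) {c : ℝ≥0∞} (hc : c < G.norm) :
    ∃ A : ℝ≥0∞, A ≠ 0 ∧ ∃ M : ℕ, ∀ k : ℕ,
      A * c ^ (2 * k) ≤ (G.op^[M + 2 * k] fun _ => 1) 0 := by
  obtain ⟨t, f, hft, hf0, hftop, hcf⟩ := exists_finite_lt hc
  obtain ⟨M, e, he, hM⟩ := exists_uniform_reach hδ0 hδ hr t
  set S := ∑ x ∈ t, f x with hS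
  have hSt : S ≠ ⊤ := by
    refine (ENNReal.sum_lt_top.2 fun x _ => ?_).ne
    exact (ne_top_of_le_ne_top hftop (le_l2 f x)).lt_top
  have hfS : ∀ x, f x ≤ S * 1 := fun x => by
    by_cases hx : x ∈ t
    · rw [mul_one]; exact Finset.single_le_sum (f := f) (fun _ _ => zero_le) hx
    · rw [hft x hx]; exact zero_le
  have hS0 : S ≠ 0 := by
    intro h
    have : f = fun _ => 0 := funext fun x => by simpa [h] using hfS x
    exact hf0 (by rw [this, l2_zero])
  refine ⟨e * (l2 f ^ 2 / S ^ 2), ?_, M, fun k => ?_⟩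
  · exact mul_ne_zero he (ENNReal.div_ne_zero.2 ⟨pow_ne_zero 2 hf0, ENNReal.pow_ne_top hSt⟩)
  have h1 : (c ^ k * l2 f) ^ 2 ≤ ∑' x, f x * (G.op^[2 * k] f) x := by
    calc (c ^ k * l2 f) ^ 2 ≤ l2 (G.op^[k] f) ^ 2 := by
          gcongr; exact pow_mul_l2_le hftop hcf k
      _ = ∑' x, (G.op^[k] f) x * (G.op^[k] f) x := by rw [l2_sq]; simp_rw [sq]
      _ = _ := by rw [← tsum_mul_iterate_op, ← Function.iterate_add_apply, two_mul]
  have h2 : ∀ x, (G.op^[2 * k] f) x ≤ S * (G.op^[2 * k] fun _ => 1) x := fun x => by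
    have := iterate_op_mono (G := G) hfS (2 * k) x
    rwa [iterate_op_const_mul] at this
  have h3 : e * (c ^ k * l2 f) ^ 2 ≤ S ^ 2 * (G.op^[M + 2 * k] fun _ => 1) 0 := by
    calc e * (c ^ k * l2 f) ^ 2 ≤ e * ∑' x, f x * (G.op^[2 * k] f) x := by gcongr
      _ = ∑ x ∈ t, e * (f x * (G.op^[2 * k] f) x) := by
          rw [tsum_eq_sum (s := t), Finset.mul_sum]
          intro x hx; rw [hft x hx, zero_mul]
      _ ≤ ∑ x ∈ t, f x * (S * (G.op^[M + 2 * k] fun _ => 1) 0) := by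
          refine Finset.sum_le_sum fun x hx => ?_
          calc e * (f x * (G.op^[2 * k] f) x)
              ≤ e * (f x * (S * (G.op^[2 * k] fun _ => 1) x)) := by gcongr; exact h2 x
            _ = f x * (S * (e * (G.op^[2 * k] fun _ => 1) x)) := by ring
            _ ≤ _ := by
                rw [Function.iterate_add_apply]
                gcongr
                exact hM _ x hx
      _ = _ := by rw [← Finset.sum_mul, ← hS]; ring
  have h4 : e * (l2 f ^ 2 / S ^ 2) * c ^ (2 * k) = e * (c ^ k * l2 f) ^ 2 / S ^ 2 := by
    rw [pow_mul', div_eq_mul_inv, div_eq_mul_inv]; ring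
  rw [h4]
  exact ENNReal.div_le_of_le_mul' h3

lemma exists_upper {ε : ℝ≥0∞} {r : Γ → ℝ≥0∞} (hr0 : r 0 ≠ 0) (hr : l2 r ≠ ⊤) (F : Set σ)
    (hF : ∀ s ∈ F, ∀ x, r x ≤ (1 + ε) * r (x + G.shift s))
    (htail : ∀ x, ∑' s : (Fᶜ : Set σ), G.weight s * r (x - G.shift s) ^ 2 ≤ ε ^ 2 * r x ^ 2)
    (n : ℕ) :
    (G.op^[n] fun _ => 1) 0 ≤
      l2 r / r 0 * ((1 + ε) * G.norm + ε * (1 + ∑' s, G.weight s)) ^ n := by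
  classical
  set K := (1 + ε) * G.norm + ε * (1 + ∑' s, G.weight s)
  rcases eq_or_ne ε ⊤ with rfl | hε
  · rcases n with _ | n
    · simp only [Function.iterate_zero, id, pow_zero, mul_one]
      rw [ENNReal.le_div_iff_mul_le (Or.inl hr0)
        (Or.inl (ne_top_of_le_ne_top hr (le_l2 r 0))), one_mul]
      exact le_l2 r 0
    · have hK : K = ⊤ := by simp [K]
      rw [hK, ENNReal.top_pow (Nat.succ_ne_zero n), ENNReal.mul_top]
      · exact le_top
      · refine ENNReal.div_ne_zero.2 ⟨?_, ne_top_of_le_ne_top hr (le_l2 r 0)⟩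
        exact (lt_of_lt_of_le (pos_iff_ne_zero.2 hr0) (le_l2 r 0)).ne'
  have hK : K ≠ ⊤ := by
    refine ENNReal.add_ne_top.2 ⟨ENNReal.mul_ne_top (by simp [hε]) norm_ne_top,
      ENNReal.mul_ne_top hε (by simp [G.weight_ne_top])⟩
  have step : ∀ h : Γ → ℝ≥0∞, l2 (fun x => r x * h x) ≠ ⊤ →
      l2 (fun x => r x * G.op h x) ≤ K * l2 (fun x => r x * h x) := by
    intro h hh
    set E : Γ → ℝ≥0∞ := fun x => ∑' s : (Fᶜ : Set σ), G.weight s * h (x + G.shift s) with hE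
    have hpt : ∀ x, r x * G.op h x ≤ (1 + ε) * G.op (fun x => r x * h x) x + r x * E x := by
      intro x
      have hsplit : ∑' s, G.weight s * h (x + G.shift s)
          = ∑' s : F, G.weight s * h (x + G.shift s) + E x :=
        (ENNReal.summable.tsum_add_tsum_compl (s := F)
          (f := fun s => G.weight s * h (x + G.shift s)) ENNReal.summable).symm
      have h1 : r x * ∑' s : F, G.weight s * h (x + G.shift s) ≤
          (1 + ε) * ∑' s, G.weight s * (r (x + G.shift s) * h (x + G.shift s)) := by
        calc r x * ∑' s : F, G.weight s * h (x + G.shift s)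
            = ∑' s : F, r x * (G.weight s * h (x + G.shift s)) := ENNReal.tsum_mul_left.symm
          _ ≤ ∑' s : F, (1 + ε) * (G.weight s * (r (x + G.shift s) * h (x + G.shift s))) := by
              refine ENNReal.tsum_le_tsum fun s => ?_
              calc r x * (G.weight s * h (x + G.shift s))
                  ≤ ((1 + ε) * r (x + G.shift s)) * (G.weight s * h (x + G.shift s)) := by
                    gcongr; exact hF s s.2 x
                _ = _ := by ring
          _ ≤ _ := by
              rw [ENNReal.tsum_mul_left]
              gcongr
              exact ENNReal.tsum_comp_le_tsum_of_injective Subtype.val_injective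
                (fun s => G.weight s * (r (x + G.shift s) * h (x + G.shift s)))
      calc r x * G.op h x = r x * ∑' s : F, G.weight s * h (x + G.shift s) + r x * E x
            + G.diag x * (r x * h x) := by rw [op, hsplit]; ring
        _ ≤ (1 + ε) * ∑' s, G.weight s * (r (x + G.shift s) * h (x + G.shift s)) + r x * E x
            + (1 + ε) * (G.diag x * (r x * h x)) := by
            exact add_le_add (add_le_add h1 le_rfl) (le_mul_of_one_le_left zero_le le_self_add)
        _ = _ := by rw [op]; ring
    have hEbd : l2 (fun x => r x * E x) ≤ ε * (1 + ∑' s, G.weight s) * l2 (fun x => r x * h x) := by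
      rw [l2_le_iff, mul_pow, l2_sq]
      set w' := ∑' s, G.weight s
      have hw' : ∑' s : (Fᶜ : Set σ), G.weight s ≤ w' :=
        ENNReal.tsum_comp_le_tsum_of_injective Subtype.val_injective G.weight
      calc ∑' x, (r x * E x) ^ 2
          ≤ ∑' x, r x ^ 2 * (w' * ∑' s : (Fᶜ : Set σ), G.weight s * h (x + G.shift s) ^ 2) := by
            refine ENNReal.tsum_le_tsum fun x => ?_
            rw [mul_pow]
            gcongr
            refine (sq_tsum_mul_le (fun s : (Fᶜ : Set σ) => G.weight s) _).trans ?_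
            gcongr
        _ = w' * ∑' x, ∑' s : (Fᶜ : Set σ), r x ^ 2 * (G.weight s * h (x + G.shift s) ^ 2) := by
            rw [← ENNReal.tsum_mul_left]
            refine tsum_congr fun x => ?_
            rw [ENNReal.tsum_mul_left]; ring
        _ = w' * ∑' y, ∑' s : (Fᶜ : Set σ), G.weight s * r (y - G.shift s) ^ 2 * h y ^ 2 := by
            rw [ENNReal.tsum_comm,
              ENNReal.tsum_comm (f := fun y (s : (Fᶜ : Set σ)) => _ * _ * h y ^ 2)]
            congr 1
            refine tsum_congr fun s => ?_
            rw [← (Equiv.addRight (G.shift s)).tsum_eq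
              (fun y => G.weight s * r (y - G.shift s) ^ 2 * h y ^ 2)]
            refine tsum_congr fun x => ?_
            simp only [Equiv.coe_addRight, add_sub_cancel_right]
            ring
        _ ≤ w' * ∑' y, ε ^ 2 * r y ^ 2 * h y ^ 2 := by
            gcongr with y
            rw [ENNReal.tsum_mul_right]
            gcongr
            exact htail y
        _ = ε ^ 2 * w' * ∑' y, (r y * h y) ^ 2 := by
            simp_rw [mul_assoc, ENNReal.tsum_mul_left, mul_pow]; ring
        _ ≤ _ := by
            rw [mul_pow]
            gcongr
            calc w' ≤ 1 + w' := le_add_self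
              _ ≤ (1 + w') ^ 2 := by
                rw [sq]; exact le_mul_of_one_le_left zero_le le_self_add
    calc l2 (fun x => r x * G.op h x)
        ≤ l2 (fun x => (1 + ε) * G.op (fun x => r x * h x) x + r x * E x) := l2_mono hpt
      _ ≤ (1 + ε) * l2 (G.op (fun x => r x * h x)) + l2 (fun x => r x * E x) := by
          rw [← l2_const_mul]; exact l2_add_le _ _
      _ ≤ (1 + ε) * (G.norm * l2 (fun x => r x * h x))
          + ε * (1 + ∑' s, G.weight s) * l2 (fun x => r x * h x) := by
          gcongr; exact l2_op_le hh
      _ = _ := by rw [add_mul]; ring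
  have main : ∀ n, l2 (fun x => r x * (G.op^[n] fun _ => 1) x) ≤ K ^ n * l2 r := by
    intro n
    induction n with
    | zero => simp
    | succ n ih =>
      simp_rw [Function.iterate_succ_apply']
      refine (step _ (ne_top_of_le_ne_top (ENNReal.mul_ne_top (ENNReal.pow_ne_top hK) hr) ih)).trans ?_
      rw [pow_succ', mul_assoc]
      gcongr
  rw [div_eq_mul_inv, mul_right_comm, ← div_eq_mul_inv,
    ENNReal.le_div_iff_mul_le (Or.inl hr0) (Or.inl (ne_top_of_le_ne_top hr (le_l2 r 0)))]
  calc _ = r 0 * (G.op^[n] fun _ => 1) 0 := mul_comm _ _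
    _ ≤ _ := le_l2 (fun x => r x * (G.op^[n] fun _ => 1) x) 0
    _ ≤ _ := main n
    _ = _ := mul_comm _ _

/-- Positive summable functions that vary slowly along finitely many given jumps exist. -/
def SlowlyVarying (G : Hopping Γ σ) : Prop :=
  ∀ ε : ℝ≥0∞, ε ≠ 0 → ∀ F : Finset σ, ∃ ρ : Γ → ℝ≥0∞, ρ 0 ≠ 0 ∧ ∑' x, ρ x ≠ ⊤ ∧
    ∀ s ∈ F, ∀ x, ρ x ≤ (1 + ε) * ρ (x + G.shift s)

lemma exists_weight (hG : G.SlowlyVarying) {ε : ℝ≥0∞} (hε : ε ≠ 0) (hε' : ε ≠ ⊤) :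
    ∃ r : Γ → ℝ≥0∞, r 0 ≠ 0 ∧ l2 r ≠ ⊤ ∧ ∃ F : Set σ,
      (∀ s ∈ F, ∀ x, r x ≤ (1 + ε) * r (x + G.shift s)) ∧
      ∀ x, ∑' s : (Fᶜ : Set σ), G.weight s * r (x - G.shift s) ^ 2 ≤ ε ^ 2 * r x ^ 2 := by
  have htend := ENNReal.tendsto_tsum_compl_atTop_zero G.weight_ne_top
  have hpos : 0 < ε ^ 2 / 2 := ENNReal.div_pos (pow_ne_zero 2 hε) (by norm_num)
  obtain ⟨F, hFη⟩ := (htend.eventually_lt_const hpos).exists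
  obtain ⟨ρ, hρ0, hρs, hρF⟩ := hG ε hε F
  set T : (Γ → ℝ≥0∞) → Γ → ℝ≥0∞ := fun f x =>
    ∑' s : {s // s ∉ F}, G.weight s * f (x - G.shift s) with hT
  set η := ∑' s : {s // s ∉ F}, G.weight s with hη
  have hTsum : ∀ f, ∑' x, T f x = η * ∑' x, f x := fun f => by
    simp only [hT]
    rw [ENNReal.tsum_comm, hη, ← ENNReal.tsum_mul_right]
    refine tsum_congr fun s => ?_
    rw [ENNReal.tsum_mul_left]
    congr 1
    exact (Equiv.subRight (G.shift s)).tsum_eq f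
  have hTn : ∀ n, ∑' x, (T^[n] ρ) x = η ^ n * ∑' x, ρ x := fun n => by
    induction n with
    | zero => simp
    | succ n ih => rw [Function.iterate_succ_apply', hTsum, ih]; ring
  have hTF : ∀ n, ∀ s ∈ F, ∀ x, (T^[n] ρ) x ≤ (1 + ε) * (T^[n] ρ) (x + G.shift s) := by
    intro n
    induction n with
    | zero => exact hρF
    | succ n ih =>
      intro s hs x
      rw [Function.iterate_succ_apply']
      simp only [hT, ← ENNReal.tsum_mul_left]
      refine ENNReal.tsum_le_tsum fun u => ?_
      calc G.weight u * (T^[n] ρ) (x - G.shift u)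
          ≤ G.weight u * ((1 + ε) * (T^[n] ρ) (x - G.shift u + G.shift s)) := by
            gcongr; exact ih s hs _
        _ = _ := by rw [sub_add_eq_add_sub]; ring
  set R : Γ → ℝ≥0∞ := fun x => ∑' n : ℕ, (ε ^ 2)⁻¹ ^ n * (T^[n] ρ) x with hR
  have hRF : ∀ s ∈ F, ∀ x, R x ≤ (1 + ε) * R (x + G.shift s) := fun s hs x => by
    simp only [hR, ← ENNReal.tsum_mul_left]
    refine ENNReal.tsum_le_tsum fun n => ?_
    calc _ ≤ (ε ^ 2)⁻¹ ^ n * ((1 + ε) * (T^[n] ρ) (x + G.shift s)) := by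
          gcongr; exact hTF n s hs x
      _ = _ := by ring
  have he0 : ε ^ 2 ≠ 0 := pow_ne_zero 2 hε
  have het : ε ^ 2 ≠ ⊤ := ENNReal.pow_ne_top hε'
  have hTR : ∀ x, T R x ≤ ε ^ 2 * R x := fun x => by
    have : T R x = ∑' n : ℕ, (ε ^ 2)⁻¹ ^ n * (T^[n + 1] ρ) x := by
      simp only [hT, hR, ← ENNReal.tsum_mul_left]
      rw [ENNReal.tsum_comm]
      refine tsum_congr fun n => ?_
      rw [Function.iterate_succ_apply', ← ENNReal.tsum_mul_left]
      exact tsum_congr fun s => by ring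
    rw [this]
    calc _ = ∑' n : ℕ, ε ^ 2 * ((ε ^ 2)⁻¹ ^ (n + 1) * (T^[n + 1] ρ) x) := by
          refine tsum_congr fun n => ?_
          rw [pow_succ' (ε ^ 2)⁻¹, ← mul_assoc, ← mul_assoc, ENNReal.mul_inv_cancel he0 het,
            one_mul]
      _ = ε ^ 2 * ∑' n : ℕ, ((ε ^ 2)⁻¹ ^ (n + 1) * (T^[n + 1] ρ) x) := ENNReal.tsum_mul_left
      _ ≤ _ := by
          gcongr
          exact ENNReal.tsum_comp_le_tsum_of_injective (add_left_injective 1)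
            (fun n => (ε ^ 2)⁻¹ ^ n * (T^[n] ρ) x)
  have hRs : ∑' x, R x ≠ ⊤ := by
    simp only [hR]
    rw [ENNReal.tsum_comm]
    have hle : ∑' n, ∑' x, (ε ^ 2)⁻¹ ^ n * (T^[n] ρ) x ≤ ∑' n : ℕ, 2⁻¹ ^ n * ∑' x, ρ x := by
      refine ENNReal.tsum_le_tsum fun n => ?_
      rw [ENNReal.tsum_mul_left, hTn, ← mul_assoc, ← mul_pow]
      gcongr
      calc (ε ^ 2)⁻¹ * η ≤ (ε ^ 2)⁻¹ * (ε ^ 2 / 2) := by gcongr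
        _ = 2⁻¹ := by rw [div_eq_mul_inv, ← mul_assoc, ENNReal.inv_mul_cancel he0 het, one_mul]
    refine ne_top_of_le_ne_top ?_ hle
    rw [ENNReal.tsum_mul_right]
    refine ENNReal.mul_ne_top ?_ hρs
    rw [ENNReal.tsum_geometric]
    simp
  have hrsq : ∀ x, (R x ^ (1 / 2 : ℝ)) ^ 2 = R x := fun x => by
    rw [← ENNReal.rpow_natCast, ← ENNReal.rpow_mul]; norm_num
  refine ⟨fun x => R x ^ (1 / 2 : ℝ), ?_, ?_, F, ?_, ?_⟩
  · have h0 : R 0 ≠ 0 := by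
      have : ρ 0 ≤ R 0 := by
        have := ENNReal.le_tsum (f := fun n : ℕ => (ε ^ 2)⁻¹ ^ n * (T^[n] ρ) 0) 0
        simpa using this
      exact (lt_of_lt_of_le (pos_iff_ne_zero.2 hρ0) this).ne'
    intro h
    have := hrsq 0
    rw [show R 0 ^ (1 / 2 : ℝ) = 0 from h] at this
    exact h0 (by simpa using this.symm)
  · have : l2 (fun x => R x ^ (1 / 2 : ℝ)) ^ 2 ≠ ⊤ := by
      rw [l2_sq]; simp_rw [hrsq]; exact hRs
    intro h
    rw [h] at this
    simp at this
  · intro s hs x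
    apply le_of_sq_le_sq
    rw [mul_pow, hrsq, hrsq]
    calc R x ≤ (1 + ε) * R (x + G.shift s) := hRF s hs x
      _ ≤ _ := by
        gcongr
        rw [sq]; exact le_mul_of_one_le_left zero_le le_self_add
  · intro x
    simp_rw [hrsq]
    exact hTR x

end Hopping

end

section

lemma exists_pos_le_of_parity {h : ℕ → ℝ} (hpos : ∀ n, 0 < h n) {δ c A : ℝ} (hδ : 0 < δ)
    (hc : 0 < c) (hA : 0 < A) (M : ℕ) (hstep : ∀ n, δ * h n ≤ h (n + 1))
    (hM : ∀ k, A * c ^ (2 * k) ≤ h (M + 2 * k)) : ∃ A' > 0, ∀ n, A' * c ^ n ≤ h n := by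
  have hsmall : ∃ A' > 0, ∀ n < M, A' * c ^ n ≤ h n := by
    clear hM
    induction M with
    | zero => exact ⟨1, one_pos, by simp⟩
    | succ M ih =>
      obtain ⟨A', hA', h'⟩ := ih
      refine ⟨min A' (h M / c ^ M), lt_min hA' (div_pos (hpos M) (pow_pos hc M)), fun n hn => ?_⟩
      rcases Nat.lt_succ_iff_lt_or_eq.1 hn with hn | rfl
      · exact le_trans (by gcongr; exact min_le_left _ _) (h' n hn)
      · calc _ ≤ h n / c ^ n * c ^ n := by gcongr; exact min_le_right _ _
          _ = h n := by field_simp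
  obtain ⟨A', hA', h'⟩ := hsmall
  refine ⟨min A' (min (A / c ^ M) (δ * A / c ^ (M + 1))), by positivity, fun n => ?_⟩
  rcases lt_or_ge n M with hn | hn
  · exact le_trans (by gcongr; exact min_le_left _ _) (h' n hn)
  obtain ⟨j, rfl⟩ := Nat.exists_eq_add_of_le hn
  rcases Nat.even_or_odd' j with ⟨k, rfl | rfl⟩
  · calc _ ≤ A / c ^ M * c ^ (M + 2 * k) := by
          gcongr; exact (min_le_right _ _).trans (min_le_left _ _)
      _ = A * c ^ (2 * k) := by rw [pow_add]; field_simp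
      _ ≤ _ := hM k
  · calc _ ≤ δ * A / c ^ (M + 1) * c ^ (M + (2 * k + 1)) := by
          gcongr; exact (min_le_right _ _).trans (min_le_right _ _)
      _ = δ * (A * c ^ (2 * k)) := by
          rw [show M + (2 * k + 1) = (M + 1) + 2 * k by ring, pow_add c (M + 1)]; field_simp
      _ ≤ δ * h (M + 2 * k) := by gcongr; exact hM k
      _ ≤ _ := hstep _

lemma summable_pow_div_factorial_mul {h : ℕ → ℝ} (h0 : ∀ n, 0 ≤ h n) {A c : ℝ}
    (hle : ∀ n, h n ≤ A * c ^ n) {t : ℝ} (ht : 0 ≤ t) :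
    Summable fun k : ℕ => t ^ k / k.factorial * h k := by
  refine Summable.of_nonneg_of_le (fun k => mul_nonneg (by positivity) (h0 k)) (fun k => ?_)
    ((Real.summable_pow_div_factorial (t * c)).mul_left A)
  calc t ^ k / k.factorial * h k ≤ t ^ k / k.factorial * (A * c ^ k) := by gcongr; exact hle k
    _ = _ := by rw [mul_pow]; ring

lemma tsum_pow_div_factorial_mul_pow (A c t : ℝ) :
    ∑' k : ℕ, t ^ k / k.factorial * (A * c ^ k) = A * Real.exp (t * c) := by
  rw [Real.exp_eq_exp_ℝ, NormedSpace.exp_eq_tsum_div, ← tsum_mul_left]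
  exact tsum_congr fun k => by rw [mul_pow]; ring

/-- An exponential generating function of a sequence with geometric growth rate `L` has
exponential growth rate `L`. -/
lemma tendsto_log_exp_series {h : ℕ → ℝ} (h0 : ∀ n, 0 ≤ h n) {L : ℝ} (hL : 0 < L)
    (lower : ∀ c, 0 < c → c < L → ∃ A > 0, ∀ n, A * c ^ n ≤ h n)
    (upper : ∀ c, L < c → ∃ A > 0, ∀ n, h n ≤ A * c ^ n) (c₀ : ℝ) :
    Tendsto (fun t : ℝ≥0 => Real.log (Real.exp (-(c₀ * t)) *
      ∑' k : ℕ, (t : ℝ) ^ k / k.factorial * h k) / (t : ℝ)) atTop (𝓝 (L - c₀)) := by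
  have hsum : ∀ t : ℝ≥0, Summable fun k : ℕ => (t : ℝ) ^ k / k.factorial * h k := fun t => by
    obtain ⟨A, -, hA⟩ := upper (L + 1) (by linarith)
    exact summable_pow_div_factorial_mul h0 hA t.2
  have hlow : ∀ c, 0 < c → c < L → ∃ A > 0, ∀ t : ℝ≥0, A * Real.exp (t * c) ≤
      ∑' k : ℕ, (t : ℝ) ^ k / k.factorial * h k := fun c hc hcL => by
    obtain ⟨A, hA, hle⟩ := lower c hc hcL
    refine ⟨A, hA, fun t => ?_⟩
    rw [← tsum_pow_div_factorial_mul_pow]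
    refine Summable.tsum_le_tsum (fun k => ?_) ?_ (hsum t)
    · gcongr; exact hle k
    · exact summable_pow_div_factorial_mul (h := fun k => A * c ^ k) (fun n => by positivity)
        (A := A) (c := c) (fun n => le_rfl) t.2
  have hupp : ∀ c, L < c → ∃ A > 0, ∀ t : ℝ≥0,
      ∑' k : ℕ, (t : ℝ) ^ k / k.factorial * h k ≤ A * Real.exp (t * c) := fun c hcL => by
    obtain ⟨A, hA, hle⟩ := upper c hcL
    refine ⟨A, hA, fun t => ?_⟩
    rw [← tsum_pow_div_factorial_mul_pow]
    refine Summable.tsum_le_tsum (fun k => ?_) (hsum t) ?_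
    · gcongr; exact hle k
    · exact summable_pow_div_factorial_mul (h := fun k => A * c ^ k)
        (fun n => mul_nonneg hA.le (pow_nonneg (hL.trans hcL).le n))
        (A := A) (c := c) (fun n => le_rfl) t.2
  have hdiv : ∀ a : ℝ, Tendsto (fun t : ℝ≥0 => a / (t : ℝ)) atTop (𝓝 0) := fun a =>
    tendsto_const_nhds.div_atTop (NNReal.tendsto_coe_atTop.2 tendsto_id)
  have hpos : ∀ t : ℝ≥0, 0 < ∑' k : ℕ, (t : ℝ) ^ k / k.factorial * h k := fun t => by
    obtain ⟨A, hA, hle⟩ := hlow (L / 2) (by linarith) (by linarith)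
    exact lt_of_lt_of_le (by positivity) (hle t)
  have hlog : ∀ A > 0, ∀ c : ℝ, ∀ t : ℝ≥0, 0 < t → Real.log (Real.exp (-(c₀ * t)) *
      (A * Real.exp (t * c))) / (t : ℝ) = Real.log A / t + (c - c₀) := fun A hA c t ht => by
    have ht' : (0 : ℝ) < t := ht
    rw [Real.log_mul (Real.exp_ne_zero _) (by positivity), Real.log_mul hA.ne' (Real.exp_ne_zero _),
      Real.log_exp, Real.log_exp]
    field_simp
    ring
  rw [tendsto_order]
  constructor
  · intro a ha
    obtain ⟨c, hc1, hc2⟩ := exists_between (max_lt (show a + c₀ < L by linarith) hL)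
    obtain ⟨A, hA, hle⟩ := hlow c (lt_of_le_of_lt (le_max_right _ _) hc1) hc2
    have hac : a < 0 + (c - c₀) := by linarith [le_max_left (a + c₀) 0]
    filter_upwards [((hdiv (Real.log A)).add_const (c - c₀)).eventually_const_lt hac,
      eventually_gt_atTop 0] with t ht ht0
    rw [← hlog A hA c t ht0] at ht
    refine ht.trans_le ?_
    gcongr
    exact hle t
  · intro a ha
    obtain ⟨c, hc1, hc2⟩ := exists_between (show L < a + c₀ by linarith)
    obtain ⟨A, hA, hle⟩ := hupp c hc1
    have hac : 0 + (c - c₀) < a := by linarith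
    filter_upwards [((hdiv (Real.log A)).add_const (c - c₀)).eventually_lt_const hac,
      eventually_gt_atTop 0] with t ht ht0
    rw [← hlog A hA c t ht0] at ht
    refine lt_of_le_of_lt ?_ ht
    gcongr
    · exact mul_pos (Real.exp_pos _) (hpos t)
    · exact hle t

namespace Hopping

variable {Γ σ : Type*} [AddCommGroup Γ] {G : Hopping Γ σ}

/-- The total weight of the paths of length `k` started at the origin. -/
def pathWeight (G : Hopping Γ σ) (k : ℕ) : ℝ := ((G.op^[k] fun _ => 1) 0).toReal

lemma pathWeight_nonneg (k : ℕ) : 0 ≤ G.pathWeight k := ENNReal.toReal_nonneg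

lemma le_norm_of_le_diag {δ : ℝ≥0∞} (hδ : ∀ x, δ ≤ G.diag x) : δ ≤ G.norm := by
  classical
  have h1 : l2 (Pi.single (0 : Γ) (1 : ℝ≥0∞)) = 1 := by
    have : l2 (Pi.single (0 : Γ) (1 : ℝ≥0∞)) ^ 2 = 1 ^ 2 := by
      rw [l2_sq, tsum_eq_single 0]
      · simp
      · intro x hx; simp [hx]
    exact le_antisymm (le_of_sq_le_sq this.le) (le_of_sq_le_sq this.ge)
  have h2 := l2_op_le (G := G) (f := Pi.single (0 : Γ) (1 : ℝ≥0∞)) (by simp [h1])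
  rw [h1, mul_one] at h2
  refine le_trans ?_ h2
  calc δ = δ * l2 (Pi.single (0 : Γ) (1 : ℝ≥0∞)) := by rw [h1, mul_one]
    _ = l2 (fun x => δ * (Pi.single (0 : Γ) (1 : ℝ≥0∞) : Γ → ℝ≥0∞) x) := (l2_const_mul _ _).symm
    _ ≤ _ := l2_mono fun x => ?_
  calc _ ≤ G.diag x * _ := by gcongr; exact hδ x
    _ ≤ _ := le_add_self

theorem tendsto_log_pathWeight_series (δ : ℝ≥0) (hδ0 : δ ≠ 0) (hδ : ∀ x, (δ : ℝ≥0∞) ≤ G.diag x)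
    (hr : ∀ x, G.Reach 0 x) (hs : G.SlowlyVarying) (c₀ : ℝ) :
    Tendsto (fun t : ℝ≥0 => Real.log (Real.exp (-(c₀ * t)) *
      ∑' k : ℕ, (t : ℝ) ^ k / k.factorial * G.pathWeight k) / (t : ℝ)) atTop
      (𝓝 (G.norm.toReal - c₀)) := by
  have hδ' : (0 : ℝ) < δ := by exact_mod_cast pos_iff_ne_zero.2 hδ0
  have hδE : (δ : ℝ≥0∞) ≠ 0 := by simpa using hδ0
  have hstep : ∀ n, (δ : ℝ) * G.pathWeight n ≤ G.pathWeight (n + 1) := fun n => by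
    rw [pathWeight, pathWeight, ← ENNReal.coe_toReal δ, ← ENNReal.toReal_mul]
    apply ENNReal.toReal_mono (iterate_one_ne_top _ _)
    have := pow_mul_le_iterate hδ (G.op^[n] fun _ => 1) 1 0
    rwa [pow_one, ← Function.iterate_add_apply, add_comm] at this
  have hpos : ∀ n, 0 < G.pathWeight n := fun n => by
    have : (δ : ℝ≥0∞) ^ n * 1 ≤ (G.op^[n] fun _ => 1) 0 := pow_mul_le_iterate hδ (fun _ => 1) n 0
    refine ENNReal.toReal_pos ?_ (iterate_one_ne_top _ _)
    exact (lt_of_lt_of_le (pos_iff_ne_zero.2 (by rw [mul_one]; exact pow_ne_zero n hδE)) this).ne'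
  refine tendsto_log_exp_series pathWeight_nonneg ?_ ?_ ?_ c₀
  · refine lt_of_lt_of_le hδ' ?_
    rw [← ENNReal.coe_toReal δ]
    exact ENNReal.toReal_mono norm_ne_top (le_norm_of_le_diag hδ)
  · intro c hc hcL
    obtain ⟨A, hA, M, hle⟩ := exists_lower hδE hδ hr (c := ENNReal.ofReal c)
      ((ENNReal.ofReal_lt_iff_lt_toReal hc.le norm_ne_top).2 hcL)
    have hAt : A ≠ ⊤ := by
      have := hle 0
      rw [mul_zero, pow_zero, mul_one] at this
      exact ne_top_of_le_ne_top (iterate_one_ne_top _ _) this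
    refine exists_pos_le_of_parity hpos hδ' hc (ENNReal.toReal_pos hA hAt) M hstep fun k => ?_
    have := ENNReal.toReal_mono (iterate_one_ne_top _ _) (hle k)
    rwa [ENNReal.toReal_mul, ENNReal.toReal_pow, ENNReal.toReal_ofReal hc.le] at this
  · intro c hcL
    have htend : Tendsto (fun ε : ℝ≥0∞ => (1 + ε) * G.norm + ε * (1 + ∑' s, G.weight s))
        (𝓝 0) (𝓝 ((1 + 0) * G.norm + 0 * (1 + ∑' s, G.weight s))) := by
      refine Tendsto.add ?_ ?_
      · exact ENNReal.Tendsto.mul_const (tendsto_const_nhds.add tendsto_id) (Or.inr norm_ne_top)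
      · exact ENNReal.Tendsto.mul_const tendsto_id (Or.inr (by simp [G.weight_ne_top]))
    have hlt : (1 + 0) * G.norm + 0 * (1 + ∑' s, G.weight s) < ENNReal.ofReal c := by
      simpa using (ENNReal.lt_ofReal_iff_toReal_lt norm_ne_top).2 hcL
    have hev := htend.eventually_lt_const hlt
    obtain ⟨ε, ⟨hε, hεt⟩, hε0⟩ := (((hev.and (eventually_lt_nhds ENNReal.zero_lt_top)).filter_mono
      (nhdsWithin_le_nhds (s := Set.Ioi 0))).and self_mem_nhdsWithin).exists
    replace hε0 : 0 < ε := hε0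
    obtain ⟨r, hr0, hrt, F, hF, htail⟩ := exists_weight hs hε0.ne' hεt.ne
    have hup := exists_upper hr0 hrt F hF htail
    have h0t : r 0 ≠ ⊤ := ne_top_of_le_ne_top hrt (le_l2 r 0)
    have hq0 : l2 r / r 0 ≠ 0 := ENNReal.div_ne_zero.2
      ⟨(lt_of_lt_of_le (pos_iff_ne_zero.2 hr0) (le_l2 r 0)).ne', h0t⟩
    have hqt : l2 r / r 0 ≠ ⊤ := ENNReal.div_ne_top hrt hr0
    have hc : 0 ≤ c := ENNReal.toReal_nonneg.trans hcL.le
    refine ⟨(l2 r / r 0).toReal, ENNReal.toReal_pos hq0 hqt, fun n => ?_⟩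
    rw [← ENNReal.toReal_ofReal hc, ← ENNReal.toReal_pow, ← ENNReal.toReal_mul]
    refine ENNReal.toReal_mono (ENNReal.mul_ne_top hqt (ENNReal.pow_ne_top ENNReal.ofReal_ne_top))
      ((hup n).trans ?_)
    gcongr

end Hopping

end

section

lemma Summable.abs_comp_sub {G : Type*} [AddCommGroup G] {b : G → ℝ} (hb : Summable fun x => |b x|)
    (x : G) : Summable fun z => |b (x - z)| :=
  (Equiv.subLeft x).summable_iff.2 hb

lemma abs_apply_le_tsum {G : Type*} {b : G → ℝ} (hb : Summable fun x => |b x|) (x : G) :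
    |b x| ≤ ∑' z, |b z| :=
  hb.le_tsum x fun _ _ => abs_nonneg _

section Correlator

variable {d : ℕ} {b : Site d → ℝ}

lemma summable_mul_comp_sub (hb : Summable fun x => |b x|) (x y : Site d) :
    Summable fun z => b (x - z) * b (y - z) := by
  refine Summable.of_norm_bounded ((Summable.abs_comp_sub hb x).mul_right (∑' z, |b z|))
    fun z => ?_
  rw [Real.norm_eq_abs, abs_mul]
  gcongr
  exact abs_apply_le_tsum hb _

lemma correlator_sub (x y : Site d) :
    correlator b (x - y) = ∑' z, b (x - z) * b (y - z) := by
  rw [correlator, ← (Equiv.subRight y).tsum_eq]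
  refine tsum_congr fun z => ?_
  simp only [Equiv.subRight_apply]
  congr 2 <;> abel

/-- A bound for the correlator of a summable kernel. -/
def corrBound (b : Site d → ℝ) : ℝ := (∑' x, |b x|) ^ 2

lemma corrBound_nonneg : 0 ≤ corrBound b := sq_nonneg _

lemma abs_correlator_le (hb : Summable fun x => |b x|) (x : Site d) :
    |correlator b x| ≤ corrBound b := by
  have h0 := correlator_sub (b := b) x 0
  rw [sub_zero] at h0
  rw [h0, ← Real.norm_eq_abs, corrBound, sq]
  refine (norm_tsum_le_tsum_norm (summable_mul_comp_sub hb x 0).norm).trans ?_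
  calc ∑' z, ‖b (x - z) * b (0 - z)‖ ≤ ∑' z, |b (x - z)| * ∑' z, |b z| := by
        refine Summable.tsum_le_tsum (fun z => ?_) (summable_mul_comp_sub hb x 0).norm
          ((Summable.abs_comp_sub hb x).mul_right _)
        rw [Real.norm_eq_abs, abs_mul]
        gcongr
        exact abs_apply_le_tsum hb _
    _ = _ := by rw [tsum_mul_right]; congr 1; exact (Equiv.subLeft x).tsum_eq fun z => |b z|

lemma correlator_posDef_sum (hb : Summable fun x => |b x|) (Q : Finset (Site d))
    (c : Site d → ℝ) : 0 ≤ ∑ x ∈ Q, ∑ y ∈ Q, c x * c y * correlator b (x - y) := by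
  have : ∑ x ∈ Q, ∑ y ∈ Q, c x * c y * correlator b (x - y)
      = ∑' z, (∑ x ∈ Q, c x * b (x - z)) ^ 2 := by
    have h : ∀ z, (∑ x ∈ Q, c x * b (x - z)) ^ 2
        = ∑ x ∈ Q, ∑ y ∈ Q, c x * c y * (b (x - z) * b (y - z)) := fun z => by
      rw [sq, Finset.sum_mul_sum]
      exact Finset.sum_congr rfl fun x _ => Finset.sum_congr rfl fun y _ => by ring
    simp_rw [h]
    rw [Summable.tsum_finsetSum fun x _ => summable_sum fun y _ =>
      (summable_mul_comp_sub hb x y).mul_left _]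
    refine Finset.sum_congr rfl fun x _ => ?_
    rw [Summable.tsum_finsetSum fun y _ => (summable_mul_comp_sub hb x y).mul_left _]
    refine Finset.sum_congr rfl fun y _ => ?_
    rw [tsum_mul_left, correlator_sub]
  rw [this]
  exact tsum_nonneg fun z => sq_nonneg _

end Correlator

/-- The pair potential `∑_{i<j} B(x_i - x_j)`, written as half the sum over ordered pairs. -/
def pairPotential {d p : ℕ} (B : Site d → ℝ) (x : Fin p → Site d) : ℝ :=
  2⁻¹ * ∑ i, ∑ j ∈ Finset.univ.erase i, B (x i - x j)

/-- The number of pairs of `p` particles. -/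
def numPairs (p : ℕ) : ℝ := p * (p - 1) / 2

lemma numPairs_nonneg (p : ℕ) : 0 ≤ numPairs p := by
  unfold numPairs
  rcases p with _ | p
  · simp
  · push_cast; rw [add_sub_cancel_right]; positivity

lemma sum_erase_const (p : ℕ) (c : ℝ) :
    ∑ i : Fin p, ∑ _j ∈ Finset.univ.erase i, c = 2 * numPairs p * c := by
  have h : ∀ i : Fin p, ∑ _j ∈ Finset.univ.erase i, c = (p - 1) * c := fun i => by
    rw [Finset.sum_const, Finset.card_erase_of_mem (Finset.mem_univ i), Finset.card_univ,
      Fintype.card_fin, nsmul_eq_mul, Nat.cast_sub (by have := i.2; omega)]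
    simp
  simp_rw [h]
  rw [Finset.sum_const, Finset.card_univ, Fintype.card_fin, nsmul_eq_mul, numPairs]
  ring

lemma abs_pairPotential_le {d p : ℕ} {B : Site d → ℝ} {β : ℝ} (hB : ∀ x, |B x| ≤ β)
    (x : Fin p → Site d) : |pairPotential B x| ≤ numPairs p * β := by
  rw [pairPotential, abs_mul, abs_of_pos (by norm_num : (0 : ℝ) < 2⁻¹)]
  calc 2⁻¹ * |∑ i, ∑ j ∈ Finset.univ.erase i, B (x i - x j)|
      ≤ 2⁻¹ * ∑ i : Fin p, ∑ _j ∈ Finset.univ.erase i, β := by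
        gcongr
        refine (Finset.abs_sum_le_sum_abs _ _).trans (Finset.sum_le_sum fun i _ => ?_)
        exact (Finset.abs_sum_le_sum_abs _ _).trans (Finset.sum_le_sum fun j _ => hB _)
    _ = _ := by rw [sum_erase_const]; ring

section Particles

variable {d : ℕ} {a B : Site d → ℝ} {β : ℝ}

lemma IsJumpLaw.tsum_ofReal (ha : IsJumpLaw a) (κ : ℝ) (hκ : 0 ≤ κ) :
    ∑' z, ENNReal.ofReal (κ * a z) = ENNReal.ofReal κ := by
  rw [← ENNReal.ofReal_tsum_of_nonneg (fun z => mul_nonneg hκ (ha.nonneg z))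
    (ha.hasSum_one.summable.mul_left κ), tsum_mul_left, ha.hasSum_one.tsum_eq, mul_one]

lemma IsJumpLaw.tsum_ofReal_prod (ha : IsJumpLaw a) (p : ℕ) (κ : ℝ) (hκ : 0 ≤ κ) :
    ∑' s : Fin p × Site d, ENNReal.ofReal (κ * a s.2) = ENNReal.ofReal (p * κ) := by
  rw [ENNReal.tsum_prod (f := fun (_ : Fin p) z => ENNReal.ofReal (κ * a z))]
  simp_rw [ha.tsum_ofReal κ hκ]
  rw [tsum_fintype, Finset.sum_const, Finset.card_univ, Fintype.card_fin, nsmul_eq_mul,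
    ENNReal.ofReal_mul (by positivity), ENNReal.ofReal_natCast]

/-- The generator of `p` particles with pair interaction `B`, shifted by a multiple of the
identity so that it preserves positivity. -/
def particles (ha : IsJumpLaw a) (hB : ∀ x, |B x| ≤ β) (p : ℕ) (κ : ℝ≥0) :
    Hopping (Fin p → Site d) (Fin p × Site d) where
  weight s := ENNReal.ofReal (κ * a s.2)
  shift s := Pi.single s.1 s.2
  diag x := ENNReal.ofReal (p * κ + numPairs p * β + pairPotential B x)
  diagBound := ENNReal.ofReal (p * κ + numPairs p * β + numPairs p * β)
  refl := (Equiv.refl _).prodCongr (Equiv.neg _)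
  weight_refl s := by simp [ha.symm]
  shift_refl s := by simp [Pi.single_neg]
  weight_ne_top := by rw [ha.tsum_ofReal_prod p κ κ.2]; exact ENNReal.ofReal_ne_top
  diagBound_ne_top := ENNReal.ofReal_ne_top
  diag_le x := by
    gcongr
    exact (le_abs_self _).trans (abs_pairPotential_le hB x)

/-- The Lyapunov exponent of the `p`-th moment as a spectral quantity. -/
def lyapunov (ha : IsJumpLaw a) (hB : ∀ x, |B x| ≤ β) (p : ℕ) (κ : ℝ≥0) : ℝ :=
  (particles ha hB p κ).norm.toReal - (numPairs p * β + 2 * p * κ)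

lemma particles_diag_ge (ha : IsJumpLaw a) (hB : ∀ x, |B x| ≤ β) (p : ℕ) (κ : ℝ≥0)
    (x : Fin p → Site d) : ((p * κ : ℝ≥0) : ℝ≥0∞) ≤ (particles ha hB p κ).diag x := by
  rw [← ENNReal.ofReal_coe_nnreal]
  refine ENNReal.ofReal_le_ofReal ?_
  have := neg_abs_le (pairPotential B x)
  have := abs_pairPotential_le hB x
  push_cast
  linarith

end Particles

namespace Hopping

variable {Γ σ : Type*} [AddCommGroup Γ] {G : Hopping Γ σ}

lemma reach_refl (x : Γ) : G.Reach x x := ⟨0, 1, one_ne_zero, fun g => by simp⟩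

lemma Reach.trans {x y z : Γ} (h : G.Reach x y) (h' : G.Reach y z) : G.Reach x z := by
  obtain ⟨m, c, hc, h⟩ := h
  obtain ⟨m', c', hc', h'⟩ := h'
  refine ⟨m + m', c * c', mul_ne_zero hc hc', fun g => ?_⟩
  rw [Function.iterate_add_apply, mul_assoc]
  exact (mul_le_mul_right (h' g) c).trans (h _)

lemma reach_add_shift {s : σ} (hs : G.weight s ≠ 0) (x : Γ) : G.Reach x (x + G.shift s) := by
  refine ⟨1, G.weight s, hs, fun g => ?_⟩
  exact (ENNReal.le_tsum (f := fun s => G.weight s * g (x + G.shift s)) s).trans le_self_add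

/-- The displacements that can be realised from every starting point. -/
def reachable (G : Hopping Γ σ) : AddSubmonoid Γ where
  carrier := {w | ∀ x, G.Reach x (x + w)}
  zero_mem' x := by rw [add_zero]; exact reach_refl x
  add_mem' {v w} hv hw x := by rw [← add_assoc]; exact (hv x).trans (hw _)

end Hopping

section Reach

variable {d : ℕ} {a B : Site d → ℝ} {β : ℝ}

lemma reach_particles (ha : IsJumpLaw a) (hB : ∀ x, |B x| ≤ β) (p : ℕ) {κ : ℝ≥0} (hκ : 0 < κ)
    (x : Fin p → Site d) : (particles ha hB p κ).Reach 0 x := by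
  have hmem : ∀ w, w ∈ (particles ha hB p κ).reachable := by
    intro w
    have hgen : ∀ (i : Fin p) (z : Site d), 0 < a z →
        (Pi.single i z : Fin p → Site d) ∈ (particles ha hB p κ).reachable := fun i z hz x => by
      refine Hopping.reach_add_shift (G := particles ha hB p κ) (s := (i, z)) ?_ x
      simpa [particles] using And.intro hκ.ne' hz
    have hint : ∀ (i : Fin p) (j : Fin d) (n : ℤ),
        (Pi.single i (Pi.single j n) : Fin p → Site d) ∈ (particles ha hB p κ).reachable := by
      intro i j n
      induction n using Int.induction_on with
      | zero => rw [Pi.single_zero, Pi.single_zero]; exact zero_mem _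
      | succ n ih =>
        rw [Pi.single_add, Pi.single_add]
        exact add_mem ih (hgen i _ (ha.pos_unit j))
      | pred n ih =>
        rw [sub_eq_add_neg, Pi.single_add, Pi.single_add]
        refine add_mem ih (hgen i _ ?_)
        rw [Pi.single_neg, ha.symm]
        exact ha.pos_unit j
    rw [← Finset.univ_sum_single w]
    refine sum_mem fun i _ => ?_
    have : w i = ∑ j, Pi.single j (w i j) := (Finset.univ_sum_single (w i)).symm
    rw [this, ← AddMonoidHom.single_apply, map_sum]
    exact sum_mem fun j _ => hint i j _
  have := hmem x 0
  rwa [zero_add] at this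

end Reach

lemma tsum_pi_prod_le {ι β : Type*} [Fintype ι] (g : β → ℝ≥0∞) :
    ∑' x : ι → β, ∏ i, g (x i) ≤ (∑' n, g n) ^ Fintype.card ι := by
  classical
  rw [ENNReal.tsum_eq_iSup_sum]
  refine iSup_le fun s => ?_
  set t : ι → Finset β := fun i => s.image fun x => x i
  calc ∑ x ∈ s, ∏ i, g (x i) ≤ ∑ x ∈ Fintype.piFinset t, ∏ i, g (x i) := by
        refine Finset.sum_le_sum_of_subset fun x hx => ?_
        rw [Fintype.mem_piFinset]
        exact fun i => Finset.mem_image_of_mem _ hx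
    _ = ∏ i, ∑ n ∈ t i, g n := (Finset.prod_univ_sum t fun _ n => g n).symm
    _ ≤ ∏ _i : ι, ∑' n, g n := by
        gcongr with i
        exact ENNReal.sum_le_tsum _
    _ = _ := by rw [Finset.prod_const, Finset.card_univ]

section Exponential

variable {d p : ℕ}

/-- The `ℓ¹` norm of a configuration. -/
def ell1 (x : Fin p → Site d) : ℝ := ∑ i, ∑ j, |(x i j : ℝ)|

lemma ell1_add_le (x y : Fin p → Site d) : ell1 (x + y) ≤ ell1 x + ell1 y := by
  simp only [ell1, ← Finset.sum_add_distrib]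
  gcongr with i _ j _
  simp only [Pi.add_apply, Int.cast_add]
  exact abs_add_le _ _

lemma summable_exp_neg_abs {θ : ℝ} (hθ : 0 < θ) : Summable fun n : ℤ => Real.exp (-(θ * |(n : ℝ)|)) := by
  have h : Summable fun n : ℕ => Real.exp (-(θ * (n : ℝ))) := by
    have := Real.summable_exp_nat_mul_iff (a := -θ) |>.2 (by linarith)
    refine this.congr fun n => by congr 1; ring
  refine Summable.of_nat_of_neg ?_ ?_
  · simpa using h
  · simpa using h

lemma tsum_exp_ell1_ne_top {θ : ℝ} (hθ : 0 < θ) :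
    ∑' x : Fin p → Site d, ENNReal.ofReal (Real.exp (-(θ * ell1 x))) ≠ ⊤ := by
  have h : ∀ x : Fin p → Site d, ENNReal.ofReal (Real.exp (-(θ * ell1 x)))
      = ∏ i, ∏ j, ENNReal.ofReal (Real.exp (-(θ * |(x i j : ℝ)|))) := fun x => by
    simp_rw [← ENNReal.ofReal_prod_of_nonneg (fun _ _ => (Real.exp_pos _).le)]
    rw [← ENNReal.ofReal_prod_of_nonneg
      (fun _ _ => Finset.prod_nonneg fun _ _ => (Real.exp_pos _).le)]
    simp_rw [← Real.exp_sum, ell1, Finset.mul_sum, Finset.sum_neg_distrib]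
  simp_rw [h]
  refine ne_top_of_le_ne_top ?_ (tsum_pi_prod_le
    fun y : Site d => ∏ j, ENNReal.ofReal (Real.exp (-(θ * |(y j : ℝ)|))))
  refine ENNReal.pow_ne_top (ne_top_of_le_ne_top ?_ (tsum_pi_prod_le
    fun n : ℤ => ENNReal.ofReal (Real.exp (-(θ * |(n : ℝ)|)))))
  exact ENNReal.pow_ne_top (summable_exp_neg_abs hθ).tsum_ofReal_ne_top

lemma ofReal_exp_ell1_le {θ : ℝ} (hθ : 0 ≤ θ) (x y : Fin p → Site d) :
    ENNReal.ofReal (Real.exp (-(θ * ell1 x))) ≤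
      ENNReal.ofReal (Real.exp (θ * ell1 y)) * ENNReal.ofReal (Real.exp (-(θ * ell1 (x + y)))) := by
  rw [← ENNReal.ofReal_mul (Real.exp_pos _).le, ← Real.exp_add]
  gcongr
  nlinarith [ell1_add_le x y]

lemma tendsto_ofReal_exp_ell1 (y : Fin p → Site d) :
    Tendsto (fun θ : ℝ => ENNReal.ofReal (Real.exp (θ * ell1 y))) (𝓝[>] 0) (𝓝 1) := by
  have : Continuous fun θ : ℝ => ENNReal.ofReal (Real.exp (θ * ell1 y)) :=
    ENNReal.continuous_ofReal.comp (by fun_prop)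
  simpa using (this.tendsto 0).mono_left nhdsWithin_le_nhds

lemma slowlyVarying {σ : Type*} (G : Hopping (Fin p → Site d) σ) : G.SlowlyVarying := by
  intro ε hε F
  have h1 : (1 : ℝ≥0∞) < 1 + ε := ENNReal.lt_add_right ENNReal.one_ne_top hε
  have hev : ∀ᶠ θ : ℝ in 𝓝[>] 0, ∀ s ∈ F,
      ENNReal.ofReal (Real.exp (θ * ell1 (G.shift s))) < 1 + ε := by
    rw [Filter.eventually_all_finset]
    exact fun s _ => (tendsto_ofReal_exp_ell1 _).eventually_lt_const h1
  obtain ⟨θ, hθF, hθ⟩ := (hev.and self_mem_nhdsWithin).exists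
  replace hθ : 0 < θ := hθ
  refine ⟨fun x => ENNReal.ofReal (Real.exp (-(θ * ell1 x))), ?_, tsum_exp_ell1_ne_top hθ, ?_⟩
  · simp [Real.exp_pos]
  · intro s hs x
    refine (ofReal_exp_ell1_le hθ.le x (G.shift s)).trans ?_
    gcongr
    exact (hθF s hs).le

end Exponential

end

section

section Monotone

variable {d : ℕ} {a B : Site d → ℝ} {β : ℝ}

lemma norm_particles_add_le (ha : IsJumpLaw a) (hB : ∀ x, |B x| ≤ β) (p : ℕ) (κ κ' : ℝ≥0) :
    (particles ha hB p (κ + κ')).norm ≤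
      (particles ha hB p κ).norm + ENNReal.ofReal (2 * p * κ') := by
  refine Hopping.norm_le fun f hf => ?_
  have h0 : ∀ x : Site d, |(0 : ℝ)| ≤ 0 := fun _ => by simp
  set G0 := particles (B := fun _ => 0) ha h0 p κ' with hG0
  have hsum : ∀ x, (particles ha hB p (κ + κ')).op f x =
      (particles ha hB p κ).op f x + G0.op f x := fun x => by
    have hd : (particles ha hB p (κ + κ')).diag x = (particles ha hB p κ).diag x + G0.diag x := by
      have h1 := abs_pairPotential_le hB x
      have h2 := neg_abs_le (pairPotential B x)
      simp only [particles, hG0]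
      rw [← ENNReal.ofReal_add]
      · congr 1; simp [pairPotential]; ring
      · have : (0 : ℝ) ≤ p * κ := by positivity
        linarith
      · simp [pairPotential]; positivity
    have hw : ∀ s, (particles ha hB p (κ + κ')).weight s =
        (particles ha hB p κ).weight s + G0.weight s := fun s => by
      simp only [particles, hG0]
      have := ha.nonneg s.2
      rw [← ENNReal.ofReal_add (by positivity) (by positivity)]
      congr 1; push_cast; ring
    simp only [Hopping.op, hd, hw, add_mul]
    rw [ENNReal.tsum_add]
    have e1 : (particles ha hB p (κ + κ')).shift = (particles ha hB p κ).shift := rfl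
    have e2 : G0.shift = (particles ha hB p κ).shift := rfl
    rw [e1, e2]
    ring
  have hbd : l2 (G0.op f) ≤ ENNReal.ofReal (2 * p * κ') * l2 f := by
    refine (Hopping.l2_op_le_bound f).trans ?_
    gcongr
    have : ∑' s, G0.weight s = ENNReal.ofReal (p * κ') := ha.tsum_ofReal_prod p κ' κ'.2
    rw [this]
    simp only [particles, hG0]
    rw [← ENNReal.ofReal_add (by positivity) (by simp; positivity)]
    refine ENNReal.ofReal_le_ofReal ?_
    simp; ring_nf; rfl
  rw [show (particles ha hB p (κ + κ')).op f = fun x => (particles ha hB p κ).op f x + G0.op f x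
    from funext hsum, add_mul]
  refine (l2_add_le _ _).trans ?_
  gcongr
  exact Hopping.l2_op_le hf

/-- The Lyapunov exponents are non-increasing in the diffusivity. -/
lemma lyapunov_antitone (ha : IsJumpLaw a) (hB : ∀ x, |B x| ≤ β) (p : ℕ) {κ κ' : ℝ≥0}
    (h : κ ≤ κ') : lyapunov ha hB p κ' ≤ lyapunov ha hB p κ := by
  obtain ⟨e, rfl⟩ := exists_add_of_le h
  have h1 := ENNReal.toReal_mono (ENNReal.add_ne_top.2 ⟨Hopping.norm_ne_top, ENNReal.ofReal_ne_top⟩)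
    (norm_particles_add_le ha hB p κ e)
  rw [ENNReal.toReal_add Hopping.norm_ne_top ENNReal.ofReal_ne_top,
    ENNReal.toReal_ofReal (by positivity)] at h1
  simp only [lyapunov]
  push_cast
  linarith

end Monotone

section Nonneg

variable {d : ℕ} {a b : Site d → ℝ} {β : ℝ}

lemma tsum_correlator_nonneg (hb : Summable fun x => |b x|) {h : Site d → ℝ}
    (hh : Summable fun x : Fin 2 → Site d => h (x 0) * h (x 1)) :
    0 ≤ ∑' x : Fin 2 → Site d, h (x 0) * h (x 1) * correlator b (x 0 - x 1) := by
  have hs : Summable fun x : Fin 2 → Site d => h (x 0) * h (x 1) * correlator b (x 0 - x 1) := by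
    refine Summable.of_norm_bounded (hh.norm.mul_right (corrBound b)) fun x => ?_
    rw [norm_mul]
    gcongr
    exact abs_correlator_le hb _
  let e : Site d × Site d ≃ (Fin 2 → Site d) := (finTwoArrowEquiv (Site d)).symm
  have hs' : HasSum (fun q : Site d × Site d => h q.1 * h q.2 * correlator b (q.1 - q.2))
      (∑' x : Fin 2 → Site d, h (x 0) * h (x 1) * correlator b (x 0 - x 1)) :=
    (e.hasSum_iff (f := fun x : Fin 2 → Site d => h (x 0) * h (x 1) * correlator b (x 0 - x 1))).2
      hs.hasSum
  have htend : Tendsto (fun Q : Finset (Site d) => Q ×ˢ Q) atTop atTop := by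
    refine tendsto_atTop.2 fun R => ?_
    classical
    filter_upwards [eventually_ge_atTop (R.image Prod.fst ∪ R.image Prod.snd)] with Q hQ q hq
    rw [Finset.mem_product]
    exact ⟨hQ (Finset.mem_union_left _ (Finset.mem_image_of_mem _ hq)),
      hQ (Finset.mem_union_right _ (Finset.mem_image_of_mem _ hq))⟩
  refine ge_of_tendsto' (hs'.comp htend) fun Q => ?_
  simp only [Function.comp]
  rw [Finset.sum_product]
  exact correlator_posDef_sum hb Q h

lemma pairPotential_two (B : Site d → ℝ) (x : Fin 2 → Site d) :
    pairPotential B x = 2⁻¹ * (B (x 0 - x 1) + B (x 1 - x 0)) := by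
  rw [pairPotential, Fin.sum_univ_two]
  congr 2
  · rw [show (Finset.univ : Finset (Fin 2)).erase 0 = {1} by decide, Finset.sum_singleton]
  · rw [show (Finset.univ : Finset (Fin 2)).erase 1 = {0} by decide, Finset.sum_singleton]

lemma correlator_neg (x : Site d) : correlator b (-x) = correlator b x := by
  have h1 := correlator_sub (b := b) 0 x
  have h2 := correlator_sub (b := b) x 0
  rw [zero_sub] at h1
  rw [sub_zero] at h2
  rw [h1, h2]
  exact tsum_congr fun z => mul_comm _ _

/-- The second-moment Lyapunov exponent is non-negative. -/
lemma lyapunov_two_nonneg (ha : IsJumpLaw a) (hb : Summable fun x => |b x|)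
    (hB : ∀ x, |correlator b x| ≤ β) (κ : ℝ≥0) : 0 ≤ lyapunov ha hB 2 κ := by
  set G := particles ha hB 2 κ with hG
  have hβ : 0 ≤ β := (abs_nonneg _).trans (hB 0)
  have key : ∀ F : Finset (Fin 2 × Site d), ∀ θ : ℝ, 0 < θ →
      ∑ s ∈ F, G.weight s * (ENNReal.ofReal (Real.exp (θ * ell1 (G.shift s))))⁻¹ +
        ENNReal.ofReal (2 * κ + β) ≤ G.norm := by
    intro F θ hθ
    set f : (Fin 2 → Site d) → ℝ≥0∞ := fun x => ENNReal.ofReal (Real.exp (-(θ * ell1 x))) with hf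
    have hfsq : ∀ x, f x ^ 2 = ENNReal.ofReal (Real.exp (-(2 * θ * ell1 x))) := fun x => by
      rw [hf, ← ENNReal.ofReal_pow (Real.exp_pos _).le, ← Real.exp_nat_mul]
      congr 2; push_cast; ring
    have hft : ∑' x, f x ^ 2 ≠ ⊤ := by
      simp_rw [hfsq]; exact tsum_exp_ell1_ne_top (by linarith)
    have hl2t : l2 f ≠ ⊤ := by
      rw [← l2_sq] at hft
      intro h; rw [h] at hft; simp at hft
    have hl20 : l2 f ≠ 0 := by
      refine (lt_of_lt_of_le ?_ (le_l2 f 0)).ne'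
      simp [hf, Real.exp_pos]
    have hform : (∑ s ∈ F, G.weight s * (ENNReal.ofReal (Real.exp (θ * ell1 (G.shift s))))⁻¹ +
        ENNReal.ofReal (2 * κ + β)) * l2 f ^ 2 ≤ ∑' x, f x * G.op f x := by
      simp only [Hopping.op, mul_add]
      rw [ENNReal.tsum_add, add_mul]
      refine add_le_add ?_ ?_
      · rw [l2_sq, Finset.sum_mul]
        simp_rw [← ENNReal.tsum_mul_left]
        rw [ENNReal.tsum_comm]
        refine le_trans (Finset.sum_le_sum fun s _ => ?_) (ENNReal.sum_le_tsum F)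
        refine ENNReal.tsum_le_tsum fun x => ?_
        have h1 : (ENNReal.ofReal (Real.exp (θ * ell1 (G.shift s))))⁻¹ * f x ≤ f (x + G.shift s) := by
          rw [← ENNReal.div_eq_inv_mul]
          exact ENNReal.div_le_of_le_mul' (ofReal_exp_ell1_le hθ.le x _)
        calc _ = f x * (G.weight s *
              ((ENNReal.ofReal (Real.exp (θ * ell1 (G.shift s))))⁻¹ * f x)) := by ring
          _ ≤ _ := by gcongr
      · set h : Site d → ℝ := fun y => Real.exp (-(2 * θ * ∑ j, |(y j : ℝ)|)) with hh
        have hprod : ∀ x : Fin 2 → Site d, Real.exp (-(2 * θ * ell1 x)) = h (x 0) * h (x 1) :=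
          fun x => by rw [hh, ← Real.exp_add, ell1, Fin.sum_univ_two]; congr 1; ring
        have hsum : Summable fun x : Fin 2 → Site d => h (x 0) * h (x 1) := by
          have := ENNReal.summable_toReal hft
          refine this.congr fun x => ?_
          rw [hfsq, ENNReal.toReal_ofReal (Real.exp_pos _).le, hprod]
        have hnn : ∀ x : Fin 2 → Site d, 0 ≤ h (x 0) * h (x 1) := fun x => by positivity
        have hdiag : ∀ x, f x * (G.diag x * f x) =
            ENNReal.ofReal (h (x 0) * h (x 1) * (2 * κ + β)
              + h (x 0) * h (x 1) * correlator b (x 0 - x 1)) := fun x => by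
          have hd : G.diag x = ENNReal.ofReal (2 * κ + β + correlator b (x 0 - x 1)) := by
            simp only [hG, particles, pairPotential_two, numPairs]
            rw [← neg_sub (x 0) (x 1), correlator_neg]
            congr 1; push_cast; ring
          rw [hd, ← mul_add, ENNReal.ofReal_mul (hnn x), ← hprod, ← hfsq]; ring
        simp_rw [hdiag]
        have hs2 : Summable fun x : Fin 2 → Site d =>
            h (x 0) * h (x 1) * correlator b (x 0 - x 1) := by
          refine Summable.of_norm_bounded (hsum.norm.mul_right β) fun x => ?_
          rw [norm_mul]
          gcongr
          exact hB _
        rw [← ENNReal.ofReal_tsum_of_nonneg _ ((hsum.mul_right _).add hs2),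
          (hsum.mul_right _).tsum_add hs2, tsum_mul_right, l2_sq]
        · simp_rw [hfsq, hprod]
          rw [← ENNReal.ofReal_tsum_of_nonneg hnn hsum, ← ENNReal.ofReal_mul (by positivity)]
          refine ENNReal.ofReal_le_ofReal ?_
          have := tsum_correlator_nonneg hb hsum
          linarith
        · intro x
          rw [← mul_add]
          refine mul_nonneg (hnn x) ?_
          have := neg_abs_le (correlator b (x 0 - x 1))
          have := hB (x 0 - x 1)
          have : (0 : ℝ) ≤ κ := κ.2
          linarith
    have h2 := hform.trans ((tsum_mul_le_l2_mul_l2 _ _).trans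
      (mul_le_mul_right (Hopping.l2_op_le hl2t) (l2 f)))
    rw [show l2 f * (G.norm * l2 f) = G.norm * l2 f ^ 2 by ring] at h2
    exact (ENNReal.mul_le_mul_iff_left (pow_ne_zero 2 hl20) (ENNReal.pow_ne_top hl2t)).1 h2
  have key2 : ∀ F : Finset (Fin 2 × Site d),
      ∑ s ∈ F, G.weight s + ENNReal.ofReal (2 * κ + β) ≤ G.norm := by
    intro F
    have htend : Tendsto (fun θ : ℝ => ∑ s ∈ F, G.weight s *
        (ENNReal.ofReal (Real.exp (θ * ell1 (G.shift s))))⁻¹ + ENNReal.ofReal (2 * κ + β)) (𝓝[>] 0)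
        (𝓝 (∑ s ∈ F, G.weight s * 1⁻¹ + ENNReal.ofReal (2 * κ + β))) := by
      refine Tendsto.add_const _ (tendsto_finsetSum _ fun s _ => ?_)
      exact ENNReal.Tendsto.const_mul (tendsto_ofReal_exp_ell1 _).inv (Or.inl (by simp))
    simp only [inv_one, mul_one] at htend
    refine le_of_tendsto htend ?_
    filter_upwards [self_mem_nhdsWithin] with θ hθ
    exact key F θ hθ
  have key3 : ∑' s, G.weight s + ENNReal.ofReal (2 * κ + β) ≤ G.norm := by
    rw [ENNReal.tsum_eq_iSup_sum, ENNReal.iSup_add]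
    exact iSup_le key2
  rw [show ∑' s, G.weight s = ENNReal.ofReal (((2 : ℕ) : ℝ) * κ) from
    ha.tsum_ofReal_prod 2 κ κ.2, ← ENNReal.ofReal_add (by positivity) (by positivity)] at key3
  have := (ENNReal.ofReal_le_iff_le_toReal Hopping.norm_ne_top).1 key3
  simp only [lyapunov, numPairs]
  push_cast at this ⊢
  linarith

end Nonneg

end

section

section Pairs

variable {d : ℕ} {a B : Site d → ℝ} {β : ℝ}

/-- Splitting a configuration into the positions of two particles and the rest. -/
def pairSplit {d p : ℕ} {i j : Fin p} (hij : i ≠ j) :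
    {x : Fin p → Site d // x i = 0 ∧ x j = 0} × (Fin 2 → Site d) ≃ (Fin p → Site d) where
  toFun q := q.1.1 + (Pi.single i (q.2 0) + Pi.single j (q.2 1))
  invFun x := (⟨x - (Pi.single i (x i) + Pi.single j (x j)), by simp [hij, hij.symm]⟩, ![x i, x j])
  left_inv := by
    rintro ⟨⟨x, hxi, hxj⟩, y⟩
    ext k
    · simp [hxi, hxj, hij, hij.symm]
    · fin_cases k <;> simp [hxi, hxj, hij, hij.symm]
  right_inv x := by simp

/-- The part of the many-particle generator that concerns the particles `i` and `j`. -/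
def pairOp (ha : IsJumpLaw a) (hB : ∀ x, |B x| ≤ β) (κ : ℝ≥0) {p : ℕ} (i j : Fin p)
    (f : (Fin p → Site d) → ℝ≥0∞) (x : Fin p → Site d) : ℝ≥0∞ :=
  ∑' z, ENNReal.ofReal (κ * a z) * f (x + Pi.single i z) +
    ∑' z, ENNReal.ofReal (κ * a z) * f (x + Pi.single j z) +
    (particles ha hB 2 κ).diag ![x i, x j] * f x

lemma l2_pairOp_le (ha : IsJumpLaw a) (hB : ∀ x, |B x| ≤ β) (κ : ℝ≥0) {p : ℕ} {i j : Fin p}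
    (hij : i ≠ j) {f : (Fin p → Site d) → ℝ≥0∞} (hf : l2 f ≠ ⊤) :
    l2 (pairOp ha hB κ i j f) ≤ (particles ha hB 2 κ).norm * l2 f := by
  set G := particles ha hB 2 κ with hG
  have hsq : ∀ F : (Fin p → Site d) → ℝ≥0∞,
      ∑' x, F x = ∑' k, ∑' y, F (pairSplit hij (k, y)) := fun F => by
    rw [← (pairSplit hij).tsum_eq]
    exact ENNReal.tsum_prod' (f := fun q => F (pairSplit hij q))
  have hop : ∀ k y, pairOp ha hB κ i j f (pairSplit hij (k, y)) =
      G.op (fun y => f (pairSplit hij (k, y))) y := by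
    intro k y
    obtain ⟨k, hki, hkj⟩ := k
    have hy : ![pairSplit hij (⟨k, hki, hkj⟩, y) i, pairSplit hij (⟨k, hki, hkj⟩, y) j] = y := by
      ext l
      fin_cases l <;> simp [pairSplit, hki, hkj, hij, hij.symm]
    rw [pairOp, hy, Hopping.op, ← hG]
    congr 1
    rw [ENNReal.tsum_prod']
    refine Eq.trans ?_ (tsum_fintype _).symm
    rw [Fin.sum_univ_two]
    congr 1 <;> refine tsum_congr fun z => ?_
    · simp only [hG, particles, pairSplit, Equiv.coe_fn_mk]
      congr 2
      simp [Pi.single_add]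
      abel
    · simp only [hG, particles, pairSplit, Equiv.coe_fn_mk]
      congr 2
      simp [Pi.single_add]
      abel
  rw [l2_le_iff, hsq, mul_pow, l2_sq, hsq (fun x => f x ^ 2), ← ENNReal.tsum_mul_left]
  have hfin : ∀ k, ∑' y, f (pairSplit hij (k, y)) ^ 2 ≠ ⊤ := by
    have : ∑' x, f x ^ 2 ≠ ⊤ := by rw [← l2_sq]; exact ENNReal.pow_ne_top hf
    rw [hsq] at this
    exact ENNReal.ne_top_of_tsum_ne_top this
  refine ENNReal.tsum_le_tsum fun k => ?_
  simp_rw [hop]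
  have hk : l2 (fun y => f (pairSplit hij (k, y))) ≠ ⊤ := by
    intro h
    have := hfin k
    rw [← l2_sq, h] at this
    simp at this
  rw [← l2_sq, ← l2_sq, ← mul_pow]
  gcongr
  exact Hopping.l2_op_le hk

lemma sum_erase_add {p : ℕ} (H : Fin p → ℝ≥0∞) :
    ∑ i, ∑ j ∈ Finset.univ.erase i, 2⁻¹ * (H i + H j) = ((p - 1 : ℕ) : ℝ≥0∞) * ∑ i, H i := by
  have h1 : ∀ i : Fin p, ∑ _j ∈ Finset.univ.erase i, 2⁻¹ * H i = ((p - 1 : ℕ) : ℝ≥0∞) * (2⁻¹ * H i) := by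
    intro i
    rw [Finset.sum_const, Finset.card_erase_of_mem (Finset.mem_univ i), Finset.card_univ,
      Fintype.card_fin, nsmul_eq_mul]
  have h2 : ∑ i, ∑ j ∈ Finset.univ.erase i, 2⁻¹ * H j
      = ∑ j, ∑ _i ∈ Finset.univ.erase j, 2⁻¹ * H j :=
    Finset.sum_comm' fun i j => by simp [ne_comm]
  simp_rw [mul_add, Finset.sum_add_distrib]
  rw [h2]
  simp_rw [h1]
  rw [← Finset.mul_sum, ← mul_add, ← Finset.sum_add_distrib]
  simp_rw [← add_mul, ENNReal.inv_two_add_inv_two, one_mul]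

lemma op_particles_eq_sum_pairOp (ha : IsJumpLaw a) (hB : ∀ x, |B x| ≤ β) {p : ℕ} (hp : 2 ≤ p)
    (κ : ℝ≥0) (f : (Fin p → Site d) → ℝ≥0∞) (x : Fin p → Site d) :
    (particles ha hB p (((p - 1 : ℕ) : ℝ≥0) * κ)).op f x =
      ∑ i, ∑ j ∈ Finset.univ.erase i, 2⁻¹ * pairOp ha hB κ i j f x := by
  have hβ : 0 ≤ β := (abs_nonneg _).trans (hB 0)
  have hcast : (((p - 1 : ℕ) : ℝ≥0) : ℝ) = p - 1 := by
    rw [NNReal.coe_natCast, Nat.cast_sub (by omega)]; simp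
  simp only [pairOp, mul_add _ (_ + _), Finset.sum_add_distrib]
  rw [sum_erase_add fun i : Fin p =>
    ∑' z : Site d, ENNReal.ofReal (κ * a z) * f (x + (Pi.single i z : Fin p → Site d))]
  rw [Hopping.op]
  congr 1
  · rw [ENNReal.tsum_prod', tsum_fintype, Finset.mul_sum]
    refine Finset.sum_congr rfl fun i _ => ?_
    rw [← ENNReal.tsum_mul_left]
    refine tsum_congr fun z => ?_
    simp only [particles]
    rw [← mul_assoc]
    congr 1
    rw [NNReal.coe_mul, mul_assoc, ENNReal.ofReal_mul (NNReal.coe_nonneg _), NNReal.coe_natCast,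
      ENNReal.ofReal_natCast]
  · simp_rw [← mul_assoc, ← Finset.sum_mul]
    congr 1
    have hnn : ∀ y : Fin 2 → Site d, 0 ≤ ((2 : ℕ) : ℝ) * κ + numPairs 2 * β + pairPotential B y :=
      fun y => by
        have h1 := abs_pairPotential_le hB y
        have h2 := neg_abs_le (pairPotential B y)
        have : 0 ≤ ((2 : ℕ) : ℝ) * κ := by positivity
        linarith
    have h2 : (2⁻¹ : ℝ≥0∞) = ENNReal.ofReal 2⁻¹ := by
      rw [ENNReal.ofReal_inv_of_pos two_pos]; simp
    simp only [particles]
    simp_rw [h2, ← ENNReal.ofReal_mul (show (0 : ℝ) ≤ 2⁻¹ by norm_num)]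
    rw [Finset.sum_congr rfl fun i _ => (ENNReal.ofReal_sum_of_nonneg fun j _ =>
      mul_nonneg (by norm_num) (hnn _)).symm, ← ENNReal.ofReal_sum_of_nonneg fun i _ =>
        Finset.sum_nonneg fun j _ => mul_nonneg (by norm_num) (hnn _)]
    congr 1
    simp only [pairPotential_two, Matrix.cons_val_zero, Matrix.cons_val_one, mul_add,
      Finset.sum_add_distrib, sum_erase_const]
    have h3 : ∑ i, ∑ j ∈ Finset.univ.erase i, (2⁻¹ : ℝ) * (2⁻¹ * B (x j - x i))
        = ∑ i, ∑ j ∈ Finset.univ.erase i, (2⁻¹ : ℝ) * (2⁻¹ * B (x i - x j)) :=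
      Finset.sum_comm' fun i j => by simp [ne_comm]
    rw [h3, pairPotential]
    simp_rw [← Finset.mul_sum]
    simp only [numPairs, NNReal.coe_mul, hcast]
    push_cast
    ring

/-- The many-particle exponents are controlled by the two-particle exponent. -/
lemma lyapunov_le_numPairs_mul (ha : IsJumpLaw a) (hB : ∀ x, |B x| ≤ β) {p : ℕ} (hp : 2 ≤ p)
    (κ : ℝ≥0) : lyapunov ha hB p (((p - 1 : ℕ) : ℝ≥0) * κ) ≤ numPairs p * lyapunov ha hB 2 κ := by
  have hcast : (((p - 1 : ℕ) : ℝ≥0) : ℝ) = p - 1 := by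
    rw [NNReal.coe_natCast, Nat.cast_sub (by omega)]; simp
  have hnorm : (particles ha hB p (((p - 1 : ℕ) : ℝ≥0) * κ)).norm ≤
      ENNReal.ofReal (numPairs p) * (particles ha hB 2 κ).norm := by
    refine Hopping.norm_le fun f hf => ?_
    rw [funext (op_particles_eq_sum_pairOp ha hB hp κ f)]
    calc _ ≤ ∑ i : Fin p, ∑ j ∈ Finset.univ.erase i,
          2⁻¹ * ((particles ha hB 2 κ).norm * l2 f) := by
          refine (l2_sum_le _ _).trans (Finset.sum_le_sum fun i _ => ?_)
          refine (l2_sum_le _ _).trans (Finset.sum_le_sum fun j hj => ?_)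
          rw [l2_const_mul]
          gcongr
          exact l2_pairOp_le ha hB κ (Finset.ne_of_mem_erase hj).symm hf
      _ = (∑ i : Fin p, ∑ _j ∈ Finset.univ.erase i, ENNReal.ofReal 2⁻¹) *
            ((particles ha hB 2 κ).norm * l2 f) := by
          simp_rw [Finset.sum_mul]; rw [ENNReal.ofReal_inv_of_pos two_pos, ENNReal.ofReal_ofNat]
      _ = _ := by
          rw [Finset.sum_congr rfl fun i _ => (ENNReal.ofReal_sum_of_nonneg fun j _ => by
            norm_num).symm, ← ENNReal.ofReal_sum_of_nonneg fun i _ =>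
              Finset.sum_nonneg fun j _ => by norm_num, sum_erase_const, ← mul_assoc]
          congr 3
          ring
  have h1 := ENNReal.toReal_mono (ENNReal.mul_ne_top ENNReal.ofReal_ne_top Hopping.norm_ne_top) hnorm
  rw [ENNReal.toReal_mul, ENNReal.toReal_ofReal (numPairs_nonneg p)] at h1
  simp only [lyapunov, NNReal.coe_mul, hcast] at h1 ⊢
  have h2 : numPairs 2 = 1 := by norm_num [numPairs]
  have h3 : 2 * (p : ℝ) * ((p - 1) * κ) = numPairs p * (4 * κ) := by rw [numPairs]; ring
  rw [h2, h3, Nat.cast_ofNat]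
  linarith

lemma sub_one_div_two_le_floor {p : ℕ} : ((p : ℝ) - 1) / 2 ≤ (p / 2 : ℕ) := by
  have : p ≤ 2 * (p / 2) + 1 := by omega
  have : (p : ℝ) ≤ 2 * (p / 2 : ℕ) + 1 := by exact_mod_cast this
  linarith

/-- The comparison of the `p`-th Lyapunov exponent with the second one. -/
theorem lyapunov_div_le {b : Site d → ℝ} (ha : IsJumpLaw a) (hb : Summable fun x => |b x|)
    (hB : ∀ x, |correlator b x| ≤ β) {p : ℕ} (hp : 3 ≤ p) (κ : ℝ≥0) :
    lyapunov ha hB p κ / p ≤ (p / 2 : ℕ) * lyapunov ha hB 2 (κ / p) := by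
  have hp0 : (0 : ℝ) < p := by exact_mod_cast (by omega : 0 < p)
  have hp1 : ((p - 1 : ℕ) : ℝ≥0) ≠ 0 := by
    exact_mod_cast (by omega : p - 1 ≠ 0)
  have h1 := lyapunov_le_numPairs_mul ha hB (by omega : 2 ≤ p) (κ / ((p - 1 : ℕ) : ℝ≥0))
  rw [mul_div_cancel₀ _ hp1] at h1
  have h2 : lyapunov ha hB 2 (κ / ((p - 1 : ℕ) : ℝ≥0)) ≤ lyapunov ha hB 2 (κ / p) := by
    refine lyapunov_antitone ha hB 2 ?_
    gcongr
    omega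
  have h3 := lyapunov_two_nonneg ha hb hB (κ / p)
  have h4 := numPairs_nonneg p
  rw [div_le_iff₀ hp0]
  calc lyapunov ha hB p κ ≤ numPairs p * lyapunov ha hB 2 (κ / p) := h1.trans (by gcongr)
    _ = ((p : ℝ) - 1) / 2 * lyapunov ha hB 2 (κ / p) * p := by rw [numPairs]; ring
    _ ≤ _ := by
        gcongr
        exact sub_one_div_two_le_floor

end Pairs

/-- For `p` particles the path series grows at the rate given by the spectral quantity. -/
theorem tendsto_log_particles {d : ℕ} {a B : Site d → ℝ} {β : ℝ} (ha : IsJumpLaw a)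
    (hB : ∀ x, |B x| ≤ β) {p : ℕ} (hp : 1 ≤ p) {κ : ℝ≥0} (hκ : 0 < κ) :
    Tendsto (fun t : ℝ≥0 => Real.log (Real.exp (-((numPairs p * β + 2 * p * κ) * t)) *
      ∑' k : ℕ, (t : ℝ) ^ k / k.factorial * (particles ha hB p κ).pathWeight k) / (t : ℝ)) atTop
      (𝓝 (lyapunov ha hB p κ)) :=
  Hopping.tendsto_log_pathWeight_series (p * κ)
    (mul_ne_zero (by exact_mod_cast (by omega : p ≠ 0)) hκ.ne') (particles_diag_ge ha hB p κ)
    (reach_particles ha hB p hκ) (slowlyVarying _) _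

end

section

section Euler

variable {E : Type*} [NormedAddCommGroup E] [NormedSpace ℝ E]

lemma norm_euler_le (H : E →L[ℝ] E) {T r : ℝ} (hT : 0 ≤ T) {n : ℕ} {m : ℕ → E}
    (hstep : ∀ k < n, ‖m (k + 1) - m k - (T / n) • H (m k)‖ ≤ r * ‖m k‖) :
    ∀ k ≤ n, ‖m k‖ ≤ Real.exp (k * (T / n * ‖H‖ + r)) * ‖m 0‖ := by
  intro k hk
  induction k with
  | zero => simp
  | succ k ih =>
    have h1 := hstep k (by omega)
    have hd : (0 : ℝ) ≤ T / n := by positivity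
    have h2 : ‖m (k + 1)‖ ≤ (1 + (T / n * ‖H‖ + r)) * ‖m k‖ := by
      calc ‖m (k + 1)‖ = ‖(m (k + 1) - m k - (T / n) • H (m k)) + m k + (T / n) • H (m k)‖ := by
            congr 1; abel
        _ ≤ ‖m (k + 1) - m k - (T / n) • H (m k)‖ + ‖m k‖ + ‖(T / n) • H (m k)‖ := norm_add₃_le
        _ ≤ r * ‖m k‖ + ‖m k‖ + T / n * (‖H‖ * ‖m k‖) := by
            gcongr
            rw [norm_smul, Real.norm_of_nonneg hd]
            gcongr
            exact H.le_opNorm _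
        _ = _ := by ring
    refine h2.trans ?_
    have h3 := Real.add_one_le_exp (T / n * ‖H‖ + r)
    calc _ ≤ Real.exp (T / n * ‖H‖ + r) * (Real.exp (k * (T / n * ‖H‖ + r)) * ‖m 0‖) := by
          gcongr
          · linarith
          · exact ih (by omega)
      _ = _ := by rw [← mul_assoc, ← Real.exp_add]; congr 2; push_cast; ring

variable [CompleteSpace E]

lemma tendsto_mul_norm_exp_sub (H : E →L[ℝ] E) (T : ℝ) :
    Tendsto (fun n : ℕ => n * ‖NormedSpace.exp ((T / n) • H) - 1 - (T / n) • H‖) atTop (𝓝 0) := by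
  have h := (hasDerivAt_exp_smul_const (𝕂 := ℝ) H 0)
  rw [hasDerivAt_iff_isLittleO_nhds_zero] at h
  simp only [zero_add, zero_smul, NormedSpace.exp_zero, one_mul] at h
  have hd : Tendsto (fun n : ℕ => T / (n : ℝ)) atTop (𝓝 0) :=
    tendsto_const_nhds.div_atTop tendsto_natCast_atTop_atTop
  have h1 := (h.comp_tendsto hd).norm_left
  have h2 : (fun n : ℕ => (n : ℝ) * ‖NormedSpace.exp ((T / n) • H) - 1 - (T / n) • H‖)
      =o[atTop] fun n : ℕ => (n : ℝ) * (T / n) :=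
    (Asymptotics.isBigO_refl (fun n : ℕ => (n : ℝ)) atTop).mul_isLittleO h1
  have h3 : (fun n : ℕ => (n : ℝ) * (T / n)) =O[atTop] fun _ => (1 : ℝ) := by
    refine Asymptotics.IsBigO.of_bound |T| ?_
    filter_upwards [eventually_gt_atTop 0] with n hn
    rw [mul_div_cancel₀ _ (by positivity)]
    simp
  exact (Asymptotics.isLittleO_one_iff ℝ).1 (h2.trans_isBigO h3)

/-- Perturbed Euler polygons converge to the exponential flow. -/
lemma tendsto_euler (H : E →L[ℝ] E) {T : ℝ} (hT : 0 ≤ T) {v : E} {m : ℕ → ℕ → E} {r : ℕ → ℝ}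
    (hr0 : ∀ n, 0 ≤ r n) (hr : Tendsto (fun n : ℕ => n * r n) atTop (𝓝 0)) (h0 : ∀ n, m n 0 = v)
    (hstep : ∀ᶠ n in atTop, ∀ k < n,
      ‖m n (k + 1) - m n k - (T / n) • H (m n k)‖ ≤ r n * ‖m n k‖) :
    Tendsto (fun n => m n n) atTop (𝓝 (NormedSpace.exp (T • H) v)) := by
  set q : ℕ → ℝ := fun n => ‖NormedSpace.exp ((T / n) • H) - 1 - (T / n) • H‖ with hq
  have hqt : Tendsto (fun n : ℕ => n * q n) atTop (𝓝 0) := tendsto_mul_norm_exp_sub H T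
  have hq0 : ∀ n, 0 ≤ q n := fun n => norm_nonneg _
  rw [tendsto_iff_norm_sub_tendsto_zero]
  have hlim : Tendsto (fun n : ℕ => (n * (r n + q n)) *
      (Real.exp (T * ‖H‖ + n * (r n + q n)) * ‖v‖)) atTop (𝓝 0) := by
    have h1 : Tendsto (fun n : ℕ => n * (r n + q n)) atTop (𝓝 0) := by
      simpa [mul_add] using hr.add hqt
    have h2 : Tendsto (fun n : ℕ => Real.exp (T * ‖H‖ + n * (r n + q n)) * ‖v‖) atTop
        (𝓝 (Real.exp (T * ‖H‖ + 0) * ‖v‖)) :=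
      ((Real.continuous_exp.tendsto _).comp (tendsto_const_nhds.add h1)).mul_const _
    simpa using h1.mul h2
  refine squeeze_zero' (Eventually.of_forall fun n => norm_nonneg _) ?_ hlim
  filter_upwards [hstep, eventually_gt_atTop 0] with n hn hn0
  have hn0' : (0 : ℝ) < n := by exact_mod_cast hn0
  set δ : ℝ := T / n with hδ
  have hδ0 : 0 ≤ δ := by positivity
  set s : ℝ := δ * ‖H‖ + (r n + q n) with hs
  have hbound : ∀ k ≤ n, ‖m n k‖ ≤ Real.exp (k * s) * ‖v‖ := fun k hk => by
    have := norm_euler_le H hT hn k hk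
    rw [h0] at this
    refine this.trans ?_
    gcongr
    rw [hs]
    linarith [hq0 n]
  set X := NormedSpace.exp (δ • H) with hX
  have hXn : ‖X‖ ≤ Real.exp s := by
    have : ‖X‖ ≤ q n + 1 + δ * ‖H‖ := by
      calc ‖X‖ = ‖(X - 1 - δ • H) + 1 + δ • H‖ := by congr 1; abel
        _ ≤ ‖X - 1 - δ • H‖ + ‖(1 : E →L[ℝ] E)‖ + ‖δ • H‖ := norm_add₃_le
        _ ≤ _ := by
            gcongr
            · exact ContinuousLinearMap.norm_id_le
            · rw [norm_smul, Real.norm_of_nonneg hδ0]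
    linarith [Real.add_one_le_exp s, hr0 n]
  have herr : ∀ k ≤ n, ‖m n k - (X ^ k) v‖ ≤ (k * (r n + q n)) * (Real.exp (k * s) * ‖v‖) := by
    intro k hk
    induction k with
    | zero => simp [h0]
    | succ k ih =>
      have e1 : m n (k + 1) - (X ^ (k + 1)) v = (m n (k + 1) - m n k - δ • H (m n k))
          - (X - 1 - δ • H) (m n k) + X (m n k - (X ^ k) v) := by
        rw [pow_succ']
        simp only [sub_apply, smul_apply, map_sub,
          mul_apply_eq_comp, one_apply_eq_self]
        abel
      have hb := hbound k (by omega)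
      have hmono : Real.exp (k * s) * ‖v‖ ≤ Real.exp ((k + 1 : ℕ) * s) * ‖v‖ := by
        have : 0 ≤ s := by rw [hs]; linarith [hr0 n, hq0 n, mul_nonneg hδ0 (norm_nonneg H)]
        gcongr
        omega
      calc ‖m n (k + 1) - (X ^ (k + 1)) v‖
          ≤ ‖m n (k + 1) - m n k - δ • H (m n k)‖ + ‖(X - 1 - δ • H) (m n k)‖
            + ‖X (m n k - (X ^ k) v)‖ := by
            rw [e1]; exact (norm_add_le _ _).trans (by gcongr; exact norm_sub_le _ _)
        _ ≤ r n * (Real.exp (k * s) * ‖v‖) + q n * (Real.exp (k * s) * ‖v‖)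
            + Real.exp s * ((k * (r n + q n)) * (Real.exp (k * s) * ‖v‖)) := by
            gcongr
            · exact (hn k (by omega)).trans (by gcongr; exact hr0 n)
            · exact (ContinuousLinearMap.le_opNorm _ _).trans (by gcongr)
            · exact (ContinuousLinearMap.le_opNorm _ _).trans (by gcongr; exact ih (by omega))
        _ = (r n + q n) * (Real.exp (k * s) * ‖v‖)
            + (k * (r n + q n)) * (Real.exp ((k + 1 : ℕ) * s) * ‖v‖) := by
            have : Real.exp ((k + 1 : ℕ) * s) = Real.exp s * Real.exp (k * s) := by
              rw [← Real.exp_add]; congr 1; push_cast; ring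
            rw [this]; ring
        _ ≤ (r n + q n) * (Real.exp ((k + 1 : ℕ) * s) * ‖v‖)
            + (k * (r n + q n)) * (Real.exp ((k + 1 : ℕ) * s) * ‖v‖) := by
            gcongr
            linarith [hr0 n, hq0 n]
        _ = _ := by push_cast; ring
  have hXpow : X ^ n = NormedSpace.exp (T • H) := by
    let _ : NormedAlgebra ℚ (E →L[ℝ] E) := NormedAlgebra.restrictScalars ℚ ℝ _
    rw [hX, ← NormedSpace.exp_nsmul, hδ, ← Nat.cast_smul_eq_nsmul ℝ, smul_smul,
      mul_div_cancel₀ _ hn0'.ne']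
  have := herr n le_rfl
  rw [hXpow] at this
  refine this.trans (le_of_eq ?_)
  congr 3
  rw [hs, hδ]
  field_simp

lemma exp_smul_sub_apply (A : E →L[ℝ] E) (T c : ℝ) (v : E) :
    NormedSpace.exp (T • (A - c • 1)) v = Real.exp (-(c * T)) • NormedSpace.exp (T • A) v := by
  let _ : NormedAlgebra ℚ (E →L[ℝ] E) := NormedAlgebra.restrictScalars ℚ ℝ _
  have h1 : T • (A - c • (1 : E →L[ℝ] E)) = algebraMap ℝ _ (-(c * T)) + T • A := by
    rw [Algebra.algebraMap_eq_smul_one, smul_sub, smul_smul, neg_smul, mul_comm c T]; abel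
  rw [h1, NormedSpace.exp_add_of_commute (Algebra.commutes _ _), ← NormedSpace.algebraMap_exp_comm,
    Algebra.algebraMap_eq_smul_one, smul_mul_assoc, one_mul, smul_apply, Real.exp_eq_exp_ℝ]

lemma hasSum_exp_smul_apply (A : E →L[ℝ] E) (T : ℝ) (v : E) :
    HasSum (fun k : ℕ => (T ^ k / k.factorial) • (A ^ k) v) (NormedSpace.exp (T • A) v) := by
  have h := (NormedSpace.exp_series_hasSum_exp' (𝕂 := ℝ) (T • A)).mapL
    (ContinuousLinearMap.apply ℝ E v)
  refine h.congr_fun fun k => ?_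
  rw [ContinuousLinearMap.apply_apply, smul_pow, smul_smul, smul_apply]
  congr 1
  ring

end Euler

/-- Bounded real functions with the supremum norm. -/
abbrev BddFun (Γ : Type*) : Type _ := lp (fun _ : Γ => ℝ) ⊤

namespace BddFun

variable {Γ : Type*}

/-- A bounded function as an element of the Banach space of bounded functions. -/
def mk (f : Γ → ℝ) (C : ℝ) (h : ∀ x, ‖f x‖ ≤ C) : BddFun Γ :=
  ⟨f, memℓp_infty ⟨C, by rintro _ ⟨x, rfl⟩; exact h x⟩⟩

@[simp] lemma mk_apply (f : Γ → ℝ) (C : ℝ) (h : ∀ x, ‖f x‖ ≤ C) (x : Γ) : mk f C h x = f x := rfl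

lemma norm_coe_le_norm (f : BddFun Γ) (x : Γ) : ‖f x‖ ≤ ‖f‖ :=
  lp.norm_apply_le_norm ENNReal.top_ne_zero f x

lemma norm_le {f : BddFun Γ} {C : ℝ} (hC : 0 ≤ C) (h : ∀ x, ‖f x‖ ≤ C) : ‖f‖ ≤ C :=
  lp.norm_le_of_forall_le hC h

/-- Evaluation at a point. -/
def eval (x : Γ) : BddFun Γ →L[ℝ] ℝ :=
  LinearMap.mkContinuous
    { toFun := fun f => f x, map_add' := fun _ _ => rfl, map_smul' := fun _ _ => rfl } 1
    fun f => by rw [one_mul]; exact f.norm_coe_le_norm x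

@[simp] lemma eval_apply (x : Γ) (f : BddFun Γ) : eval x f = f x := rfl

end BddFun

namespace Hopping

variable {Γ σ : Type*} [AddCommGroup Γ] (G : Hopping Γ σ)

lemma summable_weight_mul (f : BddFun Γ) (x : Γ) :
    Summable fun s => (G.weight s).toReal * f (x + G.shift s) := by
  refine Summable.of_norm_bounded ((ENNReal.summable_toReal G.weight_ne_top).mul_right ‖f‖)
    fun s => ?_
  rw [norm_mul, Real.norm_of_nonneg ENNReal.toReal_nonneg]
  gcongr
  exact f.norm_coe_le_norm _

lemma norm_real_op_le (f : BddFun Γ) (x : Γ) :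
    ‖∑' s, (G.weight s).toReal * f (x + G.shift s) + (G.diag x).toReal * f x‖ ≤
      (∑' s, (G.weight s).toReal + G.diagBound.toReal) * ‖f‖ := by
  rw [add_mul, ← tsum_mul_right]
  refine (norm_add_le _ _).trans (add_le_add ?_ ?_)
  · refine (norm_tsum_le_tsum_norm (G.summable_weight_mul f x).norm).trans ?_
    refine Summable.tsum_le_tsum (fun s => ?_) (G.summable_weight_mul f x).norm
      ((ENNReal.summable_toReal G.weight_ne_top).mul_right ‖f‖)
    rw [norm_mul, Real.norm_of_nonneg ENNReal.toReal_nonneg]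
    gcongr
    exact f.norm_coe_le_norm _
  · rw [norm_mul, Real.norm_of_nonneg ENNReal.toReal_nonneg]
    gcongr
    · exact G.diagBound_ne_top
    · exact G.diag_le x
    · exact f.norm_coe_le_norm _

/-- The hopping operator on bounded real functions. -/
def bddOp : BddFun Γ →L[ℝ] BddFun Γ :=
  LinearMap.mkContinuous
    { toFun := fun f => BddFun.mk
        (fun x => ∑' s, (G.weight s).toReal * f (x + G.shift s) + (G.diag x).toReal * f x)
        ((∑' s, (G.weight s).toReal + G.diagBound.toReal) * ‖f‖) (G.norm_real_op_le f)
      map_add' := fun f g => by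
        ext x
        simp only [BddFun.mk_apply, lp.coeFn_add, Pi.add_apply, mul_add]
        rw [(G.summable_weight_mul f x).tsum_add (G.summable_weight_mul g x)]
        ring
      map_smul' := fun c f => by
        ext x
        simp only [BddFun.mk_apply, lp.coeFn_smul, Pi.smul_apply, smul_eq_mul, RingHom.id_apply,
          mul_add, ← tsum_mul_left]
        congr 1
        · exact tsum_congr fun s => by ring
        · ring }
    (∑' s, (G.weight s).toReal + G.diagBound.toReal)
    (fun f => BddFun.norm_le (mul_nonneg (add_nonneg
      (tsum_nonneg fun _ => ENNReal.toReal_nonneg) ENNReal.toReal_nonneg) (norm_nonneg f))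
        (G.norm_real_op_le f))

lemma bddOp_apply (f : BddFun Γ) (x : Γ) :
    G.bddOp f x = ∑' s, (G.weight s).toReal * f (x + G.shift s) + (G.diag x).toReal * f x := rfl

lemma bddOp_pow_one_apply (k : ℕ) (x : Γ) :
    ((G.bddOp ^ k) 1) x = ((G.op^[k] fun _ => 1) x).toReal := by
  induction k generalizing x with
  | zero => simp
  | succ k ih =>
    rw [pow_succ', mul_apply_eq_comp, bddOp_apply, Function.iterate_succ_apply', op]
    have h1 : ∑' s, G.weight s * (G.op^[k] fun _ => 1) (x + G.shift s) ≠ ⊤ := by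
      have := iterate_one_ne_top (G := G) (k + 1) x
      rw [Function.iterate_succ_apply', op] at this
      exact (ENNReal.add_ne_top.1 this).1
    rw [ENNReal.toReal_add h1 (ENNReal.mul_ne_top
      (ne_top_of_le_ne_top G.diagBound_ne_top (G.diag_le x)) (iterate_one_ne_top _ _)),
      ENNReal.toReal_mul, ENNReal.tsum_toReal_eq fun s => ENNReal.ne_top_of_tsum_ne_top h1 s, ih]
    simp_rw [ih, ENNReal.toReal_mul]

lemma exp_bddOp_one_apply_zero (T c : ℝ) :
    (NormedSpace.exp (T • (G.bddOp - c • 1)) 1 : BddFun Γ) 0 =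
      Real.exp (-(c * T)) * ∑' k : ℕ, T ^ k / k.factorial * G.pathWeight k := by
  rw [exp_smul_sub_apply, lp.coeFn_smul, Pi.smul_apply, smul_eq_mul]
  congr 1
  have h := (hasSum_exp_smul_apply G.bddOp T 1).mapL (BddFun.eval (0 : Γ))
  refine h.tsum_eq.symm.trans (tsum_congr fun k => ?_)
  rw [pathWeight, ← bddOp_pow_one_apply, BddFun.eval_apply, lp.coeFn_smul, Pi.smul_apply,
    smul_eq_mul]

end Hopping

end

section

namespace IsWienerField

variable {Ω : Type*} {mΩ : MeasurableSpace Ω} {μ : Measure Ω} {𝓕 : Filtration ℝ≥0 mΩ}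
  {d : ℕ} {B : Site d → ℝ} {W : ℝ≥0 → Site d → Ω → ℝ}

lemma measurable_eval (hW : IsWienerField 𝓕 μ B W) (t : ℝ≥0) (x : Site d) : Measurable (W t x) :=
  (hW.adapted t x).mono (𝓕.le t) le_rfl

lemma measurable_increment (hW : IsWienerField 𝓕 μ B W) (s t : ℝ≥0) (x : Site d) :
    Measurable fun ω => W t x ω - W s x ω :=
  (hW.measurable_eval t x).sub (hW.measurable_eval s x)

lemma measurable_increment_of_le (hW : IsWienerField 𝓕 μ B W) {s t r : ℝ≥0} (hs : s ≤ r)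
    (ht : t ≤ r) (x : Site d) : Measurable[𝓕 r] fun ω => W t x ω - W s x ω :=
  ((hW.adapted t x).mono (𝓕.mono ht) le_rfl).sub ((hW.adapted s x).mono (𝓕.mono hs) le_rfl)

lemma hasGaussianLaw_increment (hW : IsWienerField 𝓕 μ B W) (s t : ℝ≥0) (x : Site d) :
    HasGaussianLaw (fun ω => W t x ω - W s x ω) μ :=
  hW.gaussian.hasGaussianLaw_fun_sub (s := (t, x)) (t := (s, x))

lemma memLp_eval (hW : IsWienerField 𝓕 μ B W) (t : ℝ≥0) (x : Site d) {q : ℝ≥0∞} (hq : q ≠ ⊤) :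
    MemLp (W t x) q μ :=
  (hW.gaussian.hasGaussianLaw_eval (t, x)).memLp hq

lemma memLp_increment (hW : IsWienerField 𝓕 μ B W) (s t : ℝ≥0) (x : Site d) {q : ℝ≥0∞}
    (hq : q ≠ ⊤) : MemLp (fun ω => W t x ω - W s x ω) q μ :=
  (hW.hasGaussianLaw_increment s t x).memLp hq

lemma indepFun_increment (hW : IsWienerField 𝓕 μ B W) {s t : ℝ≥0} (hst : s ≤ t) {Z : Ω → ℝ}
    (hZ : Measurable[𝓕 s] Z) {h : (Site d → ℝ) → ℝ} (hh : Measurable h) :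
    IndepFun Z (fun ω => h fun x => W t x ω - W s x ω) μ := by
  rw [IndepFun_iff_Indep]
  refine indep_of_indep_of_le_left (indep_of_indep_of_le_right
    (hW.indep_increments s t hst).symm ?_) hZ.comap_le
  rw [show (fun ω => h fun x => W t x ω - W s x ω) = h ∘ fun ω x => W t x ω - W s x ω from rfl,
    ← MeasurableSpace.comap_comp]
  exact MeasurableSpace.comap_mono hh.comap_le

lemma indepFun_increment_apply (hW : IsWienerField 𝓕 μ B W) {s t : ℝ≥0} (hst : s ≤ t) {Z : Ω → ℝ}
    (hZ : Measurable[𝓕 s] Z) (x : Site d) :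
    IndepFun Z (fun ω => W t x ω - W s x ω) μ :=
  hW.indepFun_increment hst hZ (h := fun y => y x) (measurable_pi_apply x)

lemma memLp_mul_increment (hW : IsWienerField 𝓕 μ B W) {s t : ℝ≥0} (hst : s ≤ t) {Z : Ω → ℝ}
    (hZ : Measurable[𝓕 s] Z) (hZ2 : MemLp Z 2 μ) (x : Site d) :
    MemLp (fun ω => Z ω * (W t x ω - W s x ω)) 2 μ := by
  have hm : Measurable fun ω => Z ω * (W t x ω - W s x ω) :=
    (hZ.mono (𝓕.le s) le_rfl).mul (hW.measurable_increment s t x)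
  rw [memLp_two_iff_integrable_sq hm.aestronglyMeasurable]
  have h := ((hW.indepFun_increment hst (hZ.pow_const 2) (h := fun y => y x ^ 2)
    (by fun_prop))).integrable_mul hZ2.integrable_sq
    (hW.memLp_increment s t x (q := 2) (by norm_num)).integrable_sq
  refine h.congr (Eventually.of_forall fun ω => ?_)
  simp only [Pi.mul_apply]
  ring

variable [IsProbabilityMeasure μ]

lemma integral_increment (hW : IsWienerField 𝓕 μ B W) (s t : ℝ≥0) (x : Site d) :
    ∫ ω, (W t x ω - W s x ω) ∂μ = 0 := by
  rw [integral_sub ((hW.memLp_eval t x ENNReal.one_ne_top).integrable le_rfl)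
    ((hW.memLp_eval s x ENNReal.one_ne_top).integrable le_rfl), hW.mean_zero, hW.mean_zero, sub_zero]

lemma integral_increment_mul (hW : IsWienerField 𝓕 μ B W) {s t : ℝ≥0} (hst : s ≤ t)
    (x y : Site d) :
    ∫ ω, (W t x ω - W s x ω) * (W t y ω - W s y ω) ∂μ = (t - s : ℝ) * B (x - y) := by
  have h2 : ∀ t x, MemLp (W t x) 2 μ := fun t x => hW.memLp_eval t x (by norm_num)
  have h := covariance_eq_sub ((h2 t x).sub (h2 s x)) ((h2 t y).sub (h2 s y))
  rw [covariance_sub_left (h2 t x) (h2 s x) ((h2 t y).sub (h2 s y)),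
    covariance_sub_right (h2 t x) (h2 t y) (h2 s y),
    covariance_sub_right (h2 s x) (h2 t y) (h2 s y),
    hW.covariance, hW.covariance, hW.covariance, hW.covariance] at h
  have e1 : μ[W t x - W s x] = 0 := hW.integral_increment s t x
  rw [e1, zero_mul, sub_zero, min_eq_left hst, min_eq_right hst, min_self, min_self] at h
  refine Eq.trans ?_ (h.symm.trans ?_)
  · rfl
  · ring

lemma map_increment (hW : IsWienerField 𝓕 μ B W) {s t : ℝ≥0} (hst : s ≤ t) (x : Site d) :
    μ.map (fun ω => W t x ω - W s x ω) =
      (gaussianReal 0 (B 0).toNNReal).map (fun y => √(t - s : ℝ) * y) := by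
  have hts : (0 : ℝ) ≤ t - s := sub_nonneg.2 (by exact_mod_cast hst)
  rw [(hW.hasGaussianLaw_increment s t x).map_eq_gaussianReal, hW.integral_increment,
    variance_of_integral_eq_zero (hW.measurable_increment s t x).aemeasurable
      (hW.integral_increment s t x), gaussianReal_map_const_mul, mul_zero]
  congr 1
  have := hW.integral_increment_mul hst x x
  simp_rw [← sq, sub_self] at this
  rw [this, Real.toNNReal_mul hts]
  congr 1
  ext
  rw [Real.coe_toNNReal _ hts]
  exact (Real.sq_sqrt hts).symm

/-- Absolute moments of increments scale like powers of the square root of time. -/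
lemma integral_abs_increment_pow (hW : IsWienerField 𝓕 μ B W) {s t : ℝ≥0} (hst : s ≤ t)
    (x : Site d) (q : ℕ) :
    ∫ ω, |W t x ω - W s x ω| ^ q ∂μ =
      √(t - s : ℝ) ^ q * ∫ y, |y| ^ q ∂(gaussianReal 0 (B 0).toNNReal) := by
  have h1 : ∫ ω, |W t x ω - W s x ω| ^ q ∂μ =
      ∫ y, |y| ^ q ∂(μ.map fun ω => W t x ω - W s x ω) := by
    rw [integral_map (hW.measurable_increment s t x).aemeasurable
      (by fun_prop)]
  rw [h1, hW.map_increment hst, integral_map (by fun_prop) (by fun_prop), ← integral_const_mul]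
  refine integral_congr_ae (Eventually.of_forall fun y => ?_)
  simp only
  rw [abs_mul, mul_pow, abs_of_nonneg (Real.sqrt_nonneg _)]

lemma integral_mul_increment (hW : IsWienerField 𝓕 μ B W) {s t : ℝ≥0} (hst : s ≤ t) {Z : Ω → ℝ}
    (hZ : Measurable[𝓕 s] Z) (x : Site d) :
    ∫ ω, Z ω * (W t x ω - W s x ω) ∂μ = 0 := by
  have h := (hW.indepFun_increment_apply hst hZ x).integral_mul_eq_mul_integral
    (hZ.mono (𝓕.le s) le_rfl).aestronglyMeasurable
    (hW.measurable_increment s t x).aestronglyMeasurable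
  rw [hW.integral_increment, mul_zero] at h
  exact h

lemma integral_mul_increment_sq (hW : IsWienerField 𝓕 μ B W) {s t : ℝ≥0} (hst : s ≤ t)
    {Z : Ω → ℝ} (hZ : Measurable[𝓕 s] Z) (x : Site d) :
    ∫ ω, Z ω * (W t x ω - W s x ω) ^ 2 ∂μ = (∫ ω, Z ω ∂μ) * ((t - s : ℝ) * B 0) := by
  have h := ((hW.indepFun_increment hst hZ (h := fun y => y x ^ 2)
    (by fun_prop))).integral_mul_eq_mul_integral
    (hZ.mono (𝓕.le s) le_rfl).aestronglyMeasurable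
    ((hW.measurable_increment s t x).pow_const 2).aestronglyMeasurable
  have h2 := hW.integral_increment_mul hst x x
  simp_rw [← sq, sub_self] at h2
  rw [h2] at h
  exact h

/-- The covariance of two elementary stochastic integrals over intervals starting in order. -/
lemma integral_piece_mul_piece_of_le (hW : IsWienerField 𝓕 μ B W) (x : Site d)
    {s r s' r' : ℝ≥0} (hsr' : s' ≤ r') (hss : s ≤ s') {c c' : Ω → ℝ}
    (hc : Measurable[𝓕 s] c) (hc2 : MemLp c 2 μ) (hc' : Measurable[𝓕 s'] c')
    (hc2' : MemLp c' 2 μ) :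
    ∫ ω, (c ω * (W r x ω - W s x ω)) * (c' ω * (W r' x ω - W s' x ω)) ∂μ =
      (∫ ω, c ω * c' ω ∂μ) * (max (min (r : ℝ) r' - s') 0 * B 0) := by
  have hcs' : Measurable[𝓕 s'] c := hc.mono (𝓕.mono hss) le_rfl
  rcases le_total r s' with hr | hr
  · have h0 : max (min (r : ℝ) r' - s') 0 = 0 :=
      max_eq_right (sub_nonpos.2 ((min_le_left _ _).trans (by exact_mod_cast hr)))
    rw [h0, zero_mul, mul_zero, ← hW.integral_mul_increment hsr'
      (Z := fun ω => c ω * (W r x ω - W s x ω) * c' ω)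
      ((hcs'.mul (hW.measurable_increment_of_le hss hr x)).mul hc') x]
    exact integral_congr_ae (Eventually.of_forall fun ω => by ring)
  have hsplit : ∫ ω, (c ω * (W r x ω - W s x ω)) * (c' ω * (W r' x ω - W s' x ω)) ∂μ =
      ∫ ω, (c ω * (W r x ω - W s' x ω)) * (c' ω * (W r' x ω - W s' x ω)) ∂μ := by
    have hi1 := (hW.memLp_mul_increment hss hc hc2 x).integrable_mul
      (hW.memLp_mul_increment hsr' hc' hc2' x)
    have hi2 := (hW.memLp_mul_increment hr hcs' hc2 x).integrable_mul
      (hW.memLp_mul_increment hsr' hc' hc2' x)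
    have h0 := hW.integral_mul_increment hsr'
      (Z := fun ω => c ω * (W s' x ω - W s x ω) * c' ω)
      ((hcs'.mul (hW.measurable_increment_of_le hss le_rfl x)).mul hc') x
    have e : ∀ ω, (c ω * (W r x ω - W s x ω)) * (c' ω * (W r' x ω - W s' x ω)) =
        ((fun ω => c ω * (W s' x ω - W s x ω)) * (fun ω => c' ω * (W r' x ω - W s' x ω))) ω +
        ((fun ω => c ω * (W r x ω - W s' x ω)) * (fun ω => c' ω * (W r' x ω - W s' x ω))) ω := by
      intro ω; simp only [Pi.mul_apply]; ring
    rw [integral_congr_ae (Eventually.of_forall e), integral_add hi1 hi2]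
    have h0' : ∫ ω, ((fun ω => c ω * (W s' x ω - W s x ω)) *
        (fun ω => c' ω * (W r' x ω - W s' x ω))) ω ∂μ = 0 := by
      rw [← h0]
      exact integral_congr_ae (Eventually.of_forall fun ω => by simp only [Pi.mul_apply]; ring)
    rw [h0', zero_add]
    rfl
  rw [hsplit]
  have key : ∀ {c c' : Ω → ℝ} {r r' : ℝ≥0}, Measurable[𝓕 s'] c → MemLp c 2 μ →
      Measurable[𝓕 s'] c' → MemLp c' 2 μ → s' ≤ r → r ≤ r' →
      ∫ ω, (c ω * (W r x ω - W s' x ω)) * (c' ω * (W r' x ω - W s' x ω)) ∂μ =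
        (∫ ω, c ω * c' ω ∂μ) * ((r - s' : ℝ) * B 0) := by
    intro c c' r r' hc hc2 hc' hc2' hr hrr
    rw [← hW.integral_mul_increment_sq hr (Z := fun ω => c ω * c' ω) (hc.mul hc') x]
    have h0 := hW.integral_mul_increment hrr
      (Z := fun ω => c ω * (W r x ω - W s' x ω) * c' ω)
      (((hc.mono (𝓕.mono hr) le_rfl).mul (hW.measurable_increment_of_le hr le_rfl x)).mul
        (hc'.mono (𝓕.mono hr) le_rfl)) x
    have hi1 := (hW.memLp_mul_increment hr hc hc2 x).integrable_mul
      (hW.memLp_mul_increment hr hc' hc2' x)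
    have hi2 := (hW.memLp_mul_increment hr hc hc2 x).integrable_mul
      (hW.memLp_mul_increment hrr (hc'.mono (𝓕.mono hr) le_rfl) hc2' x)
    have e : ∀ ω, (c ω * (W r x ω - W s' x ω)) * (c' ω * (W r' x ω - W s' x ω)) =
        ((fun ω => c ω * (W r x ω - W s' x ω)) * (fun ω => c' ω * (W r x ω - W s' x ω))) ω +
        ((fun ω => c ω * (W r x ω - W s' x ω)) * (fun ω => c' ω * (W r' x ω - W r x ω))) ω := by
      intro ω; simp only [Pi.mul_apply]; ring
    rw [integral_congr_ae (Eventually.of_forall e), integral_add hi1 hi2]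
    have h0' : ∫ ω, ((fun ω => c ω * (W r x ω - W s' x ω)) *
        (fun ω => c' ω * (W r' x ω - W r x ω))) ω ∂μ = 0 := by
      rw [← h0]
      exact integral_congr_ae (Eventually.of_forall fun ω => by simp only [Pi.mul_apply]; ring)
    rw [h0', add_zero]
    exact integral_congr_ae (Eventually.of_forall fun ω => by simp only [Pi.mul_apply]; ring)
  rcases le_total r r' with hrr | hrr
  · rw [key hcs' hc2 hc' hc2' hr hrr, min_eq_left (by exact_mod_cast hrr),
      max_eq_left (sub_nonneg.2 (by exact_mod_cast hr))]
  · rw [min_eq_right (by exact_mod_cast hrr), max_eq_left (sub_nonneg.2 (by exact_mod_cast hsr'))]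
    have := key hc' hc2' hcs' hc2 hsr' hrr
    simp_rw [mul_comm (c' _) (c _)] at this
    rw [← this]
    exact integral_congr_ae (Eventually.of_forall fun ω => by ring)

/-- The covariance of two elementary stochastic integrals. -/
lemma integral_piece_mul_piece (hW : IsWienerField 𝓕 μ B W) (x : Site d)
    {s r s' r' : ℝ≥0} (hsr : s ≤ r) (hsr' : s' ≤ r') {c c' : Ω → ℝ}
    (hc : Measurable[𝓕 s] c) (hc2 : MemLp c 2 μ) (hc' : Measurable[𝓕 s'] c')
    (hc2' : MemLp c' 2 μ) :
    ∫ ω, (c ω * (W r x ω - W s x ω)) * (c' ω * (W r' x ω - W s' x ω)) ∂μ =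
      (∫ ω, c ω * c' ω ∂μ) * (max (min (r : ℝ) r' - max (s : ℝ) s') 0 * B 0) := by
  rcases le_total s s' with h | h
  · rw [hW.integral_piece_mul_piece_of_le x hsr' h hc hc2 hc' hc2',
      max_eq_right (a := (s : ℝ)) (by exact_mod_cast h)]
  · have := hW.integral_piece_mul_piece_of_le x (r := r') hsr h hc' hc2' hc hc2
    rw [max_eq_left (a := (s : ℝ)) (by exact_mod_cast h), min_comm]
    simp_rw [mul_comm (c _) (c' _)]
    rw [← this]
    exact integral_congr_ae (Eventually.of_forall fun ω => by ring)

end IsWienerField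

end

section

lemma enorm_add_sq_le (a b : ℝ) :
    ‖a + b‖ₑ ^ 2 ≤ 2 * ‖a‖ₑ ^ 2 + 2 * ‖b‖ₑ ^ 2 := by
  calc ‖a + b‖ₑ ^ 2 ≤ (‖a‖ₑ + ‖b‖ₑ) ^ 2 := by gcongr; exact enorm_add_le a b
    _ ≤ 2 * (‖a‖ₑ ^ 2 + ‖b‖ₑ ^ 2) := by
      have := ENNReal.rpow_add_le_mul_rpow_add_rpow ‖a‖ₑ ‖b‖ₑ (p := 2) (by norm_num)
      norm_num at this
      exact this
    _ = _ := by ring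

lemma enorm_sub_sq_le (a b : ℝ) :
    ‖a - b‖ₑ ^ 2 ≤ 2 * ‖a‖ₑ ^ 2 + 2 * ‖b‖ₑ ^ 2 := by
  have := enorm_add_sq_le a (-b)
  rwa [enorm_neg, ← sub_eq_add_neg] at this

lemma enorm_sq_eq_ofReal (x : ℝ) : ‖x‖ₑ ^ 2 = ENNReal.ofReal (x ^ 2) := by
  rw [Real.enorm_eq_ofReal_abs, ← ENNReal.ofReal_pow (abs_nonneg _), sq_abs]

lemma toNNReal_mem_Ioc_iff {l r : ℝ≥0} {u : ℝ} :
    u.toNNReal ∈ Set.Ioc l r ↔ u ∈ Set.Ioc (l : ℝ) r := by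
  rw [Set.mem_Ioc, Set.mem_Ioc, Real.lt_toNNReal_iff_coe_lt, Real.toNNReal_le_iff_le_coe]

variable {Ω : Type*} {mΩ : MeasurableSpace Ω} {μ : Measure Ω} {𝓕 : Filtration ℝ≥0 mΩ}

/-- A finite superposition of square integrable elementary processes, living on `(0, T]`. -/
structure ElemProcess (𝓕 : Filtration ℝ≥0 mΩ) (μ : Measure Ω) (T : ℝ≥0) (ι : Type) where
  left : ι → ℝ≥0
  right : ι → ℝ≥0
  coef : ι → Ω → ℝ
  le : ∀ i, left i ≤ right i
  le_T : ∀ i, right i ≤ T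
  measurable : ∀ i, Measurable[𝓕 (left i)] (coef i)
  memLp : ∀ i, MemLp (coef i) 2 μ

namespace ElemProcess

variable {T : ℝ≥0} {ι κ : Type}

lemma measurable_coef (P : ElemProcess 𝓕 μ T ι) (i : ι) : Measurable (P.coef i) :=
  (P.measurable i).mono (𝓕.le _) le_rfl

lemma integrableOn_indicator_mul (P : ElemProcess 𝓕 μ T ι) (i j : ι) (ω : Ω) :
    Integrable ((Set.Ioc (max (P.left i : ℝ) (P.left j))
      (min (P.right i : ℝ) (P.right j))).indicator fun _ => P.coef i ω * P.coef j ω)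
      (volume.restrict (Set.Ioc (0 : ℝ) T)) :=
  (integrable_const _).indicator measurableSet_Ioc

variable [Fintype ι] [Fintype κ]

/-- The value of the process at a given time. -/
def eval (P : ElemProcess 𝓕 μ T ι) (u : ℝ≥0) (ω : Ω) : ℝ :=
  ∑ i, (Set.Ioc (P.left i) (P.right i)).indicator (fun _ => P.coef i ω) u

/-- The elementary stochastic integral. -/
def integral (P : ElemProcess 𝓕 μ T ι) (M : ℝ≥0 → Ω → ℝ) (ω : Ω) : ℝ :=
  ∑ i, P.coef i ω * (M (P.right i) ω - M (P.left i) ω)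

/-- The difference of two processes. -/
def sub (P : ElemProcess 𝓕 μ T ι) (Q : ElemProcess 𝓕 μ T κ) : ElemProcess 𝓕 μ T (ι ⊕ κ) where
  left := Sum.elim P.left Q.left
  right := Sum.elim P.right Q.right
  coef := Sum.elim P.coef fun k ω => -Q.coef k ω
  le := Sum.rec P.le Q.le
  le_T := Sum.rec P.le_T Q.le_T
  measurable := Sum.rec P.measurable fun k => (Q.measurable k).neg
  memLp := Sum.rec P.memLp fun k => (Q.memLp k).neg

lemma eval_sub (P : ElemProcess 𝓕 μ T ι) (Q : ElemProcess 𝓕 μ T κ) (u : ℝ≥0) (ω : Ω) :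
    (P.sub Q).eval u ω = P.eval u ω - Q.eval u ω := by
  simp only [eval, sub, Fintype.sum_sum_type, Sum.elim_inl, Sum.elim_inr, sub_eq_add_neg,
    ← Finset.sum_neg_distrib]
  congr 1
  refine Finset.sum_congr rfl fun i _ => ?_
  by_cases h : u ∈ Set.Ioc (Q.left i) (Q.right i) <;> simp [h, Set.indicator]

lemma integral_sub (P : ElemProcess 𝓕 μ T ι) (Q : ElemProcess 𝓕 μ T κ) (M : ℝ≥0 → Ω → ℝ) (ω : Ω) :
    (P.sub Q).integral M ω = P.integral M ω - Q.integral M ω := by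
  simp only [integral, sub, Fintype.sum_sum_type, Sum.elim_inl, Sum.elim_inr, sub_eq_add_neg,
    ← Finset.sum_neg_distrib]
  congr 1
  exact Finset.sum_congr rfl fun i _ => by ring

lemma measurable_eval (P : ElemProcess 𝓕 μ T ι) : Measurable fun q : ℝ≥0 × Ω => P.eval q.1 q.2 := by
  refine Finset.measurable_fun_sum _ fun i _ => ?_
  have : (fun q : ℝ≥0 × Ω => (Set.Ioc (P.left i) (P.right i)).indicator
      (fun _ => P.coef i q.2) q.1) =
      (Prod.fst ⁻¹' Set.Ioc (P.left i) (P.right i)).indicator fun q => P.coef i q.2 := by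
    ext q; simp [Set.indicator]
  rw [this]
  exact ((P.measurable_coef i).comp measurable_snd).indicator (measurable_fst measurableSet_Ioc)

lemma measurable_integral (P : ElemProcess 𝓕 μ T ι) {d : ℕ} {B : Site d → ℝ}
    {W : ℝ≥0 → Site d → Ω → ℝ} (hW : IsWienerField 𝓕 μ B W) (x : Site d) :
    Measurable (P.integral fun s => W s x) :=
  Finset.measurable_fun_sum _ fun i _ => (P.measurable_coef i).mul (hW.measurable_increment _ _ _)

lemma eval_sq (P : ElemProcess 𝓕 μ T ι) (u : ℝ) (ω : Ω) :
    P.eval u.toNNReal ω ^ 2 = ∑ i, ∑ j,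
      (Set.Ioc (max (P.left i : ℝ) (P.left j)) (min (P.right i : ℝ) (P.right j))).indicator
        (fun _ => P.coef i ω * P.coef j ω) u := by
  rw [eval, sq, Finset.sum_mul_sum]
  refine Finset.sum_congr rfl fun i _ => Finset.sum_congr rfl fun j _ => ?_
  rw [← Set.Ioc_inter_Ioc, Set.inter_indicator_mul (fun _ => P.coef i ω) (fun _ => P.coef j ω)]
  simp only [Set.indicator, toNNReal_mem_Ioc_iff]

lemma integrableOn_eval_sq (P : ElemProcess 𝓕 μ T ι) (ω : Ω) :
    Integrable (fun u : ℝ => P.eval u.toNNReal ω ^ 2) (volume.restrict (Set.Ioc (0 : ℝ) T)) := by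
  simp_rw [eval_sq]
  exact integrable_finsetSum _ fun i _ => integrable_finsetSum _ fun j _ =>
    P.integrableOn_indicator_mul i j ω

lemma integral_eval_sq (P : ElemProcess 𝓕 μ T ι) (ω : Ω) :
    ∫ u in Set.Ioc (0 : ℝ) T, P.eval u.toNNReal ω ^ 2 = ∑ i, ∑ j, P.coef i ω * P.coef j ω *
      max (min (P.right i : ℝ) (P.right j) - max (P.left i : ℝ) (P.left j)) 0 := by
  simp_rw [eval_sq]
  rw [integral_finsetSum _ fun i _ => integrable_finsetSum _ fun j _ =>
    P.integrableOn_indicator_mul i j ω]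
  refine Finset.sum_congr rfl fun i _ => ?_
  rw [integral_finsetSum _ fun j _ => P.integrableOn_indicator_mul i j ω]
  refine Finset.sum_congr rfl fun j _ => ?_
  rw [integral_indicator measurableSet_Ioc, Measure.restrict_restrict measurableSet_Ioc,
    Set.inter_eq_left.2, setIntegral_const, Real.volume_real_Ioc, smul_eq_mul, mul_comm]
  refine Set.Ioc_subset_Ioc ?_ ?_
  · exact (NNReal.coe_nonneg _).trans (le_max_left _ _)
  · exact (min_le_left _ _).trans (by exact_mod_cast P.le_T i)

lemma lintegral_eval_sq (P : ElemProcess 𝓕 μ T ι) (ω : Ω) :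
    ∫⁻ u in Set.Ioc (0 : ℝ) T, ‖P.eval u.toNNReal ω‖ₑ ^ 2 = ENNReal.ofReal
      (∑ i, ∑ j, P.coef i ω * P.coef j ω *
        max (min (P.right i : ℝ) (P.right j) - max (P.left i : ℝ) (P.left j)) 0) := by
  simp_rw [enorm_sq_eq_ofReal]
  rw [← ofReal_integral_eq_lintegral_ofReal (P.integrableOn_eval_sq ω)
    (Eventually.of_forall fun u => sq_nonneg _), integral_eval_sq]

/-- The Itô isometry for elementary processes. -/
lemma lintegral_integral_sq [IsProbabilityMeasure μ] (P : ElemProcess 𝓕 μ T ι) {d : ℕ}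
    {B : Site d → ℝ} {W : ℝ≥0 → Site d → Ω → ℝ} (hW : IsWienerField 𝓕 μ B W) (hB : 0 ≤ B 0)
    (x : Site d) :
    ∫⁻ ω, ‖P.integral (fun s => W s x) ω‖ₑ ^ 2 ∂μ = ENNReal.ofReal (B 0) *
      ∫⁻ ω, ∫⁻ u in Set.Ioc (0 : ℝ) T, ‖P.eval u.toNNReal ω‖ₑ ^ 2 ∂volume ∂μ := by
  simp_rw [P.lintegral_eval_sq, enorm_sq_eq_ofReal]
  have hc : ∀ i j, Integrable (fun ω => P.coef i ω * P.coef j ω) μ := fun i j =>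
    (P.memLp i).integrable_mul (P.memLp j)
  have hp : ∀ i j, Integrable (fun ω => (P.coef i ω * (W (P.right i) x ω - W (P.left i) x ω)) *
      (P.coef j ω * (W (P.right j) x ω - W (P.left j) x ω))) μ := fun i j =>
    (hW.memLp_mul_increment (P.le i) (P.measurable i) (P.memLp i) x).integrable_mul
      (hW.memLp_mul_increment (P.le j) (P.measurable j) (P.memLp j) x)
  have hsq : ∀ ω, P.integral (fun s => W s x) ω ^ 2 = ∑ i, ∑ j,
      (P.coef i ω * (W (P.right i) x ω - W (P.left i) x ω)) *
      (P.coef j ω * (W (P.right j) x ω - W (P.left j) x ω)) := fun ω => by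
    rw [integral, sq, Finset.sum_mul_sum]
  simp_rw [hsq]
  rw [← ofReal_integral_eq_lintegral_ofReal, ← ofReal_integral_eq_lintegral_ofReal,
    ← ENNReal.ofReal_mul hB]
  · congr 1
    rw [integral_finsetSum _ fun i _ => integrable_finsetSum _ fun j _ => hp i j,
      integral_finsetSum _ fun i _ => integrable_finsetSum _ fun j _ => (hc i j).mul_const _,
      Finset.mul_sum]
    refine Finset.sum_congr rfl fun i _ => ?_
    rw [integral_finsetSum _ fun j _ => hp i j,
      integral_finsetSum _ fun j _ => (hc i j).mul_const _, Finset.mul_sum]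
    refine Finset.sum_congr rfl fun j _ => ?_
    rw [hW.integral_piece_mul_piece x (P.le i) (P.le j) (P.measurable i) (P.memLp i)
      (P.measurable j) (P.memLp j), integral_mul_const]
    ring
  · exact integrable_finsetSum _ fun i _ => integrable_finsetSum _ fun j _ => (hc i j).mul_const _
  · exact Eventually.of_forall fun ω => by
      simp only [Pi.zero_apply]; rw [← integral_eval_sq]; exact integral_nonneg fun u => sq_nonneg _
  · exact integrable_finsetSum _ fun i _ => integrable_finsetSum _ fun j _ => hp i j
  · exact Eventually.of_forall fun ω => by
      simp only [Pi.zero_apply]; rw [← hsq]; exact sq_nonneg _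

end ElemProcess

namespace SimpleProcess

/-- A simple process stopped at time `s`, as an elementary process on `(0, t]`. -/
def stopped [IsFiniteMeasure μ] (φ : SimpleProcess 𝓕) {s t : ℝ≥0} (hst : s ≤ t) :
    ElemProcess 𝓕 μ t (Fin φ.n) where
  left k := min (φ.time k) s
  right k := min (φ.time (k + 1)) s
  coef k := if φ.time k ≤ s then φ.coef k else 0
  le k := min_le_min_right _ (φ.mono (Nat.le_succ _))
  le_T k := (min_le_right _ _).trans hst
  measurable k := by
    split_ifs with h
    · rw [min_eq_left h]; exact φ.measurable k
    · exact measurable_const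
  memLp k := by
    split_ifs with h
    · obtain ⟨C, hC⟩ := φ.bounded k
      exact MemLp.of_bound ((φ.measurable k).mono (𝓕.le _) le_rfl).aestronglyMeasurable C
        (Eventually.of_forall hC)
    · exact MemLp.zero

variable [IsFiniteMeasure μ]

lemma integral_stopped (φ : SimpleProcess 𝓕) {s t : ℝ≥0} (hst : s ≤ t) (M : ℝ≥0 → Ω → ℝ) (ω : Ω) :
    (φ.stopped (μ := μ) hst).integral M ω = φ.integral M s ω := by
  rw [ElemProcess.integral, SimpleProcess.integral, ← Fin.sum_univ_eq_sum_range
    (fun k => φ.coef k ω * (M (min (φ.time (k + 1)) s) ω - M (min (φ.time k) s) ω)) φ.n]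
  refine Finset.sum_congr rfl fun k _ => ?_
  simp only [stopped]
  split_ifs with h
  · rfl
  · have h' := (not_le.1 h).le
    rw [min_eq_right h', min_eq_right (h'.trans (φ.mono (Nat.le_succ _))), sub_self, mul_zero,
      mul_zero]

lemma eval_stopped_of_le (φ : SimpleProcess 𝓕) {s t : ℝ≥0} (hst : s ≤ t) {u : ℝ≥0} (hu : u ≤ s)
    (ω : Ω) : (φ.stopped (μ := μ) hst).eval u ω = φ.eval u ω := by
  rw [ElemProcess.eval, SimpleProcess.eval, ← Fin.sum_univ_eq_sum_range
    (fun k => (Set.Ioc (φ.time k) (φ.time (k + 1))).indicator (fun _ => φ.coef k ω) u) φ.n]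
  refine Finset.sum_congr rfl fun k _ => ?_
  simp only [stopped, Set.indicator, Set.mem_Ioc, min_lt_iff, le_min_iff, hu, and_true,
    not_lt_of_ge hu, or_false]
  by_cases h : φ.time k < u
  · simp [h.le.trans hu]
  · simp [h]

end SimpleProcess

section ItoBounds

variable [IsProbabilityMeasure μ] {d : ℕ} {B : Site d → ℝ} {W : ℝ≥0 → Site d → Ω → ℝ}

/-- The squared distance of an Itô integral to an elementary stochastic integral is controlled by
the distance of the integrands. -/
lemma IsItoIntegral.lintegral_sub_le (hW : IsWienerField 𝓕 μ B W) (hB : 0 ≤ B 0) (x : Site d)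
    {X : ℝ≥0 → Ω → ℝ} (hX : Measurable fun q : ℝ≥0 × Ω => X q.1 q.2) {t : ℝ≥0} {I : Ω → ℝ}
    (h : IsItoIntegral 𝓕 μ (fun s => W s x) X t I) {ι : Type} [Fintype ι]
    (P : ElemProcess 𝓕 μ t ι) :
    ∫⁻ ω, ‖I ω - P.integral (fun s => W s x) ω‖ₑ ^ 2 ∂μ ≤ 4 * ENNReal.ofReal (B 0) *
      ∫⁻ ω, ∫⁻ u in Set.Ioc (0 : ℝ) t, ‖X u.toNNReal ω - P.eval u.toNNReal ω‖ₑ ^ 2 ∂volume ∂μ := by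
  obtain ⟨φ, hφ1, hφ2⟩ := h
  set v := ENNReal.ofReal (B 0) with hv
  set Q := ∫⁻ ω, ∫⁻ u in Set.Ioc (0 : ℝ) t, ‖X u.toNNReal ω - P.eval u.toNNReal ω‖ₑ ^ 2 ∂volume ∂μ
  set a : ℕ → ℝ≥0∞ := fun n => ∫⁻ ω, ‖I ω - (φ n).integral (fun s => W s x) t ω‖ₑ ^ 2 ∂μ with ha
  set b : ℕ → ℝ≥0∞ := fun n => ∫⁻ ω, ∫⁻ s in Set.Ioc (0 : ℝ) t,
      ‖X s.toNNReal ω - (φ n).eval s.toNNReal ω‖ₑ ^ 2 ∂volume ∂μ with hb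
  have hlim : Tendsto (fun n => 2 * a n + 2 * (v * (2 * b n + 2 * Q))) atTop
      (𝓝 (2 * 0 + 2 * (v * (2 * 0 + 2 * Q)))) := by
    refine Tendsto.add (ENNReal.Tendsto.const_mul hφ2 (by simp)) ?_
    refine ENNReal.Tendsto.const_mul (ENNReal.Tendsto.const_mul ?_ (by simp [hv])) (by simp)
    exact (ENNReal.Tendsto.const_mul hφ1 (by simp)).add_const _
  have hval : 2 * 0 + 2 * (v * (2 * 0 + 2 * Q)) = 4 * v * Q := by ring
  rw [hval] at hlim
  refine ge_of_tendsto' hlim fun n => ?_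
  set R := ((φ n).stopped (μ := μ) le_rfl : ElemProcess 𝓕 μ t (Fin (φ n).n)) with hR
  have h1 : ∀ ω, ‖I ω - P.integral (fun s => W s x) ω‖ₑ ^ 2 ≤
      2 * ‖I ω - (φ n).integral (fun s => W s x) t ω‖ₑ ^ 2 +
        2 * ‖(R.sub P).integral (fun s => W s x) ω‖ₑ ^ 2 := fun ω => by
    rw [ElemProcess.integral_sub, hR, SimpleProcess.integral_stopped]
    refine le_trans (le_of_eq ?_) (enorm_add_sq_le _ _)
    rw [sub_add_sub_cancel]
  have hm : Measurable fun ω => 2 * ‖(R.sub P).integral (fun s => W s x) ω‖ₑ ^ 2 :=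
    (((R.sub P).measurable_integral hW x).enorm.pow_const 2).const_mul _
  calc _ ≤ _ := lintegral_mono h1
    _ = 2 * a n + 2 * (v * ∫⁻ ω, ∫⁻ u in Set.Ioc (0 : ℝ) t,
          ‖(R.sub P).eval u.toNNReal ω‖ₑ ^ 2 ∂volume ∂μ) := by
        rw [lintegral_add_right _ hm, lintegral_const_mul' _ _ (by simp),
          lintegral_const_mul' _ _ (by simp), (R.sub P).lintegral_integral_sq hW hB x]
    _ ≤ _ := by
        gcongr
        have hmX : Measurable fun q : ℝ × Ω => X q.1.toNNReal q.2 :=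
          hX.comp ((measurable_real_toNNReal.comp measurable_fst).prodMk measurable_snd)
        have hmP : Measurable fun q : ℝ × Ω => P.eval q.1.toNNReal q.2 :=
          P.measurable_eval.comp ((measurable_real_toNNReal.comp measurable_fst).prodMk measurable_snd)
        have hm1 : Measurable fun q : ℝ × Ω =>
            2 * ‖X q.1.toNNReal q.2 - P.eval q.1.toNNReal q.2‖ₑ ^ 2 :=
          ((hmX.sub hmP).enorm.pow_const 2).const_mul _
        have h2 : ∀ ω, ∫⁻ u in Set.Ioc (0 : ℝ) t, ‖(R.sub P).eval u.toNNReal ω‖ₑ ^ 2 ≤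
            2 * (∫⁻ u in Set.Ioc (0 : ℝ) t, ‖X u.toNNReal ω - (φ n).eval u.toNNReal ω‖ₑ ^ 2) +
            ∫⁻ u in Set.Ioc (0 : ℝ) t, 2 * ‖X u.toNNReal ω - P.eval u.toNNReal ω‖ₑ ^ 2 := by
          intro ω
          have hmω : Measurable fun u : ℝ => 2 * ‖X u.toNNReal ω - P.eval u.toNNReal ω‖ₑ ^ 2 :=
            Measurable.of_uncurry_right (f := fun (u : ℝ) (ω : Ω) =>
              2 * ‖X u.toNNReal ω - P.eval u.toNNReal ω‖ₑ ^ 2) hm1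
          rw [← lintegral_const_mul' _ _ (by simp), ← lintegral_add_right _ hmω]
          refine setLIntegral_mono' measurableSet_Ioc fun u hu => ?_
          rw [ElemProcess.eval_sub, hR, SimpleProcess.eval_stopped_of_le _ _
            (Real.toNNReal_le_iff_le_coe.2 hu.2)]
          refine le_trans (le_of_eq ?_) ((enorm_sub_sq_le (X u.toNNReal ω - P.eval u.toNNReal ω)
            (X u.toNNReal ω - (φ n).eval u.toNNReal ω)).trans (le_of_eq (add_comm _ _)))
          rw [sub_sub_sub_cancel_left]
        refine (lintegral_mono h2).trans (le_of_eq ?_)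
        have hm2 : Measurable fun ω => ∫⁻ u in Set.Ioc (0 : ℝ) t,
            2 * ‖X u.toNNReal ω - P.eval u.toNNReal ω‖ₑ ^ 2 := hm1.lintegral_prod_left'
        rw [lintegral_add_right _ hm2, lintegral_const_mul' _ _ (by simp)]
        simp_rw [lintegral_const_mul' (2 : ℝ≥0∞) _ (by simp)]
        rfl

end ItoBounds

end

section

variable {Ω : Type*} {mΩ : MeasurableSpace Ω} {μ : Measure Ω} {𝓕 : Filtration ℝ≥0 mΩ}

/-- A random variable with finite absolute moments of all orders. -/
def HasMoments (f : Ω → ℝ) (μ : Measure Ω) : Prop := ∀ q : ℝ≥0∞, q ≠ ⊤ → MemLp f q μ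

namespace HasMoments

variable {f g : Ω → ℝ}

lemma const [IsFiniteMeasure μ] (c : ℝ) : HasMoments (fun _ : Ω => c) μ :=
  fun _ _ => memLp_const c

lemma add (hf : HasMoments f μ) (hg : HasMoments g μ) : HasMoments (fun ω => f ω + g ω) μ :=
  fun q hq => (hf q hq).add (hg q hq)

lemma mul (hf : HasMoments f μ) (hg : HasMoments g μ) : HasMoments (fun ω => f ω * g ω) μ := by
  intro q hq
  have h2 : 2 * q ≠ ⊤ := ENNReal.mul_ne_top (by simp) hq
  have : ENNReal.HolderTriple (2 * q) (2 * q) q := ⟨by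
    rw [ENNReal.mul_inv (by simp) (by simp), ← add_mul, ENNReal.inv_two_add_inv_two, one_mul]⟩
  exact MemLp.mul' (p := 2 * q) (q := 2 * q) (hg _ h2) (hf _ h2)

lemma const_mul (c : ℝ) (hf : HasMoments f μ) : HasMoments (fun ω => c * f ω) μ :=
  fun q hq => (hf q hq).const_mul c

lemma sum {ι : Type*} (s : Finset ι) {f : ι → Ω → ℝ} (hf : ∀ i, HasMoments (f i) μ) :
    HasMoments (fun ω => ∑ i ∈ s, f i ω) μ :=
  fun q hq => memLp_finsetSum _ fun i _ => hf i q hq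

lemma prod [IsFiniteMeasure μ] {ι : Type*} (s : Finset ι) {f : ι → Ω → ℝ}
    (hf : ∀ i, HasMoments (f i) μ) : HasMoments (fun ω => ∏ i ∈ s, f i ω) μ := by
  classical
  induction s using Finset.induction_on with
  | empty => simpa using const (μ := μ) 1
  | insert i s hi ih =>
    simp_rw [Finset.prod_insert hi]
    exact (hf i).mul ih

lemma pow [IsFiniteMeasure μ] (hf : HasMoments f μ) (n : ℕ) : HasMoments (fun ω => f ω ^ n) μ := by
  simpa using prod (Finset.range n) fun _ => hf

lemma abs (hf : HasMoments f μ) : HasMoments (fun ω => |f ω|) μ := fun q hq => (hf q hq).norm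

lemma integrable (hf : HasMoments f μ) : Integrable f μ :=
  memLp_one_iff_integrable.1 (hf 1 ENNReal.one_ne_top)

end HasMoments

lemma abs_prod_one_add_sub_le {ι : Type*} (s : Finset ι) (y : ι → ℝ) :
    |∏ i ∈ s, (1 + y i) - 1 - ∑ i ∈ s, y i - ((∑ i ∈ s, y i) ^ 2 - ∑ i ∈ s, y i ^ 2) / 2| ≤
      (∑ i ∈ s, |y i|) ^ 3 * (1 + ∑ i ∈ s, |y i|) ^ s.card := by
  classical
  induction s using Finset.induction_on with
  | empty => simp
  | insert j s hj ih =>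
    simp only [Finset.prod_insert hj, Finset.sum_insert hj, Finset.card_insert_of_notMem hj]
    set P := ∏ i ∈ s, (1 + y i)
    set e := ∑ i ∈ s, y i with he
    set q := ∑ i ∈ s, y i ^ 2 with hq
    set Y := ∑ i ∈ s, |y i| with hY
    have hY0 : 0 ≤ Y := Finset.sum_nonneg fun _ _ => abs_nonneg _
    have hz := abs_nonneg (y j)
    have heY : |e| ≤ Y := Finset.abs_sum_le_sum_abs _ _
    have hqY : q ≤ Y ^ 2 := by
      refine le_trans (le_of_eq (Finset.sum_congr rfl fun i _ => (sq_abs (y i)).symm)) ?_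
      exact Finset.sum_sq_le_sq_sum_of_nonneg fun _ _ => abs_nonneg _
    have hq0 : 0 ≤ q := Finset.sum_nonneg fun _ _ => sq_nonneg _
    have he2 : e ^ 2 ≤ Y ^ 2 := by rw [← sq_abs e]; gcongr
    have h2 : |(e ^ 2 - q) / 2| ≤ Y ^ 2 := by
      rw [abs_le]; constructor <;> nlinarith [sq_nonneg e, sq_nonneg Y]
    set R := P - 1 - e - (e ^ 2 - q) / 2 with hR
    calc _ = |R * (1 + y j) + y j * ((e ^ 2 - q) / 2)| := by congr 1; rw [hR]; ring
      _ ≤ |R| * (1 + |y j|) + |y j| * Y ^ 2 := by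
          refine (abs_add_le _ _).trans ?_
          rw [abs_mul, abs_mul]
          gcongr
          exact (abs_add_le _ _).trans (by rw [abs_one])
      _ ≤ (Y ^ 3 * (1 + Y) ^ s.card) * (1 + |y j|) + |y j| * Y ^ 2 := by gcongr
      _ ≤ (Y ^ 3 * (1 + (|y j| + Y)) ^ s.card) * (1 + (|y j| + Y)) +
            |y j| * Y ^ 2 * (1 + (|y j| + Y)) ^ (s.card + 1) := by
          refine add_le_add ?_ ?_
          · gcongr <;> linarith
          · exact le_mul_of_one_le_right (by positivity) (one_le_pow₀ (by linarith))
      _ = (Y ^ 3 + |y j| * Y ^ 2) * (1 + (|y j| + Y)) ^ (s.card + 1) := by ring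
      _ ≤ _ := by
          gcongr
          nlinarith [pow_nonneg hz 3, mul_nonneg hz (sq_nonneg Y), mul_nonneg hY0 (sq_nonneg (y j)),
            mul_nonneg hY0 (pow_nonneg hz 2), mul_nonneg hz hY0]

lemma sq_sum_sub_sum_sq {ι : Type*} [Fintype ι] [DecidableEq ι] (y : ι → ℝ) :
    (∑ i, y i) ^ 2 - ∑ i, y i ^ 2 = ∑ i, ∑ j ∈ Finset.univ.erase i, y i * y j := by
  rw [sq, Finset.sum_mul_sum, ← Finset.sum_sub_distrib]
  refine Finset.sum_congr rfl fun i _ => ?_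
  rw [← Finset.add_sum_erase _ _ (Finset.mem_univ i)]
  ring

/-- The `q`-th absolute moment of the centred Gaussian law with variance `v`. -/
def gaussMoment (v : ℝ) (q : ℕ) : ℝ := ∫ y, |y| ^ q ∂(gaussianReal 0 v.toNNReal)

lemma gaussMoment_nonneg (v : ℝ) (q : ℕ) : 0 ≤ gaussMoment v q :=
  integral_nonneg fun _ => by positivity

/-- The constant in the second order expansion of a product of Gaussian factors. -/
def factorConst (v : ℝ) (p : ℕ) : ℝ :=
  2 ^ p * ((p : ℝ) ^ 3 * gaussMoment v 3 + (p : ℝ) ^ (p + 3) * gaussMoment v (p + 3))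

lemma factorConst_nonneg (v : ℝ) (p : ℕ) : 0 ≤ factorConst v p := by
  have := gaussMoment_nonneg v
  unfold factorConst
  have h1 := this 3
  have h2 := this (p + 3)
  positivity

namespace IsWienerField

variable {d : ℕ} {B : Site d → ℝ} {W : ℝ≥0 → Site d → Ω → ℝ}

lemma hasMoments_increment (hW : IsWienerField 𝓕 μ B W) (s t : ℝ≥0) (x : Site d) :
    HasMoments (fun ω => W t x ω - W s x ω) μ :=
  fun _ hq => hW.memLp_increment s t x hq

variable [IsProbabilityMeasure μ]

lemma integral_sum_abs_increment_pow_le (hW : IsWienerField 𝓕 μ B W) {s t : ℝ≥0} (hst : s ≤ t)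
    {p : ℕ} (x : Fin p → Site d) (q : ℕ) :
    ∫ ω, (∑ i, |W t (x i) ω - W s (x i) ω|) ^ (q + 1) ∂μ ≤
      (p : ℝ) ^ (q + 1) * √(t - s : ℝ) ^ (q + 1) * gaussMoment (B 0) (q + 1) := by
  have hm : ∀ i, HasMoments (fun ω => |W t (x i) ω - W s (x i) ω|) μ := fun i =>
    (hW.hasMoments_increment s t (x i)).abs
  calc _ ≤ ∫ ω, (p : ℝ) ^ q * ∑ i, |W t (x i) ω - W s (x i) ω| ^ (q + 1) ∂μ := by
        refine integral_mono ((HasMoments.sum _ hm).pow _).integrable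
          ((HasMoments.sum _ fun i => (hm i).pow _).const_mul _).integrable fun ω => ?_
        refine (pow_sum_le_card_mul_sum_pow (fun i _ => abs_nonneg _) q).trans ?_
        simp
    _ = _ := by
        rw [integral_const_mul, integral_finsetSum _ fun i _ => ((hm i).pow _).integrable]
        simp_rw [hW.integral_abs_increment_pow hst]
        simp only [Finset.sum_const, Finset.card_univ, Fintype.card_fin, nsmul_eq_mul, gaussMoment]
        ring

lemma abs_integral_prod_one_add_sub_le (hW : IsWienerField 𝓕 μ B W) {s t : ℝ≥0} (hst : s ≤ t)
    (h1 : (t - s : ℝ) ≤ 1) {p : ℕ} (x : Fin p → Site d) :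
    |∫ ω, ∏ i, (1 + (W t (x i) ω - W s (x i) ω)) ∂μ - 1 - (t - s : ℝ) * pairPotential B x| ≤
      factorConst (B 0) p * √(t - s : ℝ) ^ 3 := by
  classical
  set y : Fin p → Ω → ℝ := fun i ω => W t (x i) ω - W s (x i) ω with hy
  set r := √(t - s : ℝ) with hr
  have hr0 : 0 ≤ r := Real.sqrt_nonneg _
  have hr1 : r ≤ 1 := by rw [hr]; exact Real.sqrt_le_one.2 h1
  have hm : ∀ i, HasMoments (y i) μ := fun i => hW.hasMoments_increment s t (x i)
  have hY : HasMoments (fun ω => ∑ i, |y i ω|) μ := HasMoments.sum _ fun i => (hm i).abs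
  have hP : Integrable (fun ω => ∏ i, (1 + y i ω)) μ :=
    (HasMoments.prod _ fun i => (HasMoments.const 1).add (hm i)).integrable
  have he : Integrable (fun ω => ∑ i, y i ω) μ := (HasMoments.sum _ hm).integrable
  have hij : ∀ i j, Integrable (fun ω => y i ω * y j ω) μ := fun i j =>
    ((hm i).mul (hm j)).integrable
  have hq : Integrable (fun ω => ∑ i, ∑ j ∈ Finset.univ.erase i, y i ω * y j ω) μ :=
    integrable_finsetSum _ fun i _ => integrable_finsetSum _ fun j _ => hij i j
  have h2 : Integrable (fun ω => ∏ i, (1 + y i ω) - 1) μ := hP.sub (integrable_const 1)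
  have h3 : Integrable (fun ω => ∏ i, (1 + y i ω) - 1 - ∑ i, y i ω) μ := h2.sub he
  have hval : ∫ ω, (∏ i, (1 + y i ω) - 1 - ∑ i, y i ω -
      (∑ i, ∑ j ∈ Finset.univ.erase i, y i ω * y j ω) / 2) ∂μ =
      ∫ ω, ∏ i, (1 + y i ω) ∂μ - 1 - (t - s : ℝ) * pairPotential B x := by
    rw [integral_sub h3 (hq.div_const 2), integral_sub h2 he, integral_sub hP (integrable_const 1),
      integral_div, integral_finsetSum _ fun i _ => (hm i).integrable,
      integral_finsetSum _ fun i _ => integrable_finsetSum _ fun j _ => hij i j]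
    simp_rw [integral_finsetSum _ fun j _ => hij _ j]
    simp only [hy, hW.integral_increment, hW.integral_increment_mul hst, Finset.sum_const_zero,
      ← Finset.mul_sum, integral_const, probReal_univ, smul_eq_mul, mul_one, sub_zero, pairPotential]
    ring
  rw [← hval]
  refine (abs_integral_le_integral_abs).trans ?_
  have hb : ∀ ω, |∏ i, (1 + y i ω) - 1 - ∑ i, y i ω -
      (∑ i, ∑ j ∈ Finset.univ.erase i, y i ω * y j ω) / 2| ≤
      2 ^ p * ((∑ i, |y i ω|) ^ 3 + (∑ i, |y i ω|) ^ (p + 3)) := fun ω => by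
    rw [← sq_sum_sub_sum_sq]
    refine (abs_prod_one_add_sub_le Finset.univ fun i => y i ω).trans ?_
    rw [Finset.card_univ, Fintype.card_fin]
    set Y := ∑ i, |y i ω|
    have hY0 : 0 ≤ Y := Finset.sum_nonneg fun _ _ => abs_nonneg _
    calc Y ^ 3 * (1 + Y) ^ p ≤ Y ^ 3 * (2 ^ (p - 1) * (1 ^ p + Y ^ p)) := by
          gcongr; exact add_pow_le zero_le_one hY0 p
      _ ≤ Y ^ 3 * (2 ^ p * (1 ^ p + Y ^ p)) := by
          gcongr
          · norm_num
          · omega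
      _ = _ := by rw [one_pow]; ring
  calc _ ≤ ∫ ω, 2 ^ p * ((∑ i, |y i ω|) ^ 3 + (∑ i, |y i ω|) ^ (p + 3)) ∂μ := by
        refine integral_mono ?_ ((hY.pow 3).add (hY.pow (p + 3))|>.const_mul _).integrable hb
        exact (h3.sub (hq.div_const 2)).abs
    _ ≤ 2 ^ p * ((p : ℝ) ^ 3 * r ^ 3 * gaussMoment (B 0) 3 +
          (p : ℝ) ^ (p + 3) * r ^ (p + 3) * gaussMoment (B 0) (p + 3)) := by
        rw [integral_const_mul, integral_add (hY.pow 3).integrable (hY.pow (p + 3)).integrable]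
        gcongr
        · exact hW.integral_sum_abs_increment_pow_le hst x 2
        · exact hW.integral_sum_abs_increment_pow_le hst x (p + 2)
    _ ≤ 2 ^ p * ((p : ℝ) ^ 3 * r ^ 3 * gaussMoment (B 0) 3 +
          (p : ℝ) ^ (p + 3) * r ^ 3 * gaussMoment (B 0) (p + 3)) := by
        have := gaussMoment_nonneg (B 0) (p + 3)
        have h5 : r ^ (p + 3) ≤ r ^ 3 := pow_le_pow_of_le_one hr0 hr1 (by omega)
        gcongr 2 ^ p * (_ + _ * ?_ * _)
    _ = _ := by rw [factorConst]; ring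

end IsWienerField

section Mixing

variable {d p : ℕ} {a : Site d → ℝ}

lemma abs_sum_mul_le (ha : IsJumpLaw a) (F : Finset (Site d)) {f : Site d → ℝ} {K : ℝ}
    (hK : 0 ≤ K) (hf : ∀ z, |f z| ≤ K) : |∑ z ∈ F, a z * f z| ≤ K := by
  calc _ ≤ ∑ z ∈ F, |a z * f z| := Finset.abs_sum_le_sum_abs _ _
    _ ≤ ∑ z ∈ F, a z * K := Finset.sum_le_sum fun z _ => by
        rw [abs_mul, abs_of_nonneg (ha.nonneg z)]
        exact mul_le_mul_of_nonneg_left (hf z) (ha.nonneg z)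
    _ ≤ 1 * K := by
        rw [← Finset.sum_mul]
        gcongr
        exact sum_le_hasSum F (fun z _ => ha.nonneg z) ha.hasSum_one
    _ = K := one_mul K

lemma IsJumpLaw.summable_mul (ha : IsJumpLaw a) {f : Site d → ℝ} {K : ℝ}
    (hf : ∀ z, |f z| ≤ K) : Summable fun z => a z * f z := by
  refine Summable.of_norm_bounded (ha.hasSum_one.summable.mul_right K) fun z => ?_
  rw [Real.norm_eq_abs, abs_mul, abs_of_nonneg (ha.nonneg z)]
  exact mul_le_mul_of_nonneg_left (hf z) (ha.nonneg z)

lemma abs_sum_sub_tsum_mul_le (ha : IsJumpLaw a) (F : Finset (Site d)) {f : Site d → ℝ} {K : ℝ}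
    (hf : ∀ z, |f z| ≤ K) :
    |∑ z ∈ F, a z * f z - ∑' z, a z * f z| ≤ (1 - ∑ z ∈ F, a z) * K := by
  have h1 := ha.summable_mul hf
  have h2 := ha.hasSum_one.summable.mul_right K
  rw [← h1.sum_add_tsum_subtype_compl F, sub_add_cancel_left, abs_neg]
  have h3 : ∑ z ∈ F, a z * K + ∑' z : {z // z ∉ F}, a z * K = K := by
    rw [h2.sum_add_tsum_subtype_compl F, tsum_mul_right, ha.hasSum_one.tsum_eq, one_mul]
  have h4 : (1 - ∑ z ∈ F, a z) * K = ∑' z : {z // z ∉ F}, a z * K := by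
    rw [← Finset.sum_mul] at h3
    linarith
  rw [h4, ← Real.norm_eq_abs]
  refine tsum_of_norm_bounded (h2.subtype _).hasSum fun z => ?_
  rw [Real.norm_eq_abs, abs_mul, abs_of_nonneg (ha.nonneg z)]
  exact mul_le_mul_of_nonneg_left (hf z) (ha.nonneg z)

/-- Averaging the coordinates one after the other agrees to first order with the sum of the
Laplacians in the coordinates. -/
lemma abs_mixing_sub_le (ha : IsJumpLaw a) (F : Finset (Site d)) {c K : ℝ} (hc : 0 ≤ c)
    (hc1 : c ≤ 1) (hK : 0 ≤ K) {g : Finset (Fin p) → (Fin p → Site d) → ℝ}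
    (hg : ∀ I, ∀ j ∉ I, ∀ x : Fin p → Site d, g (insert j I) x = (1 - c) * g I x +
      c * ∑ z ∈ F, a z * g I (x + Pi.single j z))
    (h0 : ∀ x, |g ∅ x| ≤ K) (I : Finset (Fin p)) :
    (∀ x, |g I x| ≤ K) ∧ (∀ x, |g I x - g ∅ x| ≤ I.card * (2 * c * K)) ∧
    ∀ x : Fin p → Site d, |g I x - g ∅ x - c * ∑ j ∈ I, (∑' z, a z * g ∅ (x + Pi.single j z) - g ∅ x)| ≤
      I.card * (c * (4 * c * p + (1 - ∑ z ∈ F, a z)) * K) := by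
  induction I using Finset.induction_on with
  | empty => simp [h0]
  | insert j I hj ih =>
    obtain ⟨ih1, ih2, ih3⟩ := ih
    have hA : ∀ x : Fin p → Site d, |∑ z ∈ F, a z * g I (x + Pi.single j z)| ≤ K := fun x =>
      abs_sum_mul_le ha F hK fun z => ih1 _
    have hcard : (I.card : ℝ) ≤ p := by
      exact_mod_cast (Finset.card_le_univ I).trans (by simp)
    rw [Finset.card_insert_of_notMem hj]
    push_cast
    refine ⟨fun x => ?_, fun x => ?_, fun x => ?_⟩
    · rw [hg I j hj]
      calc _ ≤ |(1 - c) * g I x| + |c * ∑ z ∈ F, a z * g I (x + Pi.single j z)| := abs_add_le _ _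
        _ = (1 - c) * |g I x| + c * |∑ z ∈ F, a z * g I (x + Pi.single j z)| := by
            rw [abs_mul, abs_mul, abs_of_nonneg hc, abs_of_nonneg (sub_nonneg.2 hc1)]
        _ ≤ (1 - c) * K + c * K := add_le_add
            (mul_le_mul_of_nonneg_left (ih1 x) (sub_nonneg.2 hc1))
            (mul_le_mul_of_nonneg_left (hA x) hc)
        _ = K := by ring
    · rw [hg I j hj]
      calc _ = |(g I x - g ∅ x) + c * (∑ z ∈ F, a z * g I (x + Pi.single j z) - g I x)| := by
            congr 1; ring
        _ ≤ |g I x - g ∅ x| + c * (|∑ z ∈ F, a z * g I (x + Pi.single j z)| + |g I x|) := by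
            refine (abs_add_le _ _).trans ?_
            rw [abs_mul, abs_of_nonneg hc]
            gcongr
            exact abs_sub _ _
        _ ≤ I.card * (2 * c * K) + c * (K + K) := by
            gcongr
            · exact ih2 x
            · exact hA x
            · exact ih1 x
        _ = _ := by ring
    · rw [Finset.sum_insert hj, hg I j hj]
      have e1 : |∑ z ∈ F, a z * g I (x + Pi.single j z) -
          ∑ z ∈ F, a z * g ∅ (x + Pi.single j z)| ≤ I.card * (2 * c * K) := by
        rw [← Finset.sum_sub_distrib]
        simp_rw [← mul_sub]
        exact abs_sum_mul_le ha F (by positivity) fun z => ih2 _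
      have e2 := abs_sum_sub_tsum_mul_le ha F (f := fun z => g ∅ (x + Pi.single j z)) fun z => h0 _
      have e3 := ih2 x
      have e4 := ih3 x
      set A := ∑ z ∈ F, a z * g I (x + Pi.single j z)
      set A0 := ∑ z ∈ F, a z * g ∅ (x + Pi.single j z)
      set T := ∑' z, a z * g ∅ (x + Pi.single j z)
      set S := ∑ j ∈ I, (∑' z, a z * g ∅ (x + Pi.single j z) - g ∅ x)
      calc _ = |(g I x - g ∅ x - c * S) + c * ((A - A0) + (A0 - T) - (g I x - g ∅ x))| := by
            congr 1; ring
        _ ≤ |g I x - g ∅ x - c * S| + c * ((|A - A0| + |A0 - T|) + |g I x - g ∅ x|) := by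
            refine (abs_add_le _ _).trans ?_
            rw [abs_mul, abs_of_nonneg hc]
            gcongr
            exact (abs_sub _ _).trans (by gcongr; exact abs_add_le _ _)
        _ ≤ I.card * (c * (4 * c * p + (1 - ∑ z ∈ F, a z)) * K) +
              c * ((p * (2 * c * K) + (1 - ∑ z ∈ F, a z) * K) + p * (2 * c * K)) := by
            gcongr
            · exact e1.trans (by gcongr)
            · exact e3.trans (by gcongr)
        _ = _ := by ring

end Mixing

end

section

variable {Ω : Type*} {mΩ : MeasurableSpace Ω} {μ : Measure Ω} {𝓕 : Filtration ℝ≥0 mΩ} {d : ℕ}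

/-- The lazy average of a field with respect to the jump law truncated to `F`. -/
def average (a : Site d → ℝ) (c : ℝ) (F : Finset (Site d)) (f : Site d → Ω → ℝ) (x : Site d)
    (ω : Ω) : ℝ :=
  (1 - c) * f x ω + c * ∑ z ∈ F, a z * f (x + z) ω

section Average

variable {a : Site d → ℝ} {c : ℝ} {F : Finset (Site d)} {f : Site d → Ω → ℝ}

lemma measurable_average {m : MeasurableSpace Ω} (hf : ∀ x, Measurable[m] (f x)) (x : Site d) :
    Measurable[m] (average a c F f x) :=
  ((hf x).const_mul _).add ((Finset.measurable_fun_sum _ fun z _ =>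
    (hf (x + z)).const_mul _).const_mul _)

lemma hasMoments_average (hf : ∀ x, HasMoments (f x) μ) (x : Site d) :
    HasMoments (average a c F f x) μ :=
  ((hf x).const_mul _).add ((HasMoments.sum _ fun z => (hf (x + z)).const_mul _).const_mul _)

/-- Mixed moments in which the coordinates in `I` are averaged. -/
def partialMoment (μ : Measure Ω) (a : Site d → ℝ) (c : ℝ) (F : Finset (Site d))
    (f : Site d → Ω → ℝ) {p : ℕ} (I : Finset (Fin p)) (x : Fin p → Site d) : ℝ :=
  ∫ ω, ∏ i, (if i ∈ I then average a c F f (x i) ω else f (x i) ω) ∂μ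

lemma prod_ite_insert {p : ℕ} {I : Finset (Fin p)} {j : Fin p} (hj : j ∉ I) (x : Fin p → Site d)
    (ω : Ω) :
    ∏ i, (if i ∈ insert j I then average a c F f (x i) ω else f (x i) ω) =
      (1 - c) * ∏ i, (if i ∈ I then average a c F f (x i) ω else f (x i) ω) +
      c * ∑ z ∈ F, a z * ∏ i, (if i ∈ I then average a c F f ((x + Pi.single j z : Fin p → Site d) i) ω else
        f ((x + Pi.single j z : Fin p → Site d) i) ω) := by
  have e3 : ∀ z, ∏ i, (if i ∈ I then average a c F f ((x + Pi.single j z : Fin p → Site d) i) ω else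
      f ((x + Pi.single j z : Fin p → Site d) i) ω) = f (x j + z) ω * ∏ i ∈ Finset.univ.erase j,
        (if i ∈ I then average a c F f (x i) ω else f (x i) ω) := by
    intro z
    rw [← Finset.mul_prod_erase _ _ (Finset.mem_univ j)]
    congr 1
    · simp [hj]
    · refine Finset.prod_congr rfl fun i hi => ?_
      simp [Finset.ne_of_mem_erase hi]
  have e1 : ∏ i ∈ Finset.univ.erase j,
      (if i ∈ insert j I then average a c F f (x i) ω else f (x i) ω) =
      ∏ i ∈ Finset.univ.erase j, (if i ∈ I then average a c F f (x i) ω else f (x i) ω) :=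
    Finset.prod_congr rfl fun i hi => by simp [Finset.ne_of_mem_erase hi]
  simp_rw [e3]
  rw [← Finset.mul_prod_erase _ _ (Finset.mem_univ j),
    ← Finset.mul_prod_erase _ _ (Finset.mem_univ j), e1, if_pos (Finset.mem_insert_self _ _),
    if_neg hj]
  simp_rw [← mul_assoc, ← Finset.sum_mul]
  rw [average]
  ring

lemma hasMoments_prod_ite [IsFiniteMeasure μ] (hf : ∀ x, HasMoments (f x) μ) {p : ℕ}
    (I : Finset (Fin p)) (x : Fin p → Site d) :
    HasMoments (fun ω => ∏ i, (if i ∈ I then average a c F f (x i) ω else f (x i) ω)) μ :=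
  HasMoments.prod _ fun i => by
    split_ifs
    · exact hasMoments_average hf _
    · exact hf _

lemma integral_lazy_sum {g : Ω → ℝ} {h : Site d → Ω → ℝ} (hg : Integrable g μ)
    (hh : ∀ z, Integrable (h z) μ) :
    ∫ ω, ((1 - c) * g ω + c * ∑ z ∈ F, a z * h z ω) ∂μ =
      (1 - c) * ∫ ω, g ω ∂μ + c * ∑ z ∈ F, a z * ∫ ω, h z ω ∂μ := by
  rw [integral_add (hg.const_mul _)
    ((integrable_finsetSum F fun z _ => (hh z).const_mul (a z)).const_mul c),
    integral_const_mul, integral_const_mul,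
    integral_finsetSum F fun z _ => (hh z).const_mul (a z)]
  simp_rw [integral_const_mul]

lemma partialMoment_insert [IsFiniteMeasure μ] (hf : ∀ x, HasMoments (f x) μ) {p : ℕ}
    {I : Finset (Fin p)} {j : Fin p} (hj : j ∉ I) (x : Fin p → Site d) :
    partialMoment μ a c F f (insert j I) x = (1 - c) * partialMoment μ a c F f I x +
      c * ∑ z ∈ F, a z * partialMoment μ a c F f I (x + Pi.single j z) :=
  (integral_congr_ae (Eventually.of_forall fun ω => prod_ite_insert hj x ω)).trans
    (integral_lazy_sum (hasMoments_prod_ite hf I x).integrable fun z : Site d =>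
      (hasMoments_prod_ite hf I (x + (Pi.single j z : Fin p → Site d))).integrable)

end Average

/-- The constant in the one step estimate for the moments of the splitting scheme. -/
def stepConst (v β κ : ℝ) (p : ℕ) : ℝ :=
  (1 + numPairs p * β + factorConst v p) * (p * κ * (1 + 4 * κ * p)) +
    factorConst v p * (1 + 2 * p) + 2 * p * κ * (numPairs p * β)

lemma abs_step_defect_le {v β κ δ K θ g m L V E : ℝ} {p : ℕ} (hβ : 0 ≤ β) (hκ : 0 ≤ κ)
    (hδ0 : 0 ≤ δ) (hδ1 : δ ≤ 1) (hδκ : δ * κ ≤ 1) (hE : 0 ≤ E) (hK0 : 0 ≤ K)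
    (hθ : |θ - 1 - δ * V| ≤ factorConst v p * √δ ^ 3) (hm : |m| ≤ K)
    (hmix : |g - m - δ * κ * L| ≤ p * (δ * κ * (4 * (δ * κ) * p + E) * K))
    (hL : |L| ≤ 2 * p * K) (hVb : |V| ≤ numPairs p * β) :
    |θ * g - m - δ * (κ * L + V * m)| ≤ stepConst v β κ p * (δ * (√δ + E)) * K := by
  set N := numPairs p * β with hN
  have hN0 : 0 ≤ N := mul_nonneg (numPairs_nonneg p) hβ
  set Φ := factorConst v p with hΦ
  have hΦ0 : 0 ≤ Φ := factorConst_nonneg _ _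
  set r := √δ with hr
  have hr0 : 0 ≤ r := Real.sqrt_nonneg _
  have hrr : r * r = δ := Real.mul_self_sqrt hδ0
  have hr1 : r ≤ 1 := Real.sqrt_le_one.2 hδ1
  have hδr : δ ≤ r := by rw [← hrr]; exact mul_le_of_le_one_left hr0 hr1
  have hr3 : r ^ 3 = δ * r := by rw [← hrr]; ring
  have hrE : r ≤ r + E := by linarith
  have hEr : E ≤ r + E := by linarith
  rw [hr3] at hθ
  have hθb : |θ| ≤ 1 + N + Φ := by
    calc |θ| = |(θ - 1 - δ * V) + 1 + δ * V| := by congr 1; ring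
      _ ≤ |θ - 1 - δ * V| + 1 + |δ * V| := by
          refine (abs_add_three _ _ _).trans ?_
          rw [abs_one]
      _ ≤ Φ * (1 * 1) + 1 + 1 * N := by
          rw [abs_mul, abs_of_nonneg hδ0]
          refine add_le_add (add_le_add (hθ.trans ?_) le_rfl) ?_
          · gcongr
          · gcongr
      _ = _ := by ring
  have hmL : |m + δ * κ * L| ≤ (1 + 2 * p) * K := by
    calc _ ≤ |m| + δ * κ * |L| := by
          refine (abs_add_le _ _).trans ?_
          rw [abs_mul, abs_of_nonneg (mul_nonneg hδ0 hκ)]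
      _ ≤ K + 1 * (2 * p * K) := by gcongr
      _ = _ := by ring
  have h1 : |θ| * |g - m - δ * κ * L| ≤
      (1 + N + Φ) * (p * (δ * κ * (4 * ((r + E) * κ) * p + (r + E)) * K)) := by
    refine mul_le_mul hθb (hmix.trans ?_) (abs_nonneg _) (by positivity)
    have : δ ≤ r + E := by linarith
    gcongr
  have h2 : |θ - 1 - δ * V| * |m + δ * κ * L| ≤ Φ * (δ * (r + E)) * ((1 + 2 * p) * K) := by
    refine mul_le_mul (hθ.trans ?_) hmL (abs_nonneg _) (by positivity)
    gcongr
  have h3 : δ * |V| * (δ * κ * |L|) ≤ δ * N * ((r + E) * κ * (2 * p * K)) := by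
    have : δ ≤ r + E := by linarith
    gcongr
  calc _ = |θ * (g - m - δ * κ * L) + (θ - 1 - δ * V) * (m + δ * κ * L) +
          δ * V * (δ * κ * L)| := by congr 1; ring
    _ ≤ |θ| * |g - m - δ * κ * L| + |θ - 1 - δ * V| * |m + δ * κ * L| +
          δ * |V| * (δ * κ * |L|) := by
        refine (abs_add_three _ _ _).trans (le_of_eq ?_)
        simp only [abs_mul, abs_of_nonneg hδ0, abs_of_nonneg hκ]
    _ ≤ _ := add_le_add (add_le_add h1 h2) h3
    _ = _ := by rw [stepConst]; ring

lemma stepConst_nonneg {v β κ : ℝ} (hβ : 0 ≤ β) (hκ : 0 ≤ κ) (p : ℕ) : 0 ≤ stepConst v β κ p := by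
  have h1 := factorConst_nonneg v p
  have h2 := numPairs_nonneg p
  unfold stepConst
  positivity

variable {B : Site d → ℝ} {W : ℝ≥0 → Site d → Ω → ℝ} {a : Site d → ℝ}

lemma IsWienerField.integral_prod_step (hW : IsWienerField 𝓕 μ B W) {s t : ℝ≥0} (hst : s ≤ t)
    {f : Site d → Ω → ℝ} (hf : ∀ x, Measurable[𝓕 s] (f x)) {p : ℕ} (x : Fin p → Site d) :
    ∫ ω, ∏ i, ((1 + (W t (x i) ω - W s (x i) ω)) * f (x i) ω) ∂μ =
      (∫ ω, ∏ i, (1 + (W t (x i) ω - W s (x i) ω)) ∂μ) * ∫ ω, ∏ i, f (x i) ω ∂μ := by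
  have hZ : Measurable[𝓕 s] fun ω => ∏ i, f (x i) ω :=
    Finset.measurable_fun_prod _ fun i _ => hf (x i)
  have h := (hW.indepFun_increment hst hZ (h := fun y => ∏ i, (1 + y (x i)))
    (by fun_prop)).integral_mul_eq_mul_integral (hZ.mono (𝓕.le s) le_rfl).aestronglyMeasurable
    (Finset.measurable_fun_prod _ fun i _ =>
      (hW.measurable_increment s t (x i)).const_add 1).aestronglyMeasurable
  simp_rw [Finset.prod_mul_distrib]
  rw [mul_comm, ← h]
  exact integral_congr_ae (Eventually.of_forall fun ω => mul_comm _ _)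

variable [IsProbabilityMeasure μ]

/-- One step of the splitting scheme acts on the moments as an Euler step of the moment
equation. -/
lemma IsWienerField.abs_moment_step_sub_le (hW : IsWienerField 𝓕 μ B W) (ha : IsJumpLaw a)
    {β κ δ K : ℝ} (hβ : 0 ≤ β) (hB : ∀ x, |B x| ≤ β) (hκ : 0 ≤ κ) {s t : ℝ≥0} (hst : s ≤ t)
    (hδ : (t - s : ℝ) = δ) (hδ1 : δ ≤ 1) (hδκ : δ * κ ≤ 1) (F : Finset (Site d))
    {f : Site d → Ω → ℝ} (hf : ∀ x, Measurable[𝓕 s] (f x)) (hfm : ∀ x, HasMoments (f x) μ) {p : ℕ}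
    (hK : ∀ x : Fin p → Site d, |∫ ω, ∏ i, f (x i) ω ∂μ| ≤ K) (x : Fin p → Site d) :
    |∫ ω, ∏ i, ((1 + (W t (x i) ω - W s (x i) ω)) * average a (δ * κ) F f (x i) ω) ∂μ -
      ∫ ω, ∏ i, f (x i) ω ∂μ - δ * (κ * ∑ j, (∑' z, a z *
        ∫ ω, ∏ i, f ((x + Pi.single j z : Fin p → Site d) i) ω ∂μ - ∫ ω, ∏ i, f (x i) ω ∂μ) +
        pairPotential B x * ∫ ω, ∏ i, f (x i) ω ∂μ)| ≤
      stepConst (B 0) β κ p * (δ * (√δ + (1 - ∑ z ∈ F, a z))) * K := by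
  have hK0 : 0 ≤ K := (abs_nonneg _).trans (hK x)
  have hδ0 : 0 ≤ δ := by rw [← hδ]; exact sub_nonneg.2 (by exact_mod_cast hst)
  have hE : 0 ≤ 1 - ∑ z ∈ F, a z :=
    sub_nonneg.2 (sum_le_hasSum F (fun z _ => ha.nonneg z) ha.hasSum_one)
  rw [hW.integral_prod_step hst (measurable_average hf)]
  have hθ := hW.abs_integral_prod_one_add_sub_le hst (hδ.trans_le hδ1) x
  rw [hδ] at hθ
  have hg0 : ∀ x : Fin p → Site d, partialMoment μ a (δ * κ) F f ∅ x =
      ∫ ω, ∏ i, f (x i) ω ∂μ := fun x => by simp [partialMoment]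
  have hmix := (abs_mixing_sub_le ha F (mul_nonneg hδ0 hκ) hδκ hK0
    (g := partialMoment μ a (δ * κ) F f) (fun I j hj x => partialMoment_insert hfm hj x)
    (fun x => (hg0 x).symm ▸ hK x) Finset.univ).2.2 x
  have hgu : partialMoment μ a (δ * κ) F f Finset.univ x =
      ∫ ω, ∏ i, average a (δ * κ) F f (x i) ω ∂μ := by simp [partialMoment]
  simp only [hgu, hg0, Finset.card_univ, Fintype.card_fin] at hmix
  refine abs_step_defect_le hβ hκ hδ0 hδ1 hδκ hE hK0 hθ (hK x) hmix ?_ (abs_pairPotential_le hB x)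
  refine (Finset.abs_sum_le_sum_abs _ _).trans ?_
  refine (Finset.sum_le_sum (g := fun _ => 2 * K) fun j _ => ?_).trans (le_of_eq ?_)
  · refine (abs_sub _ _).trans ?_
    have h1 := abs_sum_sub_tsum_mul_le ha ∅
      (f := fun z => ∫ ω, ∏ i, f ((x + Pi.single j z : Fin p → Site d) i) ω ∂μ) fun z => hK _
    simp only [Finset.sum_empty, zero_sub, abs_neg, sub_zero, one_mul] at h1
    have h2 := hK x
    linarith
  · simp only [Finset.sum_const, Finset.card_univ, Fintype.card_fin, nsmul_eq_mul]
    ring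

end

section

variable {d : ℕ} {a B : Site d → ℝ} {β : ℝ}

/-- The generator of the moment equation. -/
def momentGenerator (ha : IsJumpLaw a) (hB : ∀ x, |B x| ≤ β) (p : ℕ) (κ : ℝ≥0) :
    BddFun (Fin p → Site d) →L[ℝ] BddFun (Fin p → Site d) :=
  (particles ha hB p κ).bddOp - (numPairs p * β + 2 * p * κ) • 1

lemma momentGenerator_apply (ha : IsJumpLaw a) (hB : ∀ x, |B x| ≤ β) (p : ℕ) (κ : ℝ≥0)
    (f : BddFun (Fin p → Site d)) (x : Fin p → Site d) :
    momentGenerator ha hB p κ f x =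
      κ * ∑ j, (∑' z, a z * f (x + Pi.single j z) - f x) + pairPotential B x * f x := by
  have hs : Summable fun s : Fin p × Site d =>
      ((particles ha hB p κ).weight s).toReal * f (x + (particles ha hB p κ).shift s) :=
    Hopping.summable_weight_mul _ f x
  have hdiag : 0 ≤ p * κ + numPairs p * β + pairPotential B x := by
    have h1 := neg_abs_le (pairPotential B x)
    have h2 := abs_pairPotential_le hB x
    have h3 : (0 : ℝ) ≤ p * κ := by positivity
    linarith
  have h1 : (particles ha hB p κ).bddOp f x = κ * ∑ j, ∑' z, a z * f (x + Pi.single j z) +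
      (p * κ + numPairs p * β + pairPotential B x) * f x := by
    rw [Hopping.bddOp_apply, Summable.tsum_prod hs, tsum_fintype, Finset.mul_sum]
    congr 1
    · refine Finset.sum_congr rfl fun j _ => ?_
      rw [← tsum_mul_left]
      refine tsum_congr fun z => ?_
      have hw : (ENNReal.ofReal (κ * a z)).toReal = κ * a z :=
        ENNReal.toReal_ofReal (mul_nonneg κ.2 (ha.nonneg z))
      exact (congrArg (· * f (x + Pi.single j z)) hw).trans (mul_assoc _ _ _)
    · simp only [particles]
      rw [ENNReal.toReal_ofReal hdiag]
  calc momentGenerator ha hB p κ f x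
      = (particles ha hB p κ).bddOp f x - (numPairs p * β + 2 * p * κ) * f x := rfl
    _ = _ := by
      rw [h1, Finset.sum_sub_distrib]
      simp only [Finset.sum_const, Finset.card_univ, Fintype.card_fin, nsmul_eq_mul]
      ring

variable {Ω : Type*} {mΩ : MeasurableSpace Ω} {μ : Measure Ω} {𝓕 : Filtration ℝ≥0 mΩ}
  {W : ℝ≥0 → Site d → Ω → ℝ}

/-- The splitting scheme with time step `δ` for the Anderson problem: a lazy averaging step is
followed by a multiplication with the noise. -/
def scheme (a : Site d → ℝ) (κ δ : ℝ≥0) (F : Finset (Site d)) (W : ℝ≥0 → Site d → Ω → ℝ) :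
    ℕ → Site d → Ω → ℝ
  | 0 => fun _ _ => 1
  | k + 1 => fun x ω => (1 + (W ((k + 1 : ℕ) * δ) x ω - W (k * δ) x ω)) *
      average a (δ * κ) F (scheme a κ δ F W k) x ω

lemma natCast_mul_le_succ (k : ℕ) (δ : ℝ≥0) : (k : ℝ≥0) * δ ≤ (k + 1 : ℕ) * δ := by
  gcongr; omega

lemma IsWienerField.measurable_scheme (hW : IsWienerField 𝓕 μ B W) (κ δ : ℝ≥0)
    (F : Finset (Site d)) (k : ℕ) (x : Site d) :
    Measurable[𝓕 (k * δ)] (scheme a κ δ F W k x) := by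
  induction k generalizing x with
  | zero => exact measurable_const
  | succ k ih =>
    have hk := natCast_mul_le_succ k δ
    exact ((hW.measurable_increment_of_le hk le_rfl x).const_add 1).mul
      ((measurable_average ih x).mono (𝓕.mono hk) le_rfl)

lemma IsWienerField.hasMoments_scheme [IsFiniteMeasure μ] (hW : IsWienerField 𝓕 μ B W)
    (κ δ : ℝ≥0) (F : Finset (Site d)) (k : ℕ) (x : Site d) :
    HasMoments (scheme a κ δ F W k x) μ := by
  induction k generalizing x with
  | zero => exact HasMoments.const 1
  | succ k ih =>
    exact ((HasMoments.const 1).add (hW.hasMoments_increment _ _ x)).mul (hasMoments_average ih x)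

/-- The moments of the splitting scheme. -/
def schemeMoment (μ : Measure Ω) (a : Site d → ℝ) (κ δ : ℝ≥0) (F : Finset (Site d))
    (W : ℝ≥0 → Site d → Ω → ℝ) (p k : ℕ) (x : Fin p → Site d) : ℝ :=
  ∫ ω, ∏ i, scheme a κ δ F W k (x i) ω ∂μ

variable [IsProbabilityMeasure μ]

lemma IsWienerField.abs_schemeMoment_step_sub_le (hW : IsWienerField 𝓕 μ B W)
    (ha : IsJumpLaw a) (hβ : 0 ≤ β) (hB : ∀ x, |B x| ≤ β) {κ δ : ℝ≥0} (hδ1 : δ ≤ 1)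
    (hδκ : δ * κ ≤ 1) (F : Finset (Site d)) {p k : ℕ} (f : BddFun (Fin p → Site d))
    (hf : ∀ x, f x = schemeMoment μ a κ δ F W p k x) (x : Fin p → Site d) :
    |schemeMoment μ a κ δ F W p (k + 1) x - f x - δ * momentGenerator ha hB p κ f x| ≤
      stepConst (B 0) β κ p * (δ * (√δ + (1 - ∑ z ∈ F, a z))) * ‖f‖ := by
  have h := hW.abs_moment_step_sub_le ha hβ hB κ.2 (natCast_mul_le_succ k δ) (δ := (δ : ℝ))
    (K := ‖f‖) (by push_cast; ring) (by exact_mod_cast hδ1) (by exact_mod_cast hδκ) F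
    (f := scheme a κ δ F W k) (fun y => hW.measurable_scheme κ δ F k y)
    (fun y => hW.hasMoments_scheme κ δ F k y) (p := p)
    (fun y => (congrArg abs (hf y)).symm.trans_le (f.norm_coe_le_norm y)) x
  rw [momentGenerator_apply]
  simp_rw [hf]
  exact h

/-- The moments of the splitting scheme form an approximate Euler scheme for the moment
equation. -/
lemma IsWienerField.exists_schemeMoment (hW : IsWienerField 𝓕 μ B W) (ha : IsJumpLaw a)
    (hβ : 0 ≤ β) (hB : ∀ x, |B x| ≤ β) {κ δ : ℝ≥0} (hδ1 : δ ≤ 1) (hδκ : δ * κ ≤ 1)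
    (F : Finset (Site d)) (p : ℕ) :
    ∃ m : ℕ → BddFun (Fin p → Site d), (∀ k x, m k x = schemeMoment μ a κ δ F W p k x) ∧
      m 0 = 1 ∧ ∀ k, ‖m (k + 1) - m k - (δ : ℝ) • momentGenerator ha hB p κ (m k)‖ ≤
        stepConst (B 0) β κ p * (δ * (√δ + (1 - ∑ z ∈ F, a z))) * ‖m k‖ := by
  have hE : 0 ≤ 1 - ∑ z ∈ F, a z :=
    sub_nonneg.2 (sum_le_hasSum F (fun z _ => ha.nonneg z) ha.hasSum_one)
  have hex : ∀ k, ∃ f : BddFun (Fin p → Site d), ∀ x, f x = schemeMoment μ a κ δ F W p k x := by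
    intro k
    induction k with
    | zero => exact ⟨1, fun x => by simp [schemeMoment, scheme]⟩
    | succ k ih =>
      obtain ⟨f, hf⟩ := ih
      refine ⟨BddFun.mk _ (stepConst (B 0) β κ p * (δ * (√δ + (1 - ∑ z ∈ F, a z))) * ‖f‖ +
        ‖f + (δ : ℝ) • momentGenerator ha hB p κ f‖) fun x => ?_, fun x => BddFun.mk_apply _ _ _ _⟩
      have h1 := hW.abs_schemeMoment_step_sub_le ha hβ hB hδ1 hδκ F f hf x
      have h2 := BddFun.norm_coe_le_norm (f + (δ : ℝ) • momentGenerator ha hB p κ f) x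
      calc ‖schemeMoment μ a κ δ F W p (k + 1) x‖
          = ‖(schemeMoment μ a κ δ F W p (k + 1) x - f x - δ * momentGenerator ha hB p κ f x) +
            (f + (δ : ℝ) • momentGenerator ha hB p κ f) x‖ := by
              congr 1
              simp only [lp.coeFn_add, lp.coeFn_smul, Pi.add_apply, Pi.smul_apply, smul_eq_mul]
              ring
        _ ≤ _ := (norm_add_le _ _).trans (add_le_add h1 h2)
  choose m hm using hex
  refine ⟨m, hm, ?_, fun k => ?_⟩
  · ext x
    rw [hm]
    simp [schemeMoment, scheme]
  · refine BddFun.norm_le ?_ fun x => ?_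
    · have := stepConst_nonneg (v := B 0) hβ κ.2 p
      positivity
    · have h1 := hW.abs_schemeMoment_step_sub_le ha hβ hB hδ1 hδκ F (m k) (hm k) x
      rw [← hm] at h1
      exact h1

lemma tendsto_sqrt_div_natCast (t : ℝ≥0) :
    Tendsto (fun n : ℕ => √((t / n : ℝ≥0) : ℝ)) atTop (𝓝 0) := by
  have h := (Real.continuous_sqrt.tendsto 0).comp (tendsto_const_div_atTop_nhds_zero_nat (t : ℝ))
  rw [Real.sqrt_zero] at h
  exact h.congr fun n => by simp

lemma eventually_div_natCast_mul_le_one (t κ : ℝ≥0) : ∀ᶠ n : ℕ in atTop, t / n * κ ≤ 1 := by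
  filter_upwards [eventually_ge_atTop ⌈t * κ⌉₊, eventually_gt_atTop 0] with n hn hn0
  have hn0' : (0 : ℝ≥0) < n := by exact_mod_cast hn0
  rw [div_mul_eq_mul_div, div_le_one hn0']
  exact Nat.ceil_le.1 hn

section Limit

variable (hW : IsWienerField 𝓕 μ B W) (ha : IsJumpLaw a) (hβ : 0 ≤ β) (hB : ∀ x, |B x| ≤ β)
  {F : ℕ → Finset (Site d)} (hF : Tendsto (fun n => ∑ z ∈ F n, a z) atTop (𝓝 1)) (κ t : ℝ≥0)
  (p : ℕ)

include hF in
lemma tendsto_natCast_mul_step (C : ℝ) :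
    Tendsto (fun n : ℕ => n * (C * ((t / n : ℝ≥0) * (√((t / n : ℝ≥0) : ℝ) + (1 - ∑ z ∈ F n, a z)))))
      atTop (𝓝 0) := by
  have h1 : Tendsto (fun n : ℕ => C * t * (√((t / n : ℝ≥0) : ℝ) + (1 - ∑ z ∈ F n, a z))) atTop
      (𝓝 (C * t * (0 + (1 - 1)))) :=
    ((tendsto_sqrt_div_natCast t).add (hF.const_sub 1)).const_mul _
  rw [sub_self, add_zero, mul_zero] at h1
  refine h1.congr' ?_
  filter_upwards [eventually_gt_atTop 0] with n hn
  have hn0 : (n : ℝ) ≠ 0 := by exact_mod_cast hn.ne'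
  push_cast
  field_simp

include hW ha hβ hB hF in
lemma IsWienerField.exists_schemeMoment_seq :
    ∃ (m : ℕ → ℕ → BddFun (Fin p → Site d)) (r : ℕ → ℝ), (∀ n, m n 0 = 1) ∧ (∀ n, 0 ≤ r n) ∧
      Tendsto (fun n : ℕ => n * r n) atTop (𝓝 0) ∧
      (∀ᶠ n in atTop, ∀ k x, m n k x = schemeMoment μ a κ (t / n) (F n) W p k x) ∧
      ∀ᶠ n in atTop, ∀ k < n, ‖m n (k + 1) - m n k -
        ((t : ℝ) / n) • momentGenerator ha hB p κ (m n k)‖ ≤ r n * ‖m n k‖ := by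
  have hex : ∀ n : ℕ, ∃ m : ℕ → BddFun (Fin p → Site d), m 0 = 1 ∧
      ((t / n : ℝ≥0) ≤ 1 → t / n * κ ≤ 1 →
      (∀ k x, m k x = schemeMoment μ a κ (t / n) (F n) W p k x) ∧
      ∀ k, ‖m (k + 1) - m k - ((t / n : ℝ≥0) : ℝ) • momentGenerator ha hB p κ (m k)‖ ≤
        stepConst (B 0) β κ p * ((t / n : ℝ≥0) * (√((t / n : ℝ≥0) : ℝ) +
          (1 - ∑ z ∈ F n, a z))) * ‖m k‖) := by
    intro n
    by_cases h : (t / n : ℝ≥0) ≤ 1 ∧ t / n * κ ≤ 1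
    · obtain ⟨m, h1, h2, h3⟩ := hW.exists_schemeMoment ha hβ hB h.1 h.2 (F n) p
      exact ⟨m, h2, fun _ _ => ⟨h1, h3⟩⟩
    · exact ⟨fun _ => 1, rfl, fun h1 h2 => (h ⟨h1, h2⟩).elim⟩
  choose m hm0 hm using hex
  have hE : ∀ n, 0 ≤ 1 - ∑ z ∈ F n, a z := fun n =>
    sub_nonneg.2 (sum_le_hasSum _ (fun z _ => ha.nonneg z) ha.hasSum_one)
  have h1 : ∀ᶠ n : ℕ in atTop, t / n ≤ 1 := by
    simpa using eventually_div_natCast_mul_le_one t 1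
  have h2 := eventually_div_natCast_mul_le_one t κ
  refine ⟨m, fun n => stepConst (B 0) β κ p * ((t / n : ℝ≥0) * (√((t / n : ℝ≥0) : ℝ) +
    (1 - ∑ z ∈ F n, a z))), hm0, fun n => ?_, tendsto_natCast_mul_step hF t _, ?_, ?_⟩
  · have := stepConst_nonneg (v := B 0) hβ κ.2 p
    have := hE n
    positivity
  · filter_upwards [h1, h2] with n h1 h2 using (hm n h1 h2).1
  · filter_upwards [h1, h2] with n h1 h2 k hk
    simpa using (hm n h1 h2).2 k

include hW ha hβ hB hF in
/-- The moments of the splitting scheme converge to the solution of the moment equation. -/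
theorem IsWienerField.tendsto_integral_scheme_pow :
    Tendsto (fun n : ℕ => ∫ ω, scheme a κ (t / n) (F n) W n 0 ω ^ p ∂μ) atTop
      (𝓝 (Real.exp (-((numPairs p * β + 2 * p * κ) * t)) *
        ∑' k : ℕ, (t : ℝ) ^ k / (k.factorial : ℝ) * (particles ha hB p κ).pathWeight k)) := by
  obtain ⟨m, r, h0, hr0, hr, hm, hstep⟩ := hW.exists_schemeMoment_seq ha hβ hB hF κ t p
  have h := tendsto_euler (momentGenerator ha hB p κ) t.2 hr0 hr h0 hstep
  have h' := ((BddFun.eval (0 : Fin p → Site d)).continuous.tendsto _).comp h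
  rw [BddFun.eval_apply, momentGenerator, Hopping.exp_bddOp_one_apply_zero] at h'
  refine h'.congr' ?_
  filter_upwards [hm] with n hm
  simp [hm, schemeMoment]

include hW ha hβ hB hF in
/-- The moments of the splitting scheme are bounded uniformly in space and on bounded time
intervals. -/
theorem IsWienerField.exists_integral_scheme_pow_le :
    ∃ C : ℝ, ∀ᶠ n : ℕ in atTop, ∀ k ≤ n, ∀ x,
      ∫ ω, scheme a κ (t / n) (F n) W k x ω ^ p ∂μ ≤ C := by
  obtain ⟨m, r, h0, hr0, hr, hm, hstep⟩ := hW.exists_schemeMoment_seq ha hβ hB hF κ t p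
  set H := momentGenerator ha hB p κ
  refine ⟨Real.exp (t * ‖H‖ + 1) * ‖(1 : BddFun (Fin p → Site d))‖, ?_⟩
  filter_upwards [hm, hstep, hr.eventually (gt_mem_nhds one_pos), eventually_gt_atTop 0]
    with n hm hstep hr1 hn k hk x
  have h1 := norm_euler_le H t.2 hstep k hk
  rw [h0] at h1
  have h2 : ∫ ω, scheme a κ (t / n) (F n) W k x ω ^ p ∂μ = m n k fun _ => x := by
    rw [hm]; simp [schemeMoment]
  rw [h2]
  refine ((le_abs_self _).trans (BddFun.norm_coe_le_norm (m n k) _)).trans (h1.trans ?_)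
  have hn0 : (n : ℝ) ≠ 0 := by exact_mod_cast hn.ne'
  have hkn : (k : ℝ) ≤ n := by exact_mod_cast hk
  gcongr
  have ht := t.2
  have := hr0 n
  calc (k : ℝ) * (t / n * ‖H‖ + r n) ≤ n * (t / n * ‖H‖ + r n) := by gcongr
    _ = t * ‖H‖ + n * r n := by field_simp
    _ ≤ _ := by gcongr

end Limit

end

section

lemma sq_lintegral_le {α : Type*} {m : MeasurableSpace α} (ν : Measure α) {f : α → ℝ≥0∞}
    (hf : AEMeasurable f ν) : (∫⁻ x, f x ∂ν) ^ 2 ≤ ν Set.univ * ∫⁻ x, f x ^ 2 ∂ν := by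
  have h := ENNReal.lintegral_mul_le_Lp_mul_Lq ν Real.HolderConjugate.two_two hf
    (aemeasurable_const (b := (1 : ℝ≥0∞)))
  have hsq : ∀ y : ℝ≥0∞, (y ^ (1 / 2 : ℝ)) ^ 2 = y := fun y => by
    rw [← ENNReal.rpow_natCast, ← ENNReal.rpow_mul]; norm_num
  simp only [Pi.mul_apply, mul_one, lintegral_const, ENNReal.rpow_two, one_pow, one_mul] at h
  calc _ ≤ ((∫⁻ x, f x ^ 2 ∂ν) ^ (1 / 2 : ℝ) * ν Set.univ ^ (1 / 2 : ℝ)) ^ 2 := by gcongr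
    _ = _ := by rw [mul_pow, hsq, hsq, mul_comm]

lemma enorm_integral_sub_sq_le {α : Type*} {m : MeasurableSpace α} (ν : Measure α)
    {f g : α → ℝ} (hf : AEStronglyMeasurable f ν) (hg : Integrable g ν) :
    ‖∫ x, f x ∂ν - ∫ x, g x ∂ν‖ₑ ^ 2 ≤ ν Set.univ * ∫⁻ x, ‖f x - g x‖ₑ ^ 2 ∂ν := by
  have hfg : AEStronglyMeasurable (fun x => f x - g x) ν := hf.sub hg.1
  refine le_trans ?_ (sq_lintegral_le ν hfg.enorm)
  gcongr
  by_cases hi : Integrable (fun x => f x - g x) ν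
  · have hfi : Integrable f ν :=
      (hi.add hg).congr (Eventually.of_forall fun x => sub_add_cancel (f x) (g x))
    rw [← integral_sub hfi hg]
    exact enorm_integral_le_lintegral_enorm _
  · have : ∫⁻ x, ‖f x - g x‖ₑ ∂ν = ⊤ := by
      by_contra h
      exact hi ⟨hfg, lt_top_iff_ne_top.2 h⟩
    rw [this]
    exact le_top

variable {d : ℕ} {a ρ : Site d → ℝ}

lemma IsJumpLaw.tsum_ofReal_one (ha : IsJumpLaw a) : ∑' z, ENNReal.ofReal (a z) = 1 := by
  rw [← ENNReal.ofReal_tsum_of_nonneg ha.nonneg ha.hasSum_one.summable, ha.hasSum_one.tsum_eq,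
    ENNReal.ofReal_one]

lemma IsJumpLaw.tsum_ofReal_compl (ha : IsJumpLaw a) (F : Finset (Site d)) :
    ∑' z, (if z ∈ F then 0 else ENNReal.ofReal (a z)) = ENNReal.ofReal (1 - ∑ z ∈ F, a z) := by
  have h1 : ∑' z, (if z ∈ F then ENNReal.ofReal (a z) else 0) +
      ∑' z, (if z ∈ F then 0 else ENNReal.ofReal (a z)) = 1 := by
    rw [← ENNReal.tsum_add, ← ha.tsum_ofReal_one]
    refine tsum_congr fun z => ?_
    split_ifs <;> simp
  have h2 : ∑' z, (if z ∈ F then ENNReal.ofReal (a z) else 0) = ENNReal.ofReal (∑ z ∈ F, a z) := by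
    rw [tsum_eq_sum (s := F) fun z hz => if_neg hz, ENNReal.ofReal_sum_of_nonneg fun z _ =>
      ha.nonneg z]
    exact Finset.sum_congr rfl fun z hz => if_pos hz
  rw [h2] at h1
  rw [ENNReal.ofReal_sub _ (Finset.sum_nonneg fun z _ => ha.nonneg z), ENNReal.ofReal_one, ← h1,
    ENNReal.add_sub_cancel_left ENNReal.ofReal_ne_top]

lemma IsJumpLaw.sq_tsum_le (ha : IsJumpLaw a) (h : Site d → ℝ≥0∞) :
    (∑' z, ENNReal.ofReal (a z) * h z) ^ 2 ≤ ∑' z, ENNReal.ofReal (a z) * h z ^ 2 := by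
  refine (sq_tsum_mul_le _ _).trans (le_of_eq ?_)
  rw [ha.tsum_ofReal_one, one_mul]

lemma IsAdmissibleWeight.tsum_ne_top (hρ : IsAdmissibleWeight a ρ) :
    ∑' x, ENNReal.ofReal (ρ x) ≠ ⊤ := by
  rw [← ENNReal.ofReal_tsum_of_nonneg (fun x => (hρ.pos x).le) hρ.summable]
  exact ENNReal.ofReal_ne_top

/-- The averaging operator is bounded on weighted sums. -/
lemma IsAdmissibleWeight.exists_tsum_average_le (hρ : IsAdmissibleWeight a ρ) (ha : IsJumpLaw a) :
    ∃ C : ℝ≥0, ∀ g : Site d → ℝ≥0∞,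
      ∑' x, ENNReal.ofReal (ρ x) * ∑' z, ENNReal.ofReal (a z) * g (x + z) ≤
        C * ∑' x, ENNReal.ofReal (ρ x) * g x := by
  obtain ⟨C, hC⟩ := hρ.averaging
  refine ⟨C.toNNReal, fun g => ?_⟩
  have hsum : ∀ x, Summable fun z => a z * ρ (x - z) := fun x => by
    refine Summable.of_nonneg_of_le (fun z => mul_nonneg (ha.nonneg z) (hρ.pos _).le) (fun z => ?_)
      (ha.hasSum_one.summable.mul_right (∑' y, ρ y))
    exact mul_le_mul_of_nonneg_left (hρ.summable.le_tsum _ fun y _ => (hρ.pos y).le) (ha.nonneg z)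
  calc ∑' x, ENNReal.ofReal (ρ x) * ∑' z, ENNReal.ofReal (a z) * g (x + z)
      = ∑' z, ∑' x, ENNReal.ofReal (a z) * ENNReal.ofReal (ρ x) * g (x + z) := by
        rw [ENNReal.tsum_comm]
        refine tsum_congr fun x => ?_
        rw [← ENNReal.tsum_mul_left]
        exact tsum_congr fun z => by ring
    _ = ∑' z, ∑' x, ENNReal.ofReal (a z) * ENNReal.ofReal (ρ (x - z)) * g x := by
        refine tsum_congr fun z => ?_
        rw [← (Equiv.addRight z).tsum_eq fun x =>
          ENNReal.ofReal (a z) * ENNReal.ofReal (ρ (x - z)) * g x]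
        simp
    _ = ∑' x, (∑' z, ENNReal.ofReal (a z * ρ (x - z))) * g x := by
        rw [ENNReal.tsum_comm]
        refine tsum_congr fun x => ?_
        rw [← ENNReal.tsum_mul_right]
        exact tsum_congr fun z => by rw [ENNReal.ofReal_mul (ha.nonneg z)]
    _ ≤ ∑' x, (ENNReal.ofReal (C * ρ x)) * g x := by
        gcongr with x
        rw [← ENNReal.ofReal_tsum_of_nonneg (fun z => mul_nonneg (ha.nonneg z) (hρ.pos _).le)
          (hsum x)]
        exact ENNReal.ofReal_le_ofReal (hC x)
    _ = _ := by
        rw [← ENNReal.tsum_mul_left]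
        refine tsum_congr fun x => ?_
        rw [ENNReal.ofReal_mul' (hρ.pos x).le, mul_assoc]
        rfl

lemma measurable_laplacian {α : Type*} {m : MeasurableSpace α} {f : α → Site d → ℝ}
    (hf : ∀ x, Measurable fun q => f q x) (x : Site d) :
    Measurable fun q => laplacian a (f q) x :=
  Measurable.tsum fun z => ((hf (x + z)).sub (hf x)).const_mul (a z)

/-- The Laplacian of the jump law truncated to `F`. -/
def truncLaplacian (a : Site d → ℝ) (F : Finset (Site d)) (g : Site d → ℝ) (x : Site d) : ℝ :=
  ∑ z ∈ F, a z * g (x + z) - g x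

lemma enorm_laplacian_sub_le (ha : IsJumpLaw a) (F : Finset (Site d)) (f g : Site d → ℝ)
    (x : Site d) :
    ‖laplacian a f x - truncLaplacian a F g x‖ₑ ≤
      ∑' z, ENNReal.ofReal (a z) * ‖f (x + z) - (if z ∈ F then g (x + z) else 0)‖ₑ +
        ‖f x - g x‖ₑ := by
  set h : Site d → ℝ := fun z => f (x + z) - (if z ∈ F then g (x + z) else 0) with hh
  have he : ∀ z, ‖a z * h z‖ₑ = ENNReal.ofReal (a z) * ‖h z‖ₑ := fun z => by
    rw [enorm_mul, Real.enorm_of_nonneg (ha.nonneg z)]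
  by_cases htop : ∑' z, ENNReal.ofReal (a z) * ‖h z‖ₑ = ⊤
  · rw [htop, top_add]; exact le_top
  simp_rw [← he] at htop
  have hs : Summable fun z => a z * h z := by
    refine Summable.of_norm ?_
    have := ENNReal.summable_toReal htop
    simpa using this
  have hs2 : HasSum (fun z => a z * (if z ∈ F then g (x + z) else 0)) (∑ z ∈ F, a z * g (x + z)) := by
    have h0 : ∑ z ∈ F, a z * (if z ∈ F then g (x + z) else 0) = ∑ z ∈ F, a z * g (x + z) :=
      Finset.sum_congr rfl fun z hz => by simp [hz]
    rw [← h0]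
    exact hasSum_sum_of_ne_finset_zero fun z hz => by simp [hz]
  have hL : laplacian a f x = ∑' z, a z * h z + ∑ z ∈ F, a z * g (x + z) - f x := by
    have := ((hs.hasSum.add hs2).sub (ha.hasSum_one.mul_right (f x))).tsum_eq
    rw [one_mul] at this
    rw [← this]
    refine tsum_congr fun z => ?_
    simp only [hh]
    ring
  have e : laplacian a f x - truncLaplacian a F g x = ∑' z, a z * h z - (f x - g x) := by
    rw [hL, truncLaplacian]; ring
  rw [e]
  exact enorm_sub_le.trans (add_le_add
    (enorm_tsum_le_tsum_enorm.trans_eq (tsum_congr he)) le_rfl)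

lemma enorm_laplacian_sub_sq_le (ha : IsJumpLaw a) (F : Finset (Site d)) (f g : Site d → ℝ)
    (x : Site d) :
    ‖laplacian a f x - truncLaplacian a F g x‖ₑ ^ 2 ≤
      4 * ∑' z, ENNReal.ofReal (a z) * ‖f (x + z) - g (x + z)‖ₑ ^ 2 +
        4 * ∑' z, (if z ∈ F then 0 else ENNReal.ofReal (a z)) * ‖g (x + z)‖ₑ ^ 2 +
        2 * ‖f x - g x‖ₑ ^ 2 := by
  have hb : ∀ y z : ℝ≥0∞, (y + z) ^ 2 ≤ 2 * y ^ 2 + 2 * z ^ 2 := fun y z => by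
    have := ENNReal.rpow_add_le_mul_rpow_add_rpow y z (p := 2) (by norm_num)
    norm_num at this
    rwa [mul_add] at this
  calc _ ≤ _ := pow_le_pow_left' (enorm_laplacian_sub_le ha F f g x) 2
    _ ≤ _ := hb _ _
    _ ≤ 2 * ∑' z, ENNReal.ofReal (a z) *
          ‖f (x + z) - (if z ∈ F then g (x + z) else 0)‖ₑ ^ 2 + 2 * ‖f x - g x‖ₑ ^ 2 := by
        gcongr
        exact ha.sq_tsum_le _
    _ ≤ 2 * ∑' z, (2 * (ENNReal.ofReal (a z) * ‖f (x + z) - g (x + z)‖ₑ ^ 2) +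
          2 * ((if z ∈ F then 0 else ENNReal.ofReal (a z)) * ‖g (x + z)‖ₑ ^ 2)) +
          2 * ‖f x - g x‖ₑ ^ 2 := by
        gcongr with z
        split_ifs with hz
        · rw [zero_mul, mul_zero, add_zero]
          exact le_mul_of_one_le_left' (by norm_num)
        · rw [sub_zero]
          have := enorm_add_sq_le (f (x + z) - g (x + z)) (g (x + z))
          rw [sub_add_cancel] at this
          refine (mul_le_mul_right this _).trans (le_of_eq ?_)
          ring
    _ = _ := by
        rw [ENNReal.tsum_add, ENNReal.tsum_mul_left, ENNReal.tsum_mul_left]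
        ring

variable {Ω : Type*} {mΩ : MeasurableSpace Ω} {μ : Measure Ω}

lemma average_eq (a : Site d → ℝ) (c : ℝ) (F : Finset (Site d)) (f : Site d → Ω → ℝ) (x : Site d)
    (ω : Ω) : average a c F f x ω = f x ω + c * truncLaplacian a F (fun y => f y ω) x := by
  rw [average, truncLaplacian]; ring

/-- The squared norm of a random field in the weighted space. -/
def weightedSq (ρ : Site d → ℝ) (μ : Measure Ω) (f : Site d → Ω → ℝ) : ℝ≥0∞ :=
  ∑' x, ENNReal.ofReal (ρ x) * ∫⁻ ω, ‖f x ω‖ₑ ^ 2 ∂μ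

lemma measurable_truncLaplacian {F : Finset (Site d)} {g : Site d → Ω → ℝ}
    (hg : ∀ x, Measurable (g x)) (x : Site d) :
    Measurable fun ω => truncLaplacian a F (fun y => g y ω) x :=
  (Finset.measurable_fun_sum _ fun z _ => (hg (x + z)).const_mul _).sub (hg x)

lemma weightedSq_laplacian_sub_le (ha : IsJumpLaw a) {C : ℝ≥0∞}
    (hC : ∀ g : Site d → ℝ≥0∞,
      ∑' x, ENNReal.ofReal (ρ x) * ∑' z, ENNReal.ofReal (a z) * g (x + z) ≤
        C * ∑' x, ENNReal.ofReal (ρ x) * g x)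
    (F : Finset (Site d)) {f g : Site d → Ω → ℝ} (hf : ∀ x, Measurable (f x))
    (hg : ∀ x, Measurable (g x)) {S : ℝ≥0∞} (hS : ∀ x, ∫⁻ ω, ‖g x ω‖ₑ ^ 2 ∂μ ≤ S) :
    weightedSq ρ μ (fun x ω => laplacian a (fun y => f y ω) x -
        truncLaplacian a F (fun y => g y ω) x) ≤
      (4 * C + 2) * weightedSq ρ μ (fun x ω => f x ω - g x ω) +
        4 * S * ENNReal.ofReal (1 - ∑ z ∈ F, a z) * ∑' x, ENNReal.ofReal (ρ x) := by
  have hm : ∀ x, Measurable fun ω => ‖f x ω - g x ω‖ₑ ^ 2 := fun x =>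
    ((hf x).sub (hg x)).enorm.pow_const 2
  have hmg : ∀ x, Measurable fun ω => ‖g x ω‖ₑ ^ 2 := fun x => (hg x).enorm.pow_const 2
  have h1 : ∀ x, ∫⁻ ω, ‖laplacian a (fun y => f y ω) x -
      truncLaplacian a F (fun y => g y ω) x‖ₑ ^ 2 ∂μ ≤
      4 * ∑' z, ENNReal.ofReal (a z) * ∫⁻ ω, ‖f (x + z) ω - g (x + z) ω‖ₑ ^ 2 ∂μ +
      4 * (ENNReal.ofReal (1 - ∑ z ∈ F, a z) * S) +
      2 * ∫⁻ ω, ‖f x ω - g x ω‖ₑ ^ 2 ∂μ := by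
    intro x
    refine (lintegral_mono fun ω => enorm_laplacian_sub_sq_le ha F _ _ x).trans ?_
    rw [lintegral_add_right _ ((hm x).const_mul 2), lintegral_add_right _
      ((Measurable.tsum fun z => (hmg (x + z)).const_mul _).const_mul 4),
      lintegral_const_mul' _ _ (by simp), lintegral_const_mul' _ _ (by simp),
      lintegral_const_mul' _ _ (by simp),
      lintegral_tsum fun z => ((hm (x + z)).const_mul _).aemeasurable,
      lintegral_tsum fun z => ((hmg (x + z)).const_mul _).aemeasurable]
    gcongr with z
    · rw [lintegral_const_mul' _ _ ENNReal.ofReal_ne_top]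
    · rw [← ha.tsum_ofReal_compl F, ← ENNReal.tsum_mul_right]
      gcongr with z
      rw [lintegral_const_mul' _ _ (by split_ifs <;> simp)]
      gcongr
      exact hS _
  calc _ ≤ ∑' x, ENNReal.ofReal (ρ x) * (4 * ∑' z, ENNReal.ofReal (a z) *
          ∫⁻ ω, ‖f (x + z) ω - g (x + z) ω‖ₑ ^ 2 ∂μ +
          4 * (ENNReal.ofReal (1 - ∑ z ∈ F, a z) * S) +
          2 * ∫⁻ ω, ‖f x ω - g x ω‖ₑ ^ 2 ∂μ) := ENNReal.tsum_le_tsum fun x => by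
        gcongr; exact h1 x
    _ = 4 * ∑' x, ENNReal.ofReal (ρ x) * ∑' z, ENNReal.ofReal (a z) *
          ∫⁻ ω, ‖f (x + z) ω - g (x + z) ω‖ₑ ^ 2 ∂μ +
          4 * (ENNReal.ofReal (1 - ∑ z ∈ F, a z) * S) * ∑' x, ENNReal.ofReal (ρ x) +
          2 * weightedSq ρ μ (fun x ω => f x ω - g x ω) := by
        rw [weightedSq, ← ENNReal.tsum_mul_left, ← ENNReal.tsum_mul_left, ← ENNReal.tsum_mul_left,
          ← ENNReal.tsum_add, ← ENNReal.tsum_add]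
        exact tsum_congr fun x => by ring
    _ ≤ 4 * (C * weightedSq ρ μ (fun x ω => f x ω - g x ω)) +
          4 * (ENNReal.ofReal (1 - ∑ z ∈ F, a z) * S) * ∑' x, ENNReal.ofReal (ρ x) +
          2 * weightedSq ρ μ (fun x ω => f x ω - g x ω) := by
        gcongr
        exact hC fun y => ∫⁻ ω, ‖f y ω - g y ω‖ₑ ^ 2 ∂μ
    _ = _ := by ring

lemma weightedSq_sub_average_le (ha : IsJumpLaw a) {C : ℝ≥0∞}
    (hC : ∀ g : Site d → ℝ≥0∞,
      ∑' x, ENNReal.ofReal (ρ x) * ∑' z, ENNReal.ofReal (a z) * g (x + z) ≤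
        C * ∑' x, ENNReal.ofReal (ρ x) * g x)
    (F : Finset (Site d)) {f g : Site d → Ω → ℝ}
    (hg : ∀ x, Measurable (g x)) {S : ℝ≥0∞} (hS : ∀ x, ∫⁻ ω, ‖g x ω‖ₑ ^ 2 ∂μ ≤ S) (c : ℝ) :
    weightedSq ρ μ (fun x ω => f x ω - average a c F g x ω) ≤
      2 * weightedSq ρ μ (fun x ω => f x ω - g x ω) +
        2 * ENNReal.ofReal (c ^ 2) * ((4 * C + 6) * S * ∑' x, ENNReal.ofReal (ρ x)) := by
  have hm := measurable_truncLaplacian (a := a) (F := F) hg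
  have h0 : weightedSq ρ μ (fun x ω => truncLaplacian a F (fun y => g y ω) x) ≤
      (4 * C + 6) * S * ∑' x, ENNReal.ofReal (ρ x) := by
    have h := weightedSq_laplacian_sub_le (μ := μ) (ρ := ρ) ha hC F (f := fun _ _ => 0)
      (fun x => measurable_const) hg hS
    have hz : ∀ x, laplacian a (fun _ => 0) x = 0 := fun x => by simp [laplacian]
    simp only [hz, zero_sub, weightedSq, enorm_neg] at h
    refine h.trans ?_
    have h1 : ENNReal.ofReal (1 - ∑ z ∈ F, a z) ≤ 1 := by
      rw [← ENNReal.ofReal_one]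
      exact ENNReal.ofReal_le_ofReal (sub_le_self _ (Finset.sum_nonneg fun z _ => ha.nonneg z))
    have h2 : ∑' x, ENNReal.ofReal (ρ x) * ∫⁻ ω, ‖g x ω‖ₑ ^ 2 ∂μ ≤
        (∑' x, ENNReal.ofReal (ρ x)) * S := by
      rw [← ENNReal.tsum_mul_right]
      exact ENNReal.tsum_le_tsum fun x => by gcongr; exact hS x
    calc _ ≤ (4 * C + 2) * ((∑' x, ENNReal.ofReal (ρ x)) * S) +
          4 * S * 1 * ∑' x, ENNReal.ofReal (ρ x) := by gcongr
      _ = _ := by ring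
  calc _ ≤ ∑' x, ENNReal.ofReal (ρ x) * (2 * ∫⁻ ω, ‖f x ω - g x ω‖ₑ ^ 2 ∂μ +
          2 * (ENNReal.ofReal (c ^ 2) *
            ∫⁻ ω, ‖truncLaplacian a F (fun y => g y ω) x‖ₑ ^ 2 ∂μ)) := by
        refine ENNReal.tsum_le_tsum fun x => ?_
        gcongr
        have hp : ∀ ω, ‖f x ω - average a c F g x ω‖ₑ ^ 2 ≤ 2 * ‖f x ω - g x ω‖ₑ ^ 2 +
            2 * (ENNReal.ofReal (c ^ 2) * ‖truncLaplacian a F (fun y => g y ω) x‖ₑ ^ 2) := by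
          intro ω
          rw [average_eq, ← sub_sub, ← enorm_sq_eq_ofReal, ← mul_pow, ← enorm_mul]
          exact enorm_sub_sq_le _ _
        refine (lintegral_mono hp).trans (le_of_eq ?_)
        rw [lintegral_add_right _ ((((hm x).enorm.pow_const 2).const_mul _).const_mul _),
          lintegral_const_mul' _ _ (by simp), lintegral_const_mul' _ _ (by simp),
          lintegral_const_mul' _ _ (by simp)]
    _ = 2 * weightedSq ρ μ (fun x ω => f x ω - g x ω) + 2 * ENNReal.ofReal (c ^ 2) *
          weightedSq ρ μ (fun x ω => truncLaplacian a F (fun y => g y ω) x) := by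
        rw [weightedSq, weightedSq, ← ENNReal.tsum_mul_left, ← ENNReal.tsum_mul_left,
          ← ENNReal.tsum_add]
        exact tsum_congr fun x => by ring
    _ ≤ _ := by gcongr

end

section

lemma lintegral_Ioc_le_sum (δ : ℝ≥0) {h : ℝ → ℝ≥0∞} {c : ℕ → ℝ≥0∞} {k : ℕ} {s : ℝ}
    (hs : s ≤ (k + 1 : ℕ) * δ)
    (hc : ∀ j ≤ k, ∀ τ ∈ Set.Ioc ((j : ℝ) * δ) ((j + 1 : ℕ) * δ), τ ≤ s → h τ ≤ c j) :
    ∫⁻ τ in Set.Ioc 0 s, h τ ≤ ∑ j ∈ Finset.range (k + 1), δ * c j := by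
  have hpiece : ∀ j ≤ k, ∀ r, r ≤ s → r ≤ (j + 1 : ℕ) * δ →
      ∫⁻ τ in Set.Ioc ((j : ℝ) * δ) r, h τ ≤ δ * c j := by
    intro j hj r hrs hr
    calc _ ≤ ∫⁻ τ in Set.Ioc ((j : ℝ) * δ) r, c j := by
          refine setLIntegral_mono' measurableSet_Ioc fun τ hτ => ?_
          exact hc j hj τ ⟨hτ.1, hτ.2.trans hr⟩ (hτ.2.trans hrs)
      _ = c j * ENNReal.ofReal (r - j * δ) := by rw [setLIntegral_const, Real.volume_Ioc]
      _ ≤ c j * δ := by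
          gcongr
          rw [← ENNReal.ofReal_coe_nnreal]
          refine ENNReal.ofReal_le_ofReal ?_
          push_cast at hr
          linarith
      _ = _ := mul_comm _ _
  induction k generalizing s with
  | zero => simpa using hpiece 0 le_rfl s le_rfl hs
  | succ k ih =>
    rw [Finset.sum_range_succ]
    set r := min s ((k + 1 : ℕ) * δ) with hr
    have hsub : Set.Ioc 0 s ⊆ Set.Ioc 0 r ∪ Set.Ioc (((k + 1 : ℕ) : ℝ) * δ) s := by
      intro τ hτ
      rcases le_or_gt τ ((k + 1 : ℕ) * δ) with h | h
      · exact Or.inl ⟨hτ.1, le_min hτ.2 h⟩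
      · exact Or.inr ⟨h, hτ.2⟩
    refine (lintegral_mono_set hsub).trans ((lintegral_union_le _ _ _).trans (add_le_add ?_ ?_))
    · refine ih (min_le_right _ _) (fun j hj τ hτ hle => ?_) fun j hj r' hr' hr'' => ?_
      · exact hc j (hj.trans (Nat.le_succ _)) τ hτ (hle.trans (min_le_left _ _))
      · exact hpiece j (hj.trans (Nat.le_succ _)) r' (hr'.trans (min_le_left _ _)) hr''
    · exact hpiece (k + 1) le_rfl s le_rfl hs

lemma sum_range_mul_pow_add (A x : ℝ≥0∞) (k : ℕ) :
    A + x * ∑ j ∈ Finset.range k, A * (1 + x) ^ j = A * (1 + x) ^ k := by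
  induction k with
  | zero => simp
  | succ k ih =>
    rw [Finset.sum_range_succ, mul_add, ← add_assoc, ih, pow_succ]
    ring

variable {Ω : Type*} {mΩ : MeasurableSpace Ω} {μ : Measure Ω} {𝓕 : Filtration ℝ≥0 mΩ}

namespace ElemProcess

/-- The process with value `c j` on `(j δ, (j + 1) δ]` for `j < k`. -/
def step {s δ : ℝ≥0} {k : ℕ} (hks : k * δ ≤ s) (c : ℕ → Ω → ℝ)
    (hc : ∀ j : ℕ, Measurable[𝓕 (j * δ)] (c j)) (hc2 : ∀ j, MemLp (c j) 2 μ) :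
    ElemProcess 𝓕 μ s (Fin k) where
  left j := (j : ℕ) * δ
  right j := ((j : ℕ) + 1 : ℕ) * δ
  coef j := c j
  le j := natCast_mul_le_succ j δ
  le_T j := by
    refine le_trans ?_ hks
    gcongr
    exact j.2
  measurable j := hc j
  memLp j := hc2 j

variable {s δ : ℝ≥0} {k : ℕ} (hks : k * δ ≤ s) {c : ℕ → Ω → ℝ}
  (hc : ∀ j : ℕ, Measurable[𝓕 (j * δ)] (c j)) (hc2 : ∀ j, MemLp (c j) 2 μ)

lemma eval_step_of_lt {j : ℕ} (hj : j < k) {τ : ℝ≥0} (h1 : j * δ < τ) (h2 : τ ≤ (j + 1 : ℕ) * δ)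
    (ω : Ω) : (step hks c hc hc2).eval τ ω = c j ω := by
  rw [eval, Finset.sum_eq_single (⟨j, hj⟩ : Fin k)]
  · simp only [step]
    rw [Set.indicator_of_mem]
    exact ⟨h1, h2⟩
  · intro i _ hi
    simp only [step]
    refine Set.indicator_of_notMem (fun hmem => hi ?_) _
    have hlt : ∀ m l : ℕ, (m : ℝ≥0) * δ < (l : ℝ≥0) * δ → m < l := fun m l h => by
      by_contra hle
      refine absurd h (not_lt.2 ?_)
      gcongr
      exact not_lt.1 hle
    have e1 := hlt _ _ (hmem.1.trans_le h2)
    have e2 := hlt _ _ (h1.trans_le hmem.2)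
    ext
    simp only
    omega
  · exact fun h => absurd (Finset.mem_univ _) h

lemma eval_step_of_gt {τ : ℝ≥0} (h : k * δ < τ) (ω : Ω) :
    (step hks c hc hc2).eval τ ω = 0 := by
  refine Finset.sum_eq_zero fun i _ => Set.indicator_of_notMem (fun hmem => ?_) _
  refine absurd (h.trans_le hmem.2) (not_lt.2 ?_)
  simp only [step]
  gcongr
  exact i.2

lemma integral_step (M : ℝ≥0 → Ω → ℝ) (ω : Ω) :
    (step hks c hc hc2).integral M ω =
      ∑ j ∈ Finset.range k, c j ω * (M ((j + 1 : ℕ) * δ) ω - M (j * δ) ω) := by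
  rw [integral, ← Fin.sum_univ_eq_sum_range
    (fun j => c j ω * (M ((j + 1 : ℕ) * δ) ω - M (j * δ) ω)) k]
  rfl

variable {T : ℝ≥0} {ι : Type} [Fintype ι]

lemma integrableOn_eval_and_integral (P : ElemProcess 𝓕 μ T ι) (ω : Ω) :
    Integrable (fun u : ℝ => P.eval u.toNNReal ω) (volume.restrict (Set.Ioc (0 : ℝ) T)) ∧
    ∫ u in Set.Ioc (0 : ℝ) T, P.eval u.toNNReal ω =
      ∑ i, P.coef i ω * ((P.right i : ℝ) - P.left i) := by
  have he : ∀ u : ℝ, P.eval u.toNNReal ω =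
      ∑ i, (Set.Ioc (P.left i : ℝ) (P.right i)).indicator (fun _ => P.coef i ω) u := fun u => by
    simp only [eval, Set.indicator, toNNReal_mem_Ioc_iff]
  have hi : ∀ i, Integrable ((Set.Ioc (P.left i : ℝ) (P.right i)).indicator fun _ => P.coef i ω)
      (volume.restrict (Set.Ioc (0 : ℝ) T)) := fun i =>
    (integrable_const _).indicator measurableSet_Ioc
  simp_rw [he]
  refine ⟨integrable_finsetSum _ fun i _ => hi i, ?_⟩
  rw [integral_finsetSum _ fun i _ => hi i]
  refine Finset.sum_congr rfl fun i _ => ?_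
  rw [integral_indicator measurableSet_Ioc, Measure.restrict_restrict measurableSet_Ioc,
    Set.inter_eq_left.2, setIntegral_const, Real.volume_real_Ioc_of_le
      (by exact_mod_cast P.le i), smul_eq_mul, mul_comm]
  exact Set.Ioc_subset_Ioc (NNReal.coe_nonneg _) (by exact_mod_cast P.le_T i)

lemma integral_eval_step (ω : Ω) :
    ∫ u in Set.Ioc (0 : ℝ) s, (step hks c hc hc2).eval u.toNNReal ω =
      ∑ j ∈ Finset.range k, δ * c j ω := by
  rw [((step hks c hc hc2).integrableOn_eval_and_integral ω).2,
    ← Fin.sum_univ_eq_sum_range (fun j => δ * c j ω) k]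
  refine Finset.sum_congr rfl fun i _ => ?_
  simp only [step]
  push_cast
  ring

end ElemProcess

variable {d : ℕ} {a B : Site d → ℝ} {W u : ℝ≥0 → Site d → Ω → ℝ} {κ : ℝ≥0}

lemma scheme_eq_sum (κ δ : ℝ≥0) (F : Finset (Site d)) (k : ℕ) (x : Site d) (ω : Ω) :
    scheme a κ δ F W k x ω = 1 +
      ∑ j ∈ Finset.range k,
        δ * (κ * truncLaplacian a F (fun y => scheme a κ δ F W j y ω) x) +
      ∑ j ∈ Finset.range k, average a (δ * κ) F (scheme a κ δ F W j) x ω *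
        (W ((j + 1 : ℕ) * δ) x ω - W (j * δ) x ω) := by
  induction k with
  | zero => simp [scheme]
  | succ k ih =>
    have h : scheme a κ δ F W (k + 1) x ω =
        scheme a κ δ F W k x ω +
          δ * κ * truncLaplacian a F (fun y => scheme a κ δ F W k y ω) x +
          average a (δ * κ) F (scheme a κ δ F W k) x ω *
            (W ((k + 1 : ℕ) * δ) x ω - W (k * δ) x ω) := by
      rw [← average_eq]
      change (1 + _) * _ = _
      ring
    rw [h, Finset.sum_range_succ, Finset.sum_range_succ, ih]
    ring

lemma IsSolution.measurable_laplacian_toNNReal (hu : IsSolution 𝓕 μ a κ W u) (x : Site d) :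
    Measurable fun q : Ω × ℝ => laplacian a (fun y => u q.2.toNNReal y q.1) x :=
  measurable_laplacian (fun y => (hu.measurable y).comp
    ((measurable_real_toNNReal.comp measurable_snd).prodMk measurable_fst)) x

lemma ElemProcess.measurable_eval_toNNReal {T : ℝ≥0} {ι : Type} [Fintype ι]
    (P : ElemProcess 𝓕 μ T ι) : Measurable fun q : Ω × ℝ => P.eval q.2.toNNReal q.1 :=
  P.measurable_eval.comp
    ((measurable_real_toNNReal.comp measurable_snd).prodMk measurable_fst)

variable [IsProbabilityMeasure μ]

lemma IsWienerField.hasMoments_drift (hW : IsWienerField 𝓕 μ B W) (a : Site d → ℝ) (κ δ : ℝ≥0)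
    (F : Finset (Site d)) (j : ℕ) (x : Site d) :
    HasMoments (fun ω => κ * truncLaplacian a F (fun y => scheme a κ δ F W j y ω) x) μ :=
  fun _ hq => (((HasMoments.sum F fun z => (hW.hasMoments_scheme κ δ F j (x + z)).const_mul (a z))
    _ hq).sub (hW.hasMoments_scheme κ δ F j x _ hq)).const_mul _

/-- The drift of the splitting scheme. -/
def driftStep (hW : IsWienerField 𝓕 μ B W) (a : Site d → ℝ) (κ : ℝ≥0) {s δ : ℝ≥0}
    (F : Finset (Site d)) {k : ℕ} (hks : k * δ ≤ s) (x : Site d) : ElemProcess 𝓕 μ s (Fin k) :=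
  ElemProcess.step hks (fun j ω => κ * truncLaplacian a F (fun y => scheme a κ δ F W j y ω) x)
    (fun j => (measurable_truncLaplacian (hW.measurable_scheme κ δ F j) x).const_mul _)
    (fun j => hW.hasMoments_drift a κ δ F j x 2 (by simp))

/-- The noise coefficient of the splitting scheme. -/
def noiseStep (hW : IsWienerField 𝓕 μ B W) (a : Site d → ℝ) (κ : ℝ≥0) {s δ : ℝ≥0}
    (F : Finset (Site d)) {k : ℕ} (hks : k * δ ≤ s) (x : Site d) : ElemProcess 𝓕 μ s (Fin k) :=
  ElemProcess.step hks (fun j => average a (δ * κ) F (scheme a κ δ F W j) x)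
    (fun j => measurable_average (hW.measurable_scheme κ δ F j) x)
    (fun j => hasMoments_average (hW.hasMoments_scheme κ δ F j) x 2 (by simp))

/-- The distance of a solution to the splitting scheme is controlled by the distances of the
drifts and of the noise coefficients. -/
lemma IsSolution.lintegral_sub_scheme_sq_le (hu : IsSolution 𝓕 μ a κ W u)
    (hW : IsWienerField 𝓕 μ B W) (hB : 0 ≤ B 0) {s δ : ℝ≥0} (F : Finset (Site d)) {k : ℕ}
    (hks : k * δ ≤ s) (x : Site d) :
    ∫⁻ ω, ‖u s x ω - scheme a κ δ F W k x ω‖ₑ ^ 2 ∂μ ≤ ∫⁻ τ in Set.Ioc (0 : ℝ) s,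
      (2 * s * ∫⁻ ω, ‖κ * laplacian a (fun y => u τ.toNNReal y ω) x -
        (driftStep hW a κ F hks x).eval τ.toNNReal ω‖ₑ ^ 2 ∂μ +
      8 * ENNReal.ofReal (B 0) * ∫⁻ ω, ‖u τ.toNNReal x ω -
        (noiseStep hW a κ F hks x).eval τ.toNNReal ω‖ₑ ^ 2 ∂μ) := by
  set Q := driftStep hW a κ F hks x with hQ
  set P := noiseStep hW a κ F hks x with hP
  set I : Ω → ℝ := fun ω =>
    u s x ω - 1 - ∫ τ in (0 : ℝ)..s, κ * laplacian a (fun y => u τ.toNNReal y ω) x with hI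
  have hmL : Measurable fun q : Ω × ℝ =>
      (κ : ℝ) * laplacian a (fun y => u q.2.toNNReal y q.1) x :=
    (hu.measurable_laplacian_toNNReal x).const_mul _
  have hm1 : Measurable fun q : Ω × ℝ => ‖κ * laplacian a (fun y => u q.2.toNNReal y q.1) x -
      Q.eval q.2.toNNReal q.1‖ₑ ^ 2 := (hmL.sub Q.measurable_eval_toNNReal).enorm.pow_const 2
  have hm2 : Measurable fun q : Ω × ℝ => ‖u q.2.toNNReal x q.1 -
      P.eval q.2.toNNReal q.1‖ₑ ^ 2 := (((hu.measurable x).comp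
    ((measurable_real_toNNReal.comp measurable_snd).prodMk measurable_fst)).sub
      P.measurable_eval_toNNReal).enorm.pow_const 2
  have hpt : ∀ ω, ‖u s x ω - scheme a κ δ F W k x ω‖ₑ ^ 2 ≤
      2 * ‖I ω - P.integral (fun r => W r x) ω‖ₑ ^ 2 +
      2 * (s * ∫⁻ τ in Set.Ioc (0 : ℝ) s, ‖κ * laplacian a (fun y => u τ.toNNReal y ω) x -
        Q.eval τ.toNNReal ω‖ₑ ^ 2) := by
    intro ω
    have hsch := scheme_eq_sum (a := a) (W := W) κ δ F k x ω
    have e1 : ∫ τ in Set.Ioc (0 : ℝ) s, Q.eval τ.toNNReal ω = ∑ j ∈ Finset.range k,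
        δ * (κ * truncLaplacian a F (fun y => scheme a κ δ F W j y ω) x) :=
      ElemProcess.integral_eval_step _ _ _ ω
    have e2 : P.integral (fun r => W r x) ω = ∑ j ∈ Finset.range k,
        average a (δ * κ) F (scheme a κ δ F W j) x ω *
          (W ((j + 1 : ℕ) * δ) x ω - W (j * δ) x ω) :=
      ElemProcess.integral_step _ _ _ _ ω
    have e3 : u s x ω - scheme a κ δ F W k x ω = (I ω - P.integral (fun r => W r x) ω) +
        ((∫ τ in Set.Ioc (0 : ℝ) s, κ * laplacian a (fun y => u τ.toNNReal y ω) x) -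
          ∫ τ in Set.Ioc (0 : ℝ) s, Q.eval τ.toNNReal ω) := by
      rw [hsch, e1, e2, hI]
      simp only [intervalIntegral.integral_of_le (NNReal.coe_nonneg s)]
      ring
    rw [e3]
    refine (enorm_add_sq_le _ _).trans ?_
    gcongr
    have hmω : Measurable fun τ : ℝ => (κ : ℝ) * laplacian a (fun y => u τ.toNNReal y ω) x :=
      Measurable.of_uncurry_left (f := fun (ω : Ω) (τ : ℝ) =>
        (κ : ℝ) * laplacian a (fun y => u τ.toNNReal y ω) x) hmL
    refine (enorm_integral_sub_sq_le (volume.restrict (Set.Ioc (0 : ℝ) s))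
      hmω.aestronglyMeasurable (Q.integrableOn_eval_and_integral ω).1).trans ?_
    rw [Measure.restrict_apply_univ, Real.volume_Ioc, sub_zero, ENNReal.ofReal_coe_nnreal]
  have hmi : Measurable fun ω => ∫⁻ τ in Set.Ioc (0 : ℝ) s,
      ‖κ * laplacian a (fun y => u τ.toNNReal y ω) x - Q.eval τ.toNNReal ω‖ₑ ^ 2 :=
    hm1.lintegral_prod_right'
  have hIto := (hu.equation s x).lintegral_sub_le hW hB x (hu.measurable x) P
  have hmo1 : Measurable fun τ : ℝ => ∫⁻ ω, ‖κ * laplacian a (fun y => u τ.toNNReal y ω) x -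
      Q.eval τ.toNNReal ω‖ₑ ^ 2 ∂μ := hm1.lintegral_prod_left'
  calc _ ≤ _ := lintegral_mono hpt
    _ = 2 * (∫⁻ ω, ‖I ω - P.integral (fun r => W r x) ω‖ₑ ^ 2 ∂μ) + 2 * (s *
          ∫⁻ ω, ∫⁻ τ in Set.Ioc (0 : ℝ) s, ‖κ * laplacian a (fun y => u τ.toNNReal y ω) x -
            Q.eval τ.toNNReal ω‖ₑ ^ 2 ∂volume ∂μ) := by
        rw [lintegral_add_right _ ((hmi.const_mul _).const_mul _),
          lintegral_const_mul' _ _ (by simp), lintegral_const_mul' _ _ (by simp),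
          lintegral_const_mul' _ _ (by simp)]
    _ ≤ 2 * (4 * ENNReal.ofReal (B 0) * ∫⁻ ω, ∫⁻ τ in Set.Ioc (0 : ℝ) s,
          ‖u τ.toNNReal x ω - P.eval τ.toNNReal ω‖ₑ ^ 2 ∂volume ∂μ) + 2 * (s *
          ∫⁻ ω, ∫⁻ τ in Set.Ioc (0 : ℝ) s, ‖κ * laplacian a (fun y => u τ.toNNReal y ω) x -
            Q.eval τ.toNNReal ω‖ₑ ^ 2 ∂volume ∂μ) := by gcongr
    _ = _ := by
        have sw1 := lintegral_lintegral_swap (μ := μ) (ν := volume.restrict (Set.Ioc (0 : ℝ) s))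
          (f := fun ω τ => ‖κ * laplacian a (fun y => u τ.toNNReal y ω) x -
            Q.eval τ.toNNReal ω‖ₑ ^ 2) hm1.aemeasurable
        have sw2 := lintegral_lintegral_swap (μ := μ) (ν := volume.restrict (Set.Ioc (0 : ℝ) s))
          (f := fun ω τ => ‖u τ.toNNReal x ω - P.eval τ.toNNReal ω‖ₑ ^ 2) hm2.aemeasurable
        rw [sw1, sw2, lintegral_add_left (hmo1.const_mul _), lintegral_const_mul' _ _
            (ENNReal.mul_ne_top (by simp) (by simp)), lintegral_const_mul' _ _
            (ENNReal.mul_ne_top (by simp) (by simp))]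
        ring

/-- The weighted distance of a solution to the splitting scheme. -/
lemma IsSolution.weightedSq_sub_scheme_le (hu : IsSolution 𝓕 μ a κ W u)
    (hW : IsWienerField 𝓕 μ B W) (hB : 0 ≤ B 0) (ρ : Site d → ℝ) {s δ : ℝ≥0}
    (F : Finset (Site d)) {k : ℕ} (hks : k * δ ≤ s) :
    weightedSq ρ μ (fun x ω => u s x ω - scheme a κ δ F W k x ω) ≤ ∫⁻ τ in Set.Ioc (0 : ℝ) s,
      (2 * s * weightedSq ρ μ (fun x ω => κ * laplacian a (fun y => u τ.toNNReal y ω) x -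
        (driftStep hW a κ F hks x).eval τ.toNNReal ω) +
      8 * ENNReal.ofReal (B 0) * weightedSq ρ μ (fun x ω => u τ.toNNReal x ω -
        (noiseStep hW a κ F hks x).eval τ.toNNReal ω)) := by
  have hm1 : ∀ x, Measurable fun τ : ℝ => ∫⁻ ω, ‖κ * laplacian a (fun y => u τ.toNNReal y ω) x -
      (driftStep hW a κ F hks x).eval τ.toNNReal ω‖ₑ ^ 2 ∂μ := fun x =>
    Measurable.lintegral_prod_left' (f := fun q : Ω × ℝ =>
      ‖κ * laplacian a (fun y => u q.2.toNNReal y q.1) x -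
        (driftStep hW a κ F hks x).eval q.2.toNNReal q.1‖ₑ ^ 2)
      ((((hu.measurable_laplacian_toNNReal x).const_mul _).sub
        (driftStep hW a κ F hks x).measurable_eval_toNNReal).enorm.pow_const 2)
  have hm2 : ∀ x, Measurable fun τ : ℝ => ∫⁻ ω, ‖u τ.toNNReal x ω -
      (noiseStep hW a κ F hks x).eval τ.toNNReal ω‖ₑ ^ 2 ∂μ := fun x =>
    Measurable.lintegral_prod_left' (f := fun q : Ω × ℝ =>
      ‖u q.2.toNNReal x q.1 - (noiseStep hW a κ F hks x).eval q.2.toNNReal q.1‖ₑ ^ 2)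
      ((((hu.measurable x).comp ((measurable_real_toNNReal.comp measurable_snd).prodMk
        measurable_fst)).sub
          (noiseStep hW a κ F hks x).measurable_eval_toNNReal).enorm.pow_const 2)
  have hm3 : ∀ x, Measurable fun τ : ℝ => ENNReal.ofReal (ρ x) *
      (2 * s * ∫⁻ ω, ‖κ * laplacian a (fun y => u τ.toNNReal y ω) x -
        (driftStep hW a κ F hks x).eval τ.toNNReal ω‖ₑ ^ 2 ∂μ +
      8 * ENNReal.ofReal (B 0) * ∫⁻ ω, ‖u τ.toNNReal x ω -
        (noiseStep hW a κ F hks x).eval τ.toNNReal ω‖ₑ ^ 2 ∂μ) := fun x =>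
    (((hm1 x).const_mul _).add ((hm2 x).const_mul _)).const_mul _
  refine (ENNReal.tsum_le_tsum fun x =>
    mul_le_mul_right (hu.lintegral_sub_scheme_sq_le hW hB F hks x) _).trans (le_of_eq ?_)
  simp_rw [← lintegral_const_mul' _ _ ENNReal.ofReal_ne_top]
  rw [← lintegral_tsum fun x => (hm3 x).aemeasurable]
  refine lintegral_congr fun τ => ?_
  rw [weightedSq, weightedSq, ← ENNReal.tsum_mul_left, ← ENNReal.tsum_mul_left,
    ← ENNReal.tsum_add]
  exact tsum_congr fun x => by ring

end

section

variable {Ω : Type*} {mΩ : MeasurableSpace Ω} {μ : Measure Ω} {𝓕 : Filtration ℝ≥0 mΩ} {d : ℕ}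
  {a B ρ : Site d → ℝ} {W u : ℝ≥0 → Site d → Ω → ℝ} {κ : ℝ≥0}

lemma weightedSq_const_mul (c : ℝ≥0) (f : Site d → Ω → ℝ) :
    weightedSq ρ μ (fun x ω => c * f x ω) = (c : ℝ≥0∞) ^ 2 * weightedSq ρ μ f := by
  rw [weightedSq, weightedSq, ← ENNReal.tsum_mul_left]
  refine tsum_congr fun x => ?_
  simp_rw [enorm_mul, mul_pow]
  rw [lintegral_const_mul' _ _ (by simp), Real.enorm_of_nonneg c.coe_nonneg, ENNReal.ofReal_coe_nnreal]
  ring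

lemma weightedSq_mono {f g : Site d → Ω → ℝ} (h : ∀ x ω, f x ω = g x ω) :
    weightedSq ρ μ f = weightedSq ρ μ g := by
  rw [show f = g from funext fun x => funext (h x)]

lemma lintegral_Ioc_bounds {τ : ℝ} {j : ℕ} {δ : ℝ≥0}
    (h : τ ∈ Set.Ioc ((j : ℝ) * δ) ((j + 1 : ℕ) * δ)) :
    (j : ℝ≥0) * δ < τ.toNNReal ∧ τ.toNNReal ≤ (j + 1 : ℕ) * δ := by
  refine ⟨Real.lt_toNNReal_iff_coe_lt.2 ?_, Real.toNNReal_le_iff_le_coe.2 ?_⟩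
  · simpa using h.1
  · simpa using h.2

variable [IsProbabilityMeasure μ]

/-- Discrete Gronwall estimate for the distance of a solution to the splitting scheme. -/
lemma IsSolution.weightedSq_sub_scheme_le_pow (hu : IsSolution 𝓕 μ a κ W u)
    (hW : IsWienerField 𝓕 μ B W) (hB : 0 ≤ B 0) (ha : IsJumpLaw a) {C : ℝ≥0∞}
    (hC : ∀ g : Site d → ℝ≥0∞,
      ∑' x, ENNReal.ofReal (ρ x) * ∑' z, ENNReal.ofReal (a z) * g (x + z) ≤
        C * ∑' x, ENNReal.ofReal (ρ x) * g x)
    {t δ : ℝ≥0} (F : Finset (Site d)) {S M K L N : ℝ≥0∞} {n : ℕ}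
    (hS : ∀ j ≤ n, ∀ x, ∫⁻ ω, ‖scheme a κ δ F W j x ω‖ₑ ^ 2 ∂μ ≤ S)
    (hM : ∀ τ ≤ t, weightedSq ρ μ (u τ) ≤ M)
    (hK : K = 2 * t * (κ ^ 2 * (4 * C + 2)) + 16 * ENNReal.ofReal (B 0))
    (hL : L = 2 * t * (κ ^ 2 * (4 * S * ENNReal.ofReal (1 - ∑ z ∈ F, a z) *
        ∑' x, ENNReal.ofReal (ρ x))) +
      8 * ENNReal.ofReal (B 0) * (2 * ENNReal.ofReal ((δ * κ : ℝ) ^ 2) *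
        ((4 * C + 6) * S * ∑' x, ENNReal.ofReal (ρ x))))
    (hN : N = 2 * t * (κ ^ 2 * ((4 * C + 2) * M)) + 8 * ENNReal.ofReal (B 0) * M) :
    ∀ k ≤ n, ∀ s : ℝ≥0, k * δ ≤ s → s ≤ (k + 1 : ℕ) * δ → s ≤ t →
      weightedSq ρ μ (fun x ω => u s x ω - scheme a κ δ F W k x ω) ≤
        (t * L + δ * N) * (1 + δ * K) ^ k := by
  intro k
  induction k using Nat.strong_induction_on with
  | _ k ih =>
  intro hkn s hks hsk hst
  set A := t * L + δ * N with hA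
  have hst' : (s : ℝ≥0∞) ≤ t := by exact_mod_cast hst
  have hmeas : ∀ τ x, Measurable (u τ x) := fun τ x => (hu.adapted τ x).mono (𝓕.le τ) le_rfl
  have hmS : ∀ j x, Measurable (scheme a κ δ F W j x) := fun j x =>
    (hW.measurable_scheme κ δ F j x).mono (𝓕.le _) le_rfl
  refine (hu.weightedSq_sub_scheme_le hW hB ρ F hks).trans ?_
  have hbound := lintegral_Ioc_le_sum δ (k := k) (s := (s : ℝ)) (h := fun τ : ℝ =>
      (2 * s * weightedSq ρ μ (fun x ω => κ * laplacian a (fun y => u τ.toNNReal y ω) x -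
        (driftStep hW a κ F hks x).eval τ.toNNReal ω) +
      8 * ENNReal.ofReal (B 0) * weightedSq ρ μ (fun x ω => u τ.toNNReal x ω -
        (noiseStep hW a κ F hks x).eval τ.toNNReal ω)))
      (c := fun j => if j = k then N else K * (A * (1 + δ * K) ^ j) + L)
      (by exact_mod_cast hsk) ?_
  · refine hbound.trans ?_
    rw [Finset.sum_range_succ, if_pos rfl]
    have h1 : ∑ j ∈ Finset.range k, (δ : ℝ≥0∞) * (if j = k then N else
        K * (A * (1 + δ * K) ^ j) + L) =
        δ * K * ∑ j ∈ Finset.range k, A * (1 + δ * K) ^ j + (k * δ) * L := by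
      rw [Finset.mul_sum]
      have h2 : ((k : ℝ≥0∞) * δ) * L = ∑ j ∈ Finset.range k, δ * L := by
        rw [Finset.sum_const, Finset.card_range, nsmul_eq_mul, mul_assoc]
      rw [h2, ← Finset.sum_add_distrib]
      refine Finset.sum_congr rfl fun j hj => ?_
      rw [if_neg (Finset.mem_range.1 hj).ne]
      ring
    rw [h1, ← sum_range_mul_pow_add]
    have h3 : (k : ℝ≥0∞) * δ ≤ t := by exact_mod_cast hks.trans hst
    calc _ ≤ δ * K * ∑ j ∈ Finset.range k, A * (1 + δ * K) ^ j + t * L + δ * N := by gcongr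
      _ = _ := by rw [hA]; ring
  · intro j hjk τ hτ hτs
    have hτb := lintegral_Ioc_bounds hτ
    have hτt : τ.toNNReal ≤ t := (Real.toNNReal_le_iff_le_coe.2 hτs).trans hst
    rcases hjk.eq_or_lt with rfl | hjk
    · simp only [if_true]
      have e1 : weightedSq ρ μ (fun x ω => κ * laplacian a (fun y => u τ.toNNReal y ω) x -
          (driftStep hW a κ F hks x).eval τ.toNNReal ω) ≤ κ ^ 2 * ((4 * C + 2) * M) := by
        rw [weightedSq_mono (g := fun x ω => κ * (laplacian a (fun y => u τ.toNNReal y ω) x -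
            truncLaplacian a F (fun y => (fun _ _ => 0 : Site d → Ω → ℝ) y ω) x)) fun x ω => by
          rw [driftStep, ElemProcess.eval_step_of_gt _ _ _ hτb.1]
          simp [truncLaplacian], weightedSq_const_mul]
        gcongr
        refine (weightedSq_laplacian_sub_le ha hC F (hmeas _) (fun _ => measurable_const)
          (S := 0) (by simp)).trans ?_
        simp only [mul_zero, zero_mul, add_zero, sub_zero]
        gcongr
        exact hM _ hτt
      have e2 : weightedSq ρ μ (fun x ω => u τ.toNNReal x ω -
          (noiseStep hW a κ F hks x).eval τ.toNNReal ω) ≤ M := by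
        rw [weightedSq_mono (g := u τ.toNNReal) fun x ω => by
          rw [noiseStep, ElemProcess.eval_step_of_gt _ _ _ hτb.1, sub_zero]]
        exact hM _ hτt
      rw [hN]
      gcongr
    · rw [if_neg hjk.ne]
      have hD := ih j hjk (hjk.le.trans hkn) τ.toNNReal hτb.1.le hτb.2 hτt
      set D := A * (1 + δ * K) ^ j
      have e1 : weightedSq ρ μ (fun x ω => κ * laplacian a (fun y => u τ.toNNReal y ω) x -
          (driftStep hW a κ F hks x).eval τ.toNNReal ω) ≤ κ ^ 2 * ((4 * C + 2) * D +
          4 * S * ENNReal.ofReal (1 - ∑ z ∈ F, a z) * ∑' x, ENNReal.ofReal (ρ x)) := by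
        rw [weightedSq_mono (g := fun x ω => κ * (laplacian a (fun y => u τ.toNNReal y ω) x -
            truncLaplacian a F (fun y => scheme a κ δ F W j y ω) x)) fun x ω => by
          rw [driftStep, ElemProcess.eval_step_of_lt _ _ _ hjk hτb.1 hτb.2, mul_sub],
          weightedSq_const_mul]
        gcongr
        refine (weightedSq_laplacian_sub_le ha hC F (hmeas _) (hmS j)
          (hS j (hjk.le.trans hkn))).trans ?_
        gcongr
      have e2 : weightedSq ρ μ (fun x ω => u τ.toNNReal x ω -
          (noiseStep hW a κ F hks x).eval τ.toNNReal ω) ≤ 2 * D +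
          2 * ENNReal.ofReal ((δ * κ : ℝ) ^ 2) *
            ((4 * C + 6) * S * ∑' x, ENNReal.ofReal (ρ x)) := by
        rw [weightedSq_mono (g := fun x ω => u τ.toNNReal x ω -
            average a (δ * κ) F (scheme a κ δ F W j) x ω) fun x ω => by
          rw [noiseStep, ElemProcess.eval_step_of_lt _ _ _ hjk hτb.1 hτb.2]]
        refine (weightedSq_sub_average_le ha hC F (hmS j) (hS j (hjk.le.trans hkn)) _).trans ?_
        gcongr
      calc _ ≤ 2 * t * (κ ^ 2 * ((4 * C + 2) * D +
          4 * S * ENNReal.ofReal (1 - ∑ z ∈ F, a z) * ∑' x, ENNReal.ofReal (ρ x))) +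
          8 * ENNReal.ofReal (B 0) * (2 * D + 2 * ENNReal.ofReal ((δ * κ : ℝ) ^ 2) *
            ((4 * C + 6) * S * ∑' x, ENNReal.ofReal (ρ x))) := by gcongr
        _ = K * D + L := by rw [hK, hL]; ring

/-- The splitting scheme converges in mean square to the solution. -/
theorem IsSolution.tendsto_lintegral_sub_scheme_sq (hu : IsSolution 𝓕 μ a κ W u)
    (hW : IsWienerField 𝓕 μ B W) (ha : IsJumpLaw a) {β : ℝ} (hβ : 0 ≤ β) (hB : ∀ x, |B x| ≤ β)
    (hB0 : 0 ≤ B 0)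
    {F : ℕ → Finset (Site d)} (hF : Tendsto (fun n => ∑ z ∈ F n, a z) atTop (𝓝 1)) (t : ℝ≥0)
    (x : Site d) :
    Tendsto (fun n : ℕ => ∫⁻ ω, ‖u t x ω - scheme a κ (t / n) (F n) W n x ω‖ₑ ^ 2 ∂μ)
      atTop (𝓝 0) := by
  obtain ⟨ρ, hρ, hsq⟩ := hu.square_bound
  obtain ⟨M, hM⟩ := hsq t
  obtain ⟨C, hC⟩ := hρ.exists_tsum_average_le ha
  obtain ⟨S, hS⟩ := hW.exists_integral_scheme_pow_le ha hβ hB hF κ t 2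
  set R := ∑' x, ENNReal.ofReal (ρ x) with hR
  have hRtop : R ≠ ⊤ := hρ.tsum_ne_top
  set v := ENNReal.ofReal (B 0) with hv
  set K : ℝ≥0∞ := 2 * t * (κ ^ 2 * (4 * C + 2)) + 16 * v with hK
  set N : ℝ≥0∞ := 2 * t * (κ ^ 2 * ((4 * C + 2) * M)) + 8 * v * M with hN
  set L : ℕ → ℝ≥0∞ := fun n => 2 * t * (κ ^ 2 * (4 * ENNReal.ofReal S *
    ENNReal.ofReal (1 - ∑ z ∈ F n, a z) * R)) +
      8 * v * (2 * ENNReal.ofReal (((t / n : ℝ≥0) * κ : ℝ) ^ 2) *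
        ((4 * C + 6) * ENNReal.ofReal S * R)) with hL
  have hKtop : K ≠ ⊤ := by
    simp [hK, hv, ENNReal.mul_eq_top, ENNReal.add_eq_top]
  have hNtop : N ≠ ⊤ := by
    simp [hN, hv, ENNReal.mul_eq_top, ENNReal.add_eq_top]
  have hδ : Tendsto (fun n : ℕ => ((t / n : ℝ≥0) : ℝ≥0∞)) atTop (𝓝 0) := by
    rw [← ENNReal.coe_zero, ENNReal.tendsto_coe]
    exact tendsto_const_div_atTop_nhds_zero_nat t
  have hE : Tendsto (fun n => ENNReal.ofReal (1 - ∑ z ∈ F n, a z)) atTop (𝓝 0) := by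
    have := ENNReal.tendsto_ofReal (hF.const_sub 1)
    simpa using this
  have hδκ : Tendsto (fun n : ℕ => ENNReal.ofReal (((t / n : ℝ≥0) * κ : ℝ) ^ 2)) atTop (𝓝 0) := by
    have h1 : Tendsto (fun n : ℕ => ((t / n : ℝ≥0) : ℝ)) atTop (𝓝 0) := by
      rw [← NNReal.coe_zero, NNReal.tendsto_coe]
      exact tendsto_const_div_atTop_nhds_zero_nat t
    have := ENNReal.tendsto_ofReal ((h1.mul_const (κ : ℝ)).pow 2)
    simpa using this
  have hLlim : Tendsto L atTop (𝓝 0) := by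
    have h1 : Tendsto L atTop (𝓝 (2 * t * (κ ^ 2 * (4 * ENNReal.ofReal S * 0 * R)) +
        8 * v * (2 * 0 * ((4 * C + 6) * ENNReal.ofReal S * R)))) := by
      refine Tendsto.add ?_ ?_
      · refine ENNReal.Tendsto.const_mul (ENNReal.Tendsto.const_mul (ENNReal.Tendsto.mul_const
          (ENNReal.Tendsto.const_mul hE ?_) ?_) ?_) ?_ <;>
        simp [ENNReal.mul_eq_top, hRtop]
      · refine ENNReal.Tendsto.const_mul (ENNReal.Tendsto.mul_const
          (ENNReal.Tendsto.const_mul hδκ ?_) ?_) ?_ <;>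
        simp [ENNReal.mul_eq_top, ENNReal.add_eq_top, hRtop, hv]
    simpa using h1
  have hpow : ∀ n : ℕ, (1 + ((t / n : ℝ≥0) : ℝ≥0∞) * K) ^ n ≤
      ENNReal.ofReal (Real.exp (t * K.toReal)) := by
    intro n
    lift K to ℝ≥0 using hKtop with K'
    have h1 : (1 + ((t / n : ℝ≥0) : ℝ≥0∞) * K') =
        ENNReal.ofReal (1 + ((t / n : ℝ≥0) : ℝ) * K') := by
      rw [ENNReal.ofReal_add zero_le_one (by positivity), ENNReal.ofReal_one,
        ENNReal.ofReal_mul (by positivity), ENNReal.ofReal_coe_nnreal, ENNReal.ofReal_coe_nnreal]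
    rw [h1, ← ENNReal.ofReal_pow (by positivity)]
    refine ENNReal.ofReal_le_ofReal ?_
    rcases Nat.eq_zero_or_pos n with rfl | hn
    · simpa using Real.one_le_exp (show 0 ≤ (t : ℝ) * K' by positivity)
    · calc _ ≤ Real.exp (((t / n : ℝ≥0) : ℝ) * K') ^ n := by
            gcongr
            rw [add_comm]
            exact Real.add_one_le_exp _
        _ = _ := by
            rw [← Real.exp_nat_mul]
            congr 1
            have hn0 : (n : ℝ) ≠ 0 := by exact_mod_cast hn.ne'
            push_cast
            field_simp
            simp
  have hρx : ENNReal.ofReal (ρ x) ≠ 0 := by simpa using hρ.pos x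
  have hlim : Tendsto (fun n : ℕ => (ENNReal.ofReal (ρ x))⁻¹ *
      ((t * L n + ((t / n : ℝ≥0) : ℝ≥0∞) * N) * ENNReal.ofReal (Real.exp (t * K.toReal))))
      atTop (𝓝 0) := by
    have h1 : Tendsto (fun n : ℕ => (ENNReal.ofReal (ρ x))⁻¹ *
        ((t * L n + ((t / n : ℝ≥0) : ℝ≥0∞) * N) * ENNReal.ofReal (Real.exp (t * K.toReal))))
        atTop (𝓝 ((ENNReal.ofReal (ρ x))⁻¹ *
          ((t * 0 + 0 * N) * ENNReal.ofReal (Real.exp (t * K.toReal))))) := by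
      refine ENNReal.Tendsto.const_mul (ENNReal.Tendsto.mul_const (Tendsto.add
        (ENNReal.Tendsto.const_mul hLlim ?_) (ENNReal.Tendsto.mul_const hδ ?_)) ?_) ?_
      · simp
      · exact Or.inr hNtop
      · simp
      · exact Or.inr (ENNReal.inv_ne_top.2 hρx)
    simpa using h1
  refine tendsto_of_tendsto_of_tendsto_of_le_of_le' tendsto_const_nhds hlim
    (Eventually.of_forall fun _ => zero_le) ?_
  filter_upwards [hS, eventually_gt_atTop 0] with n hS hn
  have hn0 : (n : ℝ≥0) ≠ 0 := by exact_mod_cast hn.ne'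
  have hSl : ∀ j ≤ n, ∀ x, ∫⁻ ω, ‖scheme a κ (t / n) (F n) W j x ω‖ₑ ^ 2 ∂μ ≤
      ENNReal.ofReal S := fun j hj x => by
    simp_rw [enorm_sq_eq_ofReal]
    rw [← ofReal_integral_eq_lintegral_ofReal ((hW.hasMoments_scheme _ _ _ _ _).pow 2).integrable
      (Eventually.of_forall fun ω => sq_nonneg _)]
    exact ENNReal.ofReal_le_ofReal (hS j hj x)
  have h := hu.weightedSq_sub_scheme_le_pow hW hB0 ha hC (F n) hSl (t := t) (M := M)
    (fun τ hτ => hM τ hτ) hK rfl hN n le_rfl t (by rw [mul_div_cancel₀ _ hn0])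
    (by push_cast; rw [add_mul, mul_div_cancel₀ _ hn0]; exact le_self_add) le_rfl
  rw [← ENNReal.mul_le_iff_le_inv hρx ENNReal.ofReal_ne_top]
  refine le_trans ?_ (h.trans (mul_le_mul_right (hpow n) _))
  exact ENNReal.le_tsum (f := fun x => ENNReal.ofReal (ρ x) *
    ∫⁻ ω, ‖u t x ω - scheme a κ (t / n) (F n) W n x ω‖ₑ ^ 2 ∂μ) x

end

section

lemma Hopping.exp_mul_tsum_pathWeight_pos {Γ σ : Type*} [AddCommGroup Γ] (G : Hopping Γ σ)
    {T : ℝ} (hT : 0 ≤ T) (c : ℝ) :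
    0 < Real.exp c * ∑' k : ℕ, T ^ k / k.factorial * G.pathWeight k := by
  have h := (hasSum_exp_smul_apply G.bddOp T 1).mapL (BddFun.eval (0 : Γ))
  have hs : Summable fun k : ℕ => T ^ k / k.factorial * G.pathWeight k := by
    refine h.summable.congr fun k => ?_
    rw [pathWeight, ← bddOp_pow_one_apply, BddFun.eval_apply, lp.coeFn_smul, Pi.smul_apply,
      smul_eq_mul]
  refine mul_pos (Real.exp_pos _) (hs.tsum_pos (fun k => ?_) 0 ?_)
  · exact mul_nonneg (by positivity) (pathWeight_nonneg k)
  · simp [pathWeight]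

variable {Ω : Type*} {mΩ : MeasurableSpace Ω} {μ : Measure Ω}

/-- Mean square limits inherit bounds on even moments. -/
lemma lintegral_pow_le_of_tendsto_sq {X : ℕ → Ω → ℝ} {Y : Ω → ℝ} (hX : ∀ n, Measurable (X n))
    (hY : Measurable Y) (h : Tendsto (fun n => ∫⁻ ω, ‖Y ω - X n ω‖ₑ ^ 2 ∂μ) atTop (𝓝 0))
    {r : ℕ} {C : ℝ≥0∞} (hC : ∀ᶠ n in atTop, ∫⁻ ω, ‖X n ω‖ₑ ^ r ∂μ ≤ C) :
    ∫⁻ ω, ‖Y ω‖ₑ ^ r ∂μ ≤ C := by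
  have h2 : Tendsto (fun n => eLpNorm (X n - Y) 2 μ) atTop (𝓝 0) := by
    have e : ∀ n, eLpNorm (X n - Y) 2 μ = (∫⁻ ω, ‖Y ω - X n ω‖ₑ ^ 2 ∂μ) ^ (1 / 2 : ℝ) := by
      intro n
      rw [eLpNorm_eq_lintegral_rpow_enorm_toReal (by simp) (by simp)]
      simp only [ENNReal.toReal_ofNat, ENNReal.rpow_two, Pi.sub_apply]
      congr 1
      refine lintegral_congr fun ω => ?_
      rw [← enorm_neg, neg_sub]
    simp_rw [e]
    have := ((ENNReal.continuous_rpow_const (y := (1 / 2 : ℝ))).tendsto 0).comp h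
    simpa [Function.comp_def] using this
  obtain ⟨ns, hns, hae⟩ := (tendstoInMeasure_of_tendsto_eLpNorm (by simp)
    (fun n => (hX n).aestronglyMeasurable) hY.aestronglyMeasurable h2).exists_seq_tendsto_ae
  calc ∫⁻ ω, ‖Y ω‖ₑ ^ r ∂μ = ∫⁻ ω, liminf (fun i => ‖X (ns i) ω‖ₑ ^ r) atTop ∂μ := by
        refine lintegral_congr_ae ?_
        filter_upwards [hae] with ω hω
        exact ((ENNReal.continuous_pow r).tendsto _ |>.comp hω.enorm).liminf_eq.symm
    _ ≤ liminf (fun i => ∫⁻ ω, ‖X (ns i) ω‖ₑ ^ r ∂μ) atTop :=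
        lintegral_liminf_le fun i => (hX _).enorm.pow_const r
    _ ≤ C := by
        refine liminf_le_of_frequently_le' ?_
        exact (hns.tendsto_atTop.eventually hC).frequently

lemma enorm_pow_sub_pow_le (x y : ℝ) (r : ℕ) :
    ‖x ^ (r + 1) - y ^ (r + 1)‖ₑ ≤
      ‖y - x‖ₑ * ((r + 1 : ℕ) * max ‖x‖ₑ ‖y‖ₑ ^ r) := by
  have h := abs_pow_sub_pow_le x y (r + 1)
  rw [Nat.add_sub_cancel, abs_sub_comm x y] at h
  have e : max ‖x‖ₑ ‖y‖ₑ = ENNReal.ofReal (max |x| |y|) := by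
    rw [ENNReal.ofReal_max, Real.enorm_eq_ofReal_abs, Real.enorm_eq_ofReal_abs]
  rw [e, Real.enorm_eq_ofReal_abs, Real.enorm_eq_ofReal_abs,
    ← ENNReal.ofReal_pow (by positivity), ← ENNReal.ofReal_natCast,
    ← ENNReal.ofReal_mul (by positivity), ← ENNReal.ofReal_mul (by positivity)]
  refine ENNReal.ofReal_le_ofReal (h.trans (le_of_eq ?_))
  ring

/-- Moments converge along mean square convergent sequences with bounded higher moments. -/
theorem tendsto_integral_pow_of_tendsto_sq {X : ℕ → Ω → ℝ} {Y : Ω → ℝ}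
    (hX : ∀ n, Measurable (X n)) (hY : Measurable Y)
    (h : Tendsto (fun n => ∫⁻ ω, ‖Y ω - X n ω‖ₑ ^ 2 ∂μ) atTop (𝓝 0)) {r : ℕ} {C : ℝ≥0∞}
    (hCtop : C ≠ ⊤) (hC : ∀ᶠ n in atTop, ∫⁻ ω, ‖X n ω‖ₑ ^ (2 * r) ∂μ ≤ C)
    (hi : ∀ n, Integrable (fun ω => X n ω ^ (r + 1)) μ) :
    Integrable (fun ω => Y ω ^ (r + 1)) μ ∧
      Tendsto (fun n => ∫ ω, X n ω ^ (r + 1) ∂μ) atTop (𝓝 (∫ ω, Y ω ^ (r + 1) ∂μ)) := by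
  have hYC := lintegral_pow_le_of_tendsto_sq hX hY h hC
  have hbound : ∀ᶠ n in atTop, ∫⁻ ω, ‖X n ω ^ (r + 1) - Y ω ^ (r + 1)‖ₑ ∂μ ≤
      (∫⁻ ω, ‖Y ω - X n ω‖ₑ ^ 2 ∂μ) ^ (1 / 2 : ℝ) *
        (((r + 1 : ℕ) : ℝ≥0∞) ^ 2 * (C + C)) ^ (1 / 2 : ℝ) := by
    filter_upwards [hC] with n hC
    have hm1 : Measurable fun ω => ‖Y ω - X n ω‖ₑ := (hY.sub (hX n)).enorm
    have hm2 : Measurable fun ω => ((r + 1 : ℕ) : ℝ≥0∞) * max ‖X n ω‖ₑ ‖Y ω‖ₑ ^ r :=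
      (((hX n).enorm.max hY.enorm).pow_const r).const_mul _
    have hH := ENNReal.lintegral_mul_le_Lp_mul_Lq μ Real.HolderConjugate.two_two
      hm1.aemeasurable hm2.aemeasurable
    simp only [Pi.mul_apply, ENNReal.rpow_two] at hH
    refine (lintegral_mono fun ω => enorm_pow_sub_pow_le _ _ r).trans (hH.trans ?_)
    gcongr
    calc ∫⁻ ω, (((r + 1 : ℕ) : ℝ≥0∞) * max ‖X n ω‖ₑ ‖Y ω‖ₑ ^ r) ^ 2 ∂μ
        ≤ ∫⁻ ω, ((r + 1 : ℕ) : ℝ≥0∞) ^ 2 * (‖X n ω‖ₑ ^ (2 * r) + ‖Y ω‖ₑ ^ (2 * r)) ∂μ := by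
          refine lintegral_mono fun ω => ?_
          rw [mul_pow, ← pow_mul, mul_comm r 2]
          gcongr
          rcases le_total ‖X n ω‖ₑ ‖Y ω‖ₑ with hle | hle
          · rw [max_eq_right hle]; exact le_add_self
          · rw [max_eq_left hle]; exact le_self_add
      _ ≤ _ := by
          rw [lintegral_const_mul' _ _ (by simp), lintegral_add_right _ (hY.enorm.pow_const _)]
          gcongr
  have hlim : Tendsto (fun n => ∫⁻ ω, ‖X n ω ^ (r + 1) - Y ω ^ (r + 1)‖ₑ ∂μ) atTop (𝓝 0) := by
    have h1 := ((ENNReal.continuous_rpow_const (y := (1 / 2 : ℝ))).tendsto 0).comp h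
    have h2 := ENNReal.Tendsto.mul_const (b := (((r + 1 : ℕ) : ℝ≥0∞) ^ 2 * (C + C)) ^ (1 / 2 : ℝ))
      h1 (Or.inr (ENNReal.rpow_ne_top_of_nonneg (by norm_num) (ENNReal.mul_ne_top (by simp)
        (ENNReal.add_ne_top.2 ⟨hCtop, hCtop⟩))))
    rw [ENNReal.zero_rpow_of_pos (by norm_num), zero_mul] at h2
    exact tendsto_of_tendsto_of_tendsto_of_le_of_le' tendsto_const_nhds h2
      (Eventually.of_forall fun _ => zero_le) hbound
  have hint : Integrable (fun ω => Y ω ^ (r + 1)) μ := by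
    obtain ⟨n, hn⟩ := (hlim.eventually (gt_mem_nhds (zero_lt_one (α := ℝ≥0∞)))).exists
    have hd : Integrable (fun ω => X n ω ^ (r + 1) - Y ω ^ (r + 1)) μ :=
      ⟨(((hX n).pow_const _).sub (hY.pow_const _)).aestronglyMeasurable,
        hn.trans ENNReal.one_lt_top⟩
    exact ((hi n).sub hd).congr (Eventually.of_forall fun ω => by simp)
  exact ⟨hint, tendsto_integral_of_L1 _ hint.1 (Eventually.of_forall hi) hlim⟩

section Moments

variable {𝓕 : Filtration ℝ≥0 mΩ} {d : ℕ} {a b : Site d → ℝ}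
  {W u : ℝ≥0 → Site d → Ω → ℝ} {κ : ℝ≥0} [IsProbabilityMeasure μ]

/-- The moments of a solution are given by the semigroup of the moment equation. -/
theorem IsSolution.integrable_pow_and_fieldMoment_eq (hu : IsSolution 𝓕 μ a κ W u)
    (hW : IsWienerField 𝓕 μ (correlator b) W) (ha : IsJumpLaw a) (hb : Summable fun x => |b x|)
    {p : ℕ} (hp : 1 ≤ p) (t : ℝ≥0) :
    Integrable (fun ω => u t 0 ω ^ p) μ ∧ fieldMoment μ u p t =
      Real.exp (-((numPairs p * corrBound b + 2 * p * κ) * t)) * ∑' k : ℕ,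
        (t : ℝ) ^ k / k.factorial * (particles ha (abs_correlator_le hb) p κ).pathWeight k := by
  obtain ⟨r, rfl⟩ : ∃ r, p = r + 1 := ⟨p - 1, by omega⟩
  have hβ : 0 ≤ corrBound b := corrBound_nonneg
  have hB := abs_correlator_le hb
  have hB0 : 0 ≤ correlator b 0 := tsum_nonneg fun z => by
    rw [zero_sub]; exact mul_self_nonneg _
  obtain ⟨F, hFa⟩ := exists_seq_tendsto (atTop : Filter (Finset (Site d)))
  have hF : Tendsto (fun n => ∑ z ∈ F n, a z) atTop (𝓝 1) := ha.hasSum_one.comp hFa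
  have hX : ∀ n : ℕ, Measurable (scheme a κ (t / n) (F n) W n 0) := fun n =>
    (hW.measurable_scheme κ _ _ n 0).mono (𝓕.le _) le_rfl
  have hY : Measurable (u t 0) := (hu.adapted t 0).mono (𝓕.le t) le_rfl
  have hsq := hu.tendsto_lintegral_sub_scheme_sq hW ha hβ hB hB0 hF t 0
  obtain ⟨C, hC⟩ := hW.exists_integral_scheme_pow_le ha hβ hB hF κ t (2 * r)
  have hCl : ∀ᶠ n : ℕ in atTop, ∫⁻ ω, ‖scheme a κ (t / n) (F n) W n 0 ω‖ₑ ^ (2 * r) ∂μ ≤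
      ENNReal.ofReal C := by
    filter_upwards [hC] with n hC
    have e : ∀ y : ℝ, ‖y‖ₑ ^ (2 * r) = ENNReal.ofReal (y ^ (2 * r)) := fun y => by
      rw [pow_mul, enorm_sq_eq_ofReal, ← ENNReal.ofReal_pow (sq_nonneg _), pow_mul]
    simp_rw [e]
    rw [← ofReal_integral_eq_lintegral_ofReal
      ((hW.hasMoments_scheme _ _ _ _ _).pow (2 * r)).integrable
      (Eventually.of_forall fun ω => (even_two_mul r).pow_nonneg _)]
    exact ENNReal.ofReal_le_ofReal (hC n le_rfl 0)
  obtain ⟨h1, h2⟩ := tendsto_integral_pow_of_tendsto_sq hX hY hsq ENNReal.ofReal_ne_top hCl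
    fun n => ((hW.hasMoments_scheme _ _ _ _ _).pow (r + 1)).integrable
  refine ⟨h1, ?_⟩
  have h3 := tendsto_nhds_unique h2 (hW.tendsto_integral_scheme_pow ha hβ hB hF κ t (r + 1))
  rw [← h3, fieldMoment, mixedMoment]
  simp

/-- The Lyapunov exponents of a solution. -/
theorem IsSolution.hasLyapunovExponent (hu : IsSolution 𝓕 μ a κ W u)
    (hW : IsWienerField 𝓕 μ (correlator b) W) (ha : IsJumpLaw a) (hb : Summable fun x => |b x|)
    {p : ℕ} (hp : 1 ≤ p) (hκ : 0 < κ) :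
    HasLyapunovExponent μ u p (lyapunov ha (abs_correlator_le hb) p κ) where
  integrable t := (hu.integrable_pow_and_fieldMoment_eq hW ha hb hp t).1
  moment_pos t := by
    rw [(hu.integrable_pow_and_fieldMoment_eq hW ha hb hp t).2]
    exact Hopping.exp_mul_tsum_pathWeight_pos _ t.2 _
  tendsto := by
    simp_rw [fun t => (hu.integrable_pow_and_fieldMoment_eq hW ha hb hp t).2]
    exact tendsto_log_particles ha (abs_correlator_le hb) hp hκ

end Moments

end

end Anderson

end

theorem mainTheorem2 {d : ℕ} (a b : Anderson.Site d → ℝ) (ha : Anderson.IsJumpLaw a)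
    (hb : Summable fun x => |b x|) :
    ∃ γ : ℕ → ℝ → ℝ,
      (∀ q : ℕ, 1 ≤ q → ∀ κ : ℝ, 0 < κ →
        ∀ (Ω : Type*) (mΩ : MeasurableSpace Ω) (μ : Measure Ω) (_ : IsProbabilityMeasure μ)
          (𝓕 : Filtration ℝ≥0 mΩ) (W u : ℝ≥0 → Anderson.Site d → Ω → ℝ),
          Anderson.IsWienerField 𝓕 μ (Anderson.correlator b) W →
          Anderson.IsSolution 𝓕 μ a κ W u →
          Anderson.HasLyapunovExponent μ u q (γ q κ)) ∧
      ∀ p : ℕ, 3 ≤ p → ∀ κ : ℝ, 0 < κ →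
        γ p κ / p ≤ (p / 2 : ℕ) * γ 2 (κ / p) := by
  refine ⟨fun q κ => Anderson.lyapunov ha (Anderson.abs_correlator_le hb) q κ.toNNReal, ?_, ?_⟩
  · intro q hq κ hκ Ω mΩ μ _ 𝓕 W u hW hu
    lift κ to ℝ≥0 using hκ.le
    simp only [Real.toNNReal_coe]
    exact hu.hasLyapunovExponent hW ha hb hq (by exact_mod_cast hκ)
  · intro p hp κ hκ
    have h : (κ / p).toNNReal = κ.toNNReal / p := by
      rw [Real.toNNReal_div hκ.le, Real.toNNReal_natCast]
    simp only [h]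
    exact Anderson.lyapunov_div_le ha hb (Anderson.abs_correlator_le hb) hp κ.toNNReal
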